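/- Consider point-line problems in three views: finitely many points and lines in space, a set $\mathcal I$ of point-line incidences (realizable by distinct points and lines in $\mathbb R^3$, and containing every incidence implied by the given ones), and for each view $v\in\{1,2,3\}$ the set of points and the set of lines observed in $v$, such that a view observing two lines that meet according to $\mathcal I$ also observes their intersection point. The problem is a *PL1P* if each line is incident to at most one point. A line through a point is called a *pin* of that point; a line incident to no point is *free*. Let $\mathcal X$ be the variety of tuples of points and lines in $\mathbb P^3$ satisfying the incidences in $\mathcal I$, let $\mathcal C$ be the space of triples of calibrated cameras $[R_v\mid t_v]$, $R_v\in\mathrm{SO}(3)$, normalized by $R_1=I$, $t_1=0$, $t_{2,1}=1$, let $\mathcal Y$ be the variety of triples of plane arrangements of the observed points and lines satisfying the observed incidences (all over $\mathbb C$), and let $\Phi:\mathcal X\times\mathcal C\dashrightarrow\mathcal Y$ be the joint camera map. The problem is *minimal* if for generic $y\in\mathcal Y$ the preimage $\Phi^{-1}(y)$ is nonempty and finite. Forgetting some points and lines, in space and in the views, gives a new PL1P with joint camera map $\Phi':\mathcal X'\times\mathcal C\dashrightarrow\mathcal Y'$ and projections $\Pi:\mathcal X\times\mathcal C\to\mathcal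 X'\times\mathcal C$ and $\pi:\mathcal Y\to\mathcal Y'$. The given PL1P is *reducible* to the new one if for each forgotten point at most one of its pins is kept, and for generic $S'\in\mathcal X'\times\mathcal C$ and generic $y\in\pi^{-1}(\Phi'(S'))$ there is $S\in\mathcal X\times\mathcal C$ with $\Phi(S)=y$ and $\Pi(S)=S'$. A PL1P is *reduced* if it is not reducible to another PL1P (one obtained by forgetting at least one point or line). **Theorem.** Every minimal PL1P in three views is reducible to a unique reduced PL1P, by a unique choice of forgotten points and lines. What is forgotten is exactly the following: 1. every pin that is observed in exactly two views such that both of these views also observe the point of the pin (the third view may or may not observe the point); 2. every free line that is observed in exactly two views; 3. every point that has exactly one pin, is observed in exactly one view, and whose pin is observed in all three views (the pin is kept and becomes a free line observed in all three views); 4. every point together with its single pin, if the point is observed in exactly one view and the pin is observed in exactly two views, one of which is the view observing the point. In addition, applying inverses of these reductions to a minimal PL1P in three views results in a minimal PL1P: if a PL1P becomes minimal after forgetting any collection of features of the kinds 1-4 (in 4, the point and its pin together), then it is minimal itself. -/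

import Mathlib

noncomputable section

/-! ### Point-line problems in three views -/

/-- A realization in real 3-space of an incidence relation `inc` between points and lines:
pairwise distinct points and pairwise distinct affine lines satisfying all the incidences in `inc`
(and possibly more). -/
structure RealArrangement {P L : Type*} (inc : P → L → Prop) where
  pt : P → (Fin 3 → ℝ)
  ln : L → AffineSubspace ℝ (Fin 3 → ℝ)
  finrank_ln : ∀ j, Module.finrank ℝ (ln j).direction = 1
  pt_injective : Function.Injective pt
  ln_injective : Function.Injective ln
  incident : ∀ i j, inc i j → pt i ∈ ln j

/-- A point-line problem in three views, with points labeled by `P` and lines labeled by `L`.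
`inc i j` means that the point `i` lies on the line `j`; view `v` observes exactly the points in
`seesPt v` and the lines in `seesLn v`. -/
structure PointLineProblem (P L : Type*) where
  inc : P → L → Prop
  seesPt : Fin 3 → Set P
  seesLn : Fin 3 → Set L
  /-- The incidences can be realized in real 3-space. -/
  realizable : Nonempty (RealArrangement inc)
  /-- Every incidence that is implied by the given ones is among the given ones. -/
  complete : ∀ i j, (∀ A : RealArrangement inc, A.pt i ∈ A.ln j) → inc i j
  /-- A view that observes two lines which meet according to `inc` observes their point of
  intersection. -/
  sees_meet : ∀ v i j j', j ≠ j' → inc i j → inc i j' →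
    j ∈ seesLn v → j' ∈ seesLn v → i ∈ seesPt v

/-- A PL1P: a point-line problem in which each line is incident to at most one point. -/
structure PL1P (P L : Type*) extends PointLineProblem P L where
  at_most_one : ∀ i i' j, inc i j → inc i' j → i = i'

/-! ### Arrangements, cameras and images over the complex numbers -/

/-- The Grassmannian of `k`-dimensional linear subspaces of `ℂⁿ`.  So `Gr 1 4` is the set of points
and `Gr 2 4` the set of lines of projective 3-space; `Gr 1 3` and `Gr 2 3` are the sets of points
and of lines of the projective plane. -/
abbrev Gr (k n : ℕ) : Type := {W : Submodule ℂ (Fin n → ℂ) // Module.finrank ℂ W = k}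

/-- The rows of `b` form a basis of the `k`-dimensional space `W`. -/
def Gr.IsFrame {k n : ℕ} (W : Gr k n) (b : Fin k → Fin n → ℂ) : Prop :=
  Submodule.span ℂ (Set.range b) = W.1

/-- Configurations of three (complexified) calibrated cameras `[R v | t v]`, normalized by
`R 0 = I`, `t 0 = 0` and by the first coordinate of `t 1` being `1`. -/
@[ext]
structure CameraConfig where
  R : Fin 3 → Matrix (Fin 3) (Fin 3) ℂ
  t : Fin 3 → Fin 3 → ℂ
  orthogonal : ∀ v, R v * (R v).transpose = 1
  det_eq_one : ∀ v, (R v).det = 1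
  R_zero : R 0 = 1
  t_zero : t 0 = 0
  t_one : t 1 0 = 1

/-- The `3 × 4` matrix `[R v | t v]` of the `v`-th camera. -/
def CameraConfig.matrix (C : CameraConfig) (v : Fin 3) : Matrix (Fin 3) (Fin 4) ℂ :=
  Matrix.of fun a => Fin.snoc (α := fun _ => ℂ) (C.R v a) (C.t v a)

/-- The `v`-th camera as a linear map `ℂ⁴ → ℂ³`. -/
def CameraConfig.proj (C : CameraConfig) (v : Fin 3) : (Fin 4 → ℂ) →ₗ[ℂ] (Fin 3 → ℂ) :=
  (C.matrix v).mulVecLin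

/-- A tuple of points and lines in projective 3-space (no incidences imposed yet) together with
three cameras. -/
@[ext]
structure SpaceConfig (P L : Type*) where
  pt : P → Gr 1 4
  ln : L → Gr 2 4
  cam : CameraConfig

/-- A tuple of points and lines in three projective planes, one for each observed point and line
(no incidences imposed yet). -/
@[ext]
structure ImageConfig {P L : Type*} (Q : PointLineProblem P L) where
  pt : ∀ v, Q.seesPt v → Gr 1 3
  ln : ∀ v, Q.seesLn v → Gr 2 3

/-! ### The Zariski topology and genericity -/

/-- The subset of `T` where a polynomial in the coordinates is nonzero.  Elements of `T` may have
several admissible coordinate vectors (such as homogeneous coordinates of a point in projective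
space, or bases of a linear subspace), and `coord x c` means that `c` is one of those of `x`. -/
def zariskiBasicOpen {T σ : Type*} (coord : T → (σ → ℂ) → Prop) (f : MvPolynomial σ ℂ) : Set T :=
  {x | ∃ c, coord x c ∧ MvPolynomial.eval c f ≠ 0}

/-- The Zariski topology on `T`. -/
@[reducible]
def zariskiTopology {T σ : Type*} (coord : T → (σ → ℂ) → Prop) : TopologicalSpace T :=
  TopologicalSpace.generateFrom (Set.range (zariskiBasicOpen coord))

/-- The property `p` holds for generic elements of `V`: it holds on a relatively open and dense
subset of `V`. -/
def ForGeneric {T : Type*} [TopologicalSpace T] (V : Set T) (p : T → Prop) : Prop :=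
  ∃ U : Set T, IsOpen U ∧ V ⊆ closure (V ∩ U) ∧ ∀ x ∈ V ∩ U, p x

/-- Names of the coordinates of a `SpaceConfig`. -/
inductive SpaceVar (P L : Type*)
  | pt (i : P) (s : Fin 1) (a : Fin 4)
  | ln (j : L) (s : Fin 2) (a : Fin 4)
  | rot (v a b : Fin 3)
  | trans (v a : Fin 3)

/-- Names of the coordinates of an `ImageConfig`. -/
inductive ImageVar {P L : Type*} (Q : PointLineProblem P L)
  | pt (v : Fin 3) (i : Q.seesPt v) (s : Fin 1) (a : Fin 3)
  | ln (v : Fin 3) (j : Q.seesLn v) (s : Fin 2) (a : Fin 3)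

/-- `c` lists homogeneous coordinates of the points, bases of the planes representing the lines,
and the entries of the cameras in `S`. -/
def SpaceConfig.IsCoord {P L : Type*} (S : SpaceConfig P L) (c : SpaceVar P L → ℂ) : Prop :=
  (∀ i, (S.pt i).IsFrame fun s a => c (.pt i s a)) ∧
  (∀ j, (S.ln j).IsFrame fun s a => c (.ln j s a)) ∧
  (∀ v a b, c (.rot v a b) = S.cam.R v a b) ∧
  (∀ v a, c (.trans v a) = S.cam.t v a)

/-- `c` lists homogeneous coordinates of the points and bases of the planes representing the lines
in `y`. -/
def ImageConfig.IsCoord {P L : Type*} {Q : PointLineProblem P L} (y : ImageConfig Q)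
    (c : ImageVar Q → ℂ) : Prop :=
  (∀ v i, (y.pt v i).IsFrame fun s a => c (.pt v i s a)) ∧
  (∀ v j, (y.ln v j).IsFrame fun s a => c (.ln v j s a))

instance SpaceConfig.instTopologicalSpace (P L : Type*) : TopologicalSpace (SpaceConfig P L) :=
  zariskiTopology SpaceConfig.IsCoord

instance ImageConfig.instTopologicalSpace {P L : Type*} (Q : PointLineProblem P L) :
    TopologicalSpace (ImageConfig Q) :=
  zariskiTopology ImageConfig.IsCoord

/-! ### The joint camera map and minimality -/

namespace PointLineProblem

variable {P L : Type*}

/-- The variety of pairs consisting of a point-line arrangement with the incidences of `Q` and a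
camera configuration. -/
def spaceVariety (Q : PointLineProblem P L) : Set (SpaceConfig P L) :=
  {S | ∀ i j, Q.inc i j → (S.pt i).1 ≤ (S.ln j).1}

/-- The image variety: tuples of plane arrangements satisfying the observed incidences. -/
def imageVariety (Q : PointLineProblem P L) : Set (ImageConfig Q) :=
  {y | ∀ v (i : Q.seesPt v) (j : Q.seesLn v), Q.inc i j → (y.pt v i).1 ≤ (y.ln v j).1}

/-- The joint camera map, as a partial function given by its graph: the cameras in `S` send the
observed points and lines of `S` to those of `y`.  As the entries of `y` are points and lines, this
includes that the map is defined at `S`, i.e. that no camera center is equal to a point or lies on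
a line observed by that camera. -/
def JointCameraMap (Q : PointLineProblem P L) (S : SpaceConfig P L) (y : ImageConfig Q) : Prop :=
  (∀ v (i : Q.seesPt v), (S.pt i).1.map (S.cam.proj v) = (y.pt v i).1) ∧
  (∀ v (j : Q.seesLn v), (S.ln j).1.map (S.cam.proj v) = (y.ln v j).1)

/-- The solutions of `Q` for the joint image `y`. -/
def solutions (Q : PointLineProblem P L) (y : ImageConfig Q) : Set (SpaceConfig P L) :=
  {S | S ∈ Q.spaceVariety ∧ Q.JointCameraMap S y}

/-- A generic joint image has a nonzero finite number of solutions. -/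
def IsMinimal (Q : PointLineProblem P L) : Prop :=
  ForGeneric Q.imageVariety fun y => (Q.solutions y).Nonempty ∧ (Q.solutions y).Finite

end PointLineProblem

/-! ### Forgetting points and lines -/

/-- Forget some points and lines of a real arrangement. -/
def RealArrangement.forget {P L : Type*} {inc : P → L → Prop} (A : RealArrangement inc)
    (K : Set P) (M : Set L) : RealArrangement fun (i : K) (j : M) => inc i j where
  pt i := A.pt i
  ln j := A.ln j
  finrank_ln j := A.finrank_ln j
  pt_injective := A.pt_injective.comp Subtype.val_injective
  ln_injective := A.ln_injective.comp Subtype.val_injective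
  incident i j h := A.incident i j h

namespace PL1P

variable {P L : Type*}

/-- The PL1P obtained by forgetting, in space and in the views, all points outside `K` and all
lines outside `M`. -/
def forget (Q : PL1P P L) (K : Set P) (M : Set L) : PL1P K M where
  inc i j := Q.inc i j
  seesPt v := {i | (i : P) ∈ Q.seesPt v}
  seesLn v := {j | (j : L) ∈ Q.seesLn v}
  realizable := Q.realizable.map fun A => A.forget K M
  complete i j h := Q.complete i j fun A => h (A.forget K M)
  sees_meet v i j j' hne := Q.sees_meet v i j j' fun h => hne (Subtype.ext h)
  at_most_one i i' j h h' := Subtype.ext (Q.at_most_one i i' j h h')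

/-- The projection forgetting the points outside `K` and the lines outside `M` in space. -/
def spaceForget (K : Set P) (M : Set L) (S : SpaceConfig P L) : SpaceConfig K M where
  pt i := S.pt i
  ln j := S.ln j
  cam := S.cam

/-- The projection forgetting the points outside `K` and the lines outside `M` in the views. -/
def imageForget (Q : PL1P P L) (K : Set P) (M : Set L)
    (y : ImageConfig Q.toPointLineProblem) :
    ImageConfig (Q.forget K M).toPointLineProblem where
  pt v i := y.pt v ⟨i.1.1, i.2⟩
  ln v j := y.ln v ⟨j.1.1, j.2⟩

/-- `Q` is reducible to `Q.forget K M`. -/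
def IsReducibleTo (Q : PL1P P L) (K : Set P) (M : Set L) : Prop :=
  -- for each forgotten point, at most one of its pins is kept
  (∀ i ∉ K, ∀ j ∈ M, ∀ j' ∈ M, Q.inc i j → Q.inc i j' → j = j') ∧
  -- a generic solution `S'` lifts for generic images in the fiber over the joint image of `S'`
  ForGeneric (Q.forget K M).spaceVariety fun S' =>
    ForGeneric {y | y ∈ Q.imageVariety ∧ (Q.forget K M).JointCameraMap S' (Q.imageForget K M y)}
      fun y => ∃ S ∈ Q.spaceVariety, Q.JointCameraMap S y ∧ spaceForget K M S = S'

/-- `Q` is not reducible to another PL1P. -/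
def IsReduced (Q : PL1P P L) : Prop :=
  ∀ (K : Set P) (M : Set L), Q.IsReducibleTo K M → K = Set.univ ∧ M = Set.univ

/-! ### The four kinds of forgotten features -/

/-- The line `j` is observed in exactly two views. -/
def SeenInExactlyTwoViews (Q : PL1P P L) (j : L) : Prop :=
  {v | j ∈ Q.seesLn v}.ncard = 2

/-- `j` is a pin that is observed in exactly two views, and both of these views also observe the
point of the pin. -/
def IsTwoViewPin (Q : PL1P P L) (j : L) : Prop :=
  Q.SeenInExactlyTwoViews j ∧ ∃ i, Q.inc i j ∧ ∀ v, j ∈ Q.seesLn v → i ∈ Q.seesPt v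

/-- `j` is a free line that is observed in exactly two views. -/
def IsTwoViewFreeLine (Q : PL1P P L) (j : L) : Prop :=
  Q.SeenInExactlyTwoViews j ∧ ∀ i, ¬ Q.inc i j

/-- `j` is the only pin of the point `i`. -/
def IsSinglePin (Q : PL1P P L) (i : P) (j : L) : Prop :=
  ∀ j', Q.inc i j' ↔ j' = j

/-- `i` is a point with exactly one pin; the point is observed in exactly one view and its pin is
observed in all three views. -/
def IsOneViewPointOnFullPin (Q : PL1P P L) (i : P) : Prop :=
  ∃ j, Q.IsSinglePin i j ∧ (∃! v, i ∈ Q.seesPt v) ∧ ∀ v, j ∈ Q.seesLn v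

/-- `i` is a point with the single pin `j`; the point is observed in exactly one view, and its pin
is observed in that view and in exactly one other view. -/
def IsOneViewPointWithTwoViewPin (Q : PL1P P L) (i : P) (j : L) : Prop :=
  Q.IsSinglePin i j ∧ (∃! v, i ∈ Q.seesPt v) ∧ (∀ v, i ∈ Q.seesPt v → j ∈ Q.seesLn v) ∧
    Q.SeenInExactlyTwoViews j

end PL1P

end

/-! # Reductions of minimal point-line problems

Three ideas carry the proof.

*Which features can be forgotten.*  If a problem is minimal, then every line is observed by at least
two views, every point by at least one view, and a point observed by one view only has a pin
(`PL1P.isTame_of_isMinimal`); otherwise a point or a line of a solution could be moved without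
changing its images.  Under these conditions a problem is reducible by forgetting some features if
and only if they are of the four listed kinds.
In one direction (`PL1P.IsRemovable.isReducibleTo`), two image lines that avoid the images of the
camera centers back-project to planes that meet in a unique line, and a point is recovered on its
pin from one image; a generic image in the fiber avoids these epipoles, since transvections of the
forgotten image lines move them off the epipoles.  In the other direction
(`PL1P.IsTame.isRemovable_of_isReducibleTo`), for any other forgotten feature one composes an image
from the images of different configurations in the three views such that the back-projected
subspaces have no common point or line.  This is an open condition
(`PointLineProblem.isOpen_setOf_inf_comap_eq_bot`), so that no image nearby has a lift.

*The unique reduced problem.*  With this description, existence and uniqueness of the reduced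
problem are combinatorial: a feature of one of the four kinds remains one, and no new ones arise,
when other such features are forgotten (`PL1P.IsTame.isReduced_core`,
`PL1P.IsRemovable.eq_core`).

*Minimality of the extended problem.*  If the problem after forgetting is minimal, then a generic
image of the given problem has a nonempty finite set of partial solutions, and each extends uniquely
to a solution if no forgotten image line passes through one of the epipoles of a partial solution.
This holds for generic images (`PL1P.IsRemovable.isMinimal`): the determinant that expresses the
incidence of a line and an epipole is a polynomial `g` on the space of partial solutions and
compatible images, where it is not identically zero.  As there are finitely many partial solutions
over an image, `g` is algebraic over the polynomial functions of the image, and hence its zeros lie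
over a hypersurface (`exists_polynomial_of_finite_values`).

Genericity is handled by polynomial charts: the space variety and the image variety are covered by
one polynomial family each (`PL1P.mem_spaceVariety_iff`, `PL1P.mem_imageVariety_iff`), in which a pin
is spanned by its point and a second vector, and in which the rotations are parametrized by products
of elementary matrices (`exists_rotationOfParams_eq`).  So nonempty open subsets of these varieties
are dense (`IsPolyChart.subset_closure`). -/

noncomputable section

open scoped Matrix

/-! ### Dominant polynomial maps -/

open MvPolynomial in
/-- A dominant polynomial map, here given by an injective comorphism `φ`, hits all points outside some
hypersurface: by Chevalley's theorem the image is constructible, and it contains the generic point. -/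
theorem exists_forall_eval_ne_zero_exists_preimage {σ τ : Type*} [Finite σ] [Finite τ]
    (φ : MvPolynomial τ ℂ →ₐ[ℂ] MvPolynomial σ ℂ) (hφ : Function.Injective φ) :
    ∃ a : MvPolynomial τ ℂ, a ≠ 0 ∧
      ∀ η, eval η a ≠ 0 → ∃ x, ∀ k, eval x (φ (X k)) = η k := by
  have hfp : (φ : MvPolynomial τ ℂ →+* MvPolynomial σ ℂ).FinitePresentation := by
    apply RingHom.FinitePresentation.of_finiteType.mp
    apply RingHom.FiniteType.of_comp_finiteType (f := C)
    have : (φ : MvPolynomial τ ℂ →+* MvPolynomial σ ℂ).comp C = algebraMap ℂ _ := by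
      ext x
      simp [← algebraMap_eq]
    rw [this, RingHom.finiteType_algebraMap]
    infer_instance
  obtain ⟨S, hS⟩ := PrimeSpectrum.exists_constructibleSetData_iff.mpr
    (PrimeSpectrum.isConstructible_range_comap hfp)
  have hbot : (⊥ : PrimeSpectrum (MvPolynomial τ ℂ)) ∈ S.toSet := by
    rw [hS]
    refine ⟨⊥, ?_⟩
    ext x
    simp [map_eq_zero_iff φ hφ]
  simp only [PrimeSpectrum.ConstructibleSetData.toSet, Set.mem_iUnion] at hbot
  obtain ⟨D, hD, hbot⟩ := hbot
  have hg : ∀ i, D.g i = 0 := by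
    intro i
    have := hbot.1 ⟨i, rfl⟩
    simpa using this
  have hf : D.f ≠ 0 := by
    intro h
    apply hbot.2
    simp [h]
  refine ⟨D.f, hf, fun η hη => ?_⟩
  have hmem : pointToPoint (k := ℂ) η ∈ S.toSet := by
    simp only [PrimeSpectrum.ConstructibleSetData.toSet, Set.mem_iUnion]
    refine ⟨D, hD, ?_, ?_⟩
    · rintro _ ⟨i, rfl⟩
      rw [hg i]
      exact Ideal.zero_mem _
    · intro h
      have := h rfl
      apply hη
      have h2 : D.f ∈ vanishingIdeal ℂ {η} := this
      simpa [aeval_eq_eval] using h2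
  rw [hS] at hmem
  obtain ⟨p, hp⟩ := hmem
  obtain ⟨M, hM, hpM⟩ := Ideal.exists_le_maximal p.asIdeal p.2.ne_top
  obtain ⟨x, rfl⟩ := eq_vanishingIdeal_singleton_of_isMaximal ℂ hM
  refine ⟨x, fun k => ?_⟩
  have h1 : X k - C (η k) ∈ (pointToPoint (k := ℂ) η).asIdeal := by
    change _ ∈ vanishingIdeal ℂ {η}
    simp
  rw [← hp] at h1
  have h2 := hpM h1
  rw [mem_vanishingIdeal_singleton_iff] at h2
  have h3 : φ (C (η k)) = C (η k) := by simp
  simp [aeval_eq_eval, h3, sub_eq_zero] at h2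
  exact h2

open MvPolynomial in
theorem MvPolynomial.exists_eval_ne_zero {σ : Type*} {f : MvPolynomial σ ℂ} (hf : f ≠ 0) :
    ∃ x, eval x f ≠ 0 := by
  by_contra! h
  exact hf (MvPolynomial.funext fun x => by simp [h x])

open MvPolynomial in
/-- Let `F` be a polynomial map and `g ≠ 0` a polynomial on its source that takes only finitely many
values on each fiber of `F` over the complement of a hypersurface.  Then `F` maps the zeros of `g`
into a hypersurface.  Indeed `g` is algebraic over the polynomials in `F`, and the constant
coefficient of a relation vanishes at the images of the zeros. -/
theorem exists_polynomial_of_finite_values {σ τ : Type*} [Finite σ] [Finite τ]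
    (F : τ → MvPolynomial σ ℂ) (g : MvPolynomial σ ℂ) (hg : g ≠ 0)
    (u : MvPolynomial τ ℂ) (hu : u ≠ 0)
    (hfin : ∀ η, eval η u ≠ 0 → {z | ∃ x, (∀ k, eval x (F k) = η k) ∧ eval x g = z}.Finite) :
    ∃ f : MvPolynomial τ ℂ, f ≠ 0 ∧ ∀ x, eval x g = 0 → eval (fun k => eval x (F k)) f = 0 := by
  let φ : MvPolynomial (Option τ) ℂ →ₐ[ℂ] MvPolynomial σ ℂ := aeval fun o => o.elim g F
  let ψ : Polynomial (MvPolynomial τ ℂ) →ₐ[ℂ] MvPolynomial σ ℂ :=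
    φ.comp (optionEquivLeft ℂ τ).symm.toAlgHom
  have hψX : ψ Polynomial.X = g := by simp [ψ, φ]
  have hψC : ∀ f, ψ (Polynomial.C f) = aeval F f := by
    intro f
    have : ψ.comp (Polynomial.CAlgHom (R := ℂ)) = aeval F := by
      ext k
      simp [ψ, φ]
    exact congrArg (fun h => h f) this
  by_cases hinj : Function.Injective φ
  -- if `g` is algebraically independent of `F`, then it takes almost all values on a general fiber
  · exfalso
    obtain ⟨a, ha, hlift⟩ := exists_forall_eval_ne_zero_exists_preimage φ hinj
    have hne : a * rename some u ≠ 0 :=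
      mul_ne_zero ha ((map_ne_zero_iff _ (rename_injective _ (Option.some_injective _))).2 hu)
    obtain ⟨η, hη⟩ := exists_eval_ne_zero hne
    rw [map_mul, eval_rename] at hη
    have hη1 := left_ne_zero_of_mul hη
    have hη2 := right_ne_zero_of_mul hη
    set η' : τ → ℂ := η ∘ some
    -- the polynomial in the remaining variable obtained from `a` by fixing the others at `η'`
    let b : Polynomial ℂ := aeval (fun o : Option τ => o.elim Polynomial.X
      (fun k => Polynomial.C (η' k))) a
    have hb : ∀ t, b.eval t = eval (fun o : Option τ => o.elim t η') a := by
      intro t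
      have : (Polynomial.evalRingHom t).comp (aeval (fun o : Option τ => o.elim Polynomial.X
        (fun k => Polynomial.C (η' k)) )).toRingHom =
          eval (fun o : Option τ => o.elim t η') := by
        apply MvPolynomial.ringHom_ext
        · intro r
          simp
        · rintro (_ | k) <;> simp
      exact congrArg (fun f => f a) this
    have hb0 : b ≠ 0 := by
      intro h0
      apply hη1
      have := hb (η none)
      rw [h0, Polynomial.eval_zero] at this
      rw [this]
      congr 2
      ext (_ | k) <;> rfl
    have hsub : {t | b.eval t ≠ 0} ⊆
        {z | ∃ x, (∀ k, eval x (F k) = η' k) ∧ eval x g = z} := by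
      intro t ht
      rw [Set.mem_ofPred_eq, hb] at ht
      obtain ⟨x, hx⟩ := hlift _ ht
      refine ⟨x, fun k => ?_, ?_⟩
      · simpa [φ] using hx (some k)
      · simpa [φ] using hx none
    have hfin' := (hfin η' hη2).subset hsub
    have hroots : {t | b.eval t = 0}.Finite := by
      refine (b.roots.toFinset.finite_toSet).subset fun t ht => ?_
      simpa [hb0] using ht
    have : (Set.univ : Set ℂ).Finite := by
      refine (hfin'.union hroots).subset fun t _ => ?_
      by_cases h : b.eval t = 0
      · exact Or.inr h
      · exact Or.inl h
    exact Set.infinite_univ this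
  · -- otherwise `g` is algebraic, and a relation of least order has nonzero constant coefficient
    have hψ : ∃ p, p ≠ 0 ∧ ψ p = 0 := by
      by_contra! h
      apply hinj
      rw [injective_iff_map_eq_zero]
      intro q hq
      by_contra hq0
      refine h (optionEquivLeft ℂ τ q) (by simpa using hq0) ?_
      simpa [ψ] using hq
    obtain ⟨p, hp0, hp⟩ := hψ
    obtain ⟨q, hpq, hq⟩ := p.exists_eq_pow_rootMultiplicity_mul_and_not_dvd hp0 0
    rw [map_zero, sub_zero] at hpq hq
    rw [Polynomial.X_dvd_iff] at hq
    have hψq : ψ q = 0 := by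
      rw [hpq, map_mul, map_pow, hψX] at hp
      exact (mul_eq_zero.1 hp).resolve_left (pow_ne_zero _ hg)
    refine ⟨q.coeff 0, hq, fun x hx => ?_⟩
    rw [← Polynomial.X_mul_divX_add q, map_add, map_mul, hψX, hψC] at hψq
    have h := congrArg (eval x) hψq
    rw [map_add, map_mul, hx, zero_mul, zero_add, map_zero] at h
    rw [← h]
    have : (eval x).comp (aeval F).toRingHom = eval fun k => eval x (F k) := by
      apply MvPolynomial.ringHom_ext <;> simp
    exact (congrArg (fun h => h (q.coeff 0)) this).symm

/-! ### Polynomial functions and polynomial charts -/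

/-- `φ` is a polynomial function. -/
@[fun_prop]
def IsPolyFun {σ : Type*} (φ : (σ → ℂ) → ℂ) : Prop :=
  ∃ f : MvPolynomial σ ℂ, ∀ x, MvPolynomial.eval x f = φ x

namespace IsPolyFun

variable {σ : Type*}

@[fun_prop]
theorem const (r : ℂ) : IsPolyFun fun _ : σ → ℂ => r := ⟨MvPolynomial.C r, by simp⟩

@[fun_prop]
theorem coord (k : σ) : IsPolyFun fun x : σ → ℂ => x k := ⟨MvPolynomial.X k, by simp⟩

variable {φ ψ : (σ → ℂ) → ℂ}

@[fun_prop]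
theorem add (hφ : IsPolyFun φ) (hψ : IsPolyFun ψ) : IsPolyFun fun x => φ x + ψ x := by
  obtain ⟨f, hf⟩ := hφ
  obtain ⟨g, hg⟩ := hψ
  exact ⟨f + g, by simp [hf, hg]⟩

@[fun_prop]
theorem mul (hφ : IsPolyFun φ) (hψ : IsPolyFun ψ) : IsPolyFun fun x => φ x * ψ x := by
  obtain ⟨f, hf⟩ := hφ
  obtain ⟨g, hg⟩ := hψ
  exact ⟨f * g, by simp [hf, hg]⟩

@[fun_prop]
theorem neg (hφ : IsPolyFun φ) : IsPolyFun fun x => -φ x := by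
  obtain ⟨f, hf⟩ := hφ
  exact ⟨-f, by simp [hf]⟩

@[fun_prop]
theorem sub (hφ : IsPolyFun φ) (hψ : IsPolyFun ψ) : IsPolyFun fun x => φ x - ψ x := by
  simpa only [sub_eq_add_neg] using hφ.add hψ.neg

@[fun_prop]
theorem pow (hφ : IsPolyFun φ) (n : ℕ) : IsPolyFun fun x => φ x ^ n := by
  obtain ⟨f, hf⟩ := hφ
  exact ⟨f ^ n, by simp [hf]⟩

@[fun_prop]
theorem sum {ι : Type*} (s : Finset ι) {φ : ι → (σ → ℂ) → ℂ} (hφ : ∀ i, IsPolyFun (φ i)) :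
    IsPolyFun fun x => ∑ i ∈ s, φ i x := by
  choose f hf using hφ
  exact ⟨∑ i ∈ s, f i, by simp [hf]⟩

@[fun_prop]
theorem prod {ι : Type*} (s : Finset ι) {φ : ι → (σ → ℂ) → ℂ} (hφ : ∀ i, IsPolyFun (φ i)) :
    IsPolyFun fun x => ∏ i ∈ s, φ i x := by
  choose f hf using hφ
  exact ⟨∏ i ∈ s, f i, by simp [hf]⟩

theorem det {n : Type*} [Fintype n] [DecidableEq n] {M : (σ → ℂ) → Matrix n n ℂ}
    (hM : ∀ i j, IsPolyFun fun x => M x i j) : IsPolyFun fun x => (M x).det := by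
  simp only [Matrix.det_apply']
  fun_prop

theorem comp {τ : Type*} {φ : (τ → ℂ) → ℂ} (hφ : IsPolyFun φ) {κ : (σ → ℂ) → τ → ℂ}
    (hκ : ∀ k, IsPolyFun fun x => κ x k) : IsPolyFun fun x => φ (κ x) := by
  obtain ⟨f, hf⟩ := hφ
  choose F hF using hκ
  refine ⟨MvPolynomial.aeval F f, fun x => ?_⟩
  have : (MvPolynomial.eval x).comp (MvPolynomial.aeval F).toRingHom = MvPolynomial.eval (κ x) := by
    apply MvPolynomial.ringHom_ext <;> simp [hF]
  exact (congrArg (fun h => h f) this).trans (hf _)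

/-- Two nonzero polynomial functions have a common nonzero. -/
theorem exists_ne_zero_and_ne_zero (hφ : IsPolyFun φ) (hψ : IsPolyFun ψ) (h1 : ∃ x, φ x ≠ 0)
    (h2 : ∃ x, ψ x ≠ 0) : ∃ x, φ x ≠ 0 ∧ ψ x ≠ 0 := by
  obtain ⟨f, hf⟩ := hφ
  obtain ⟨g, hg⟩ := hψ
  have hf0 : f ≠ 0 := by
    rintro rfl
    obtain ⟨x, hx⟩ := h1
    simp [← hf] at hx
  have hg0 : g ≠ 0 := by
    rintro rfl
    obtain ⟨x, hx⟩ := h2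
    simp [← hg] at hx
  obtain ⟨x, hx⟩ := MvPolynomial.exists_eval_ne_zero (mul_ne_zero hf0 hg0)
  rw [map_mul, hf, hg] at hx
  exact ⟨x, left_ne_zero_of_mul hx, right_ne_zero_of_mul hx⟩

theorem exists_forall_ne_zero {ι : Type*} (s : Finset ι) {φ : ι → (σ → ℂ) → ℂ}
    (hφ : ∀ i, IsPolyFun (φ i)) (h : ∀ i ∈ s, ∃ x, φ i x ≠ 0) : ∃ x, ∀ i ∈ s, φ i x ≠ 0 := by
  classical
  induction s using Finset.induction_on with
  | empty => exact ⟨0, by simp⟩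
  | insert i s _ ih =>
    have h1 := ih fun j hj => h j (Finset.mem_insert_of_mem hj)
    obtain ⟨x, hx⟩ := exists_ne_zero_and_ne_zero (hφ i) (prod s hφ)
      (h i (Finset.mem_insert_self _ _))
      (h1.imp fun x hx => Finset.prod_ne_zero_iff.2 hx)
    refine ⟨x, fun j hj => ?_⟩
    rcases Finset.mem_insert.1 hj with rfl | hj
    · exact hx.1
    · exact Finset.prod_ne_zero_iff.1 hx.2 j hj

end IsPolyFun

/-- Injectivity of a matrix with polynomial entries is an open condition: if `N` is a left inverse
of the matrix at the given point, then it is enough that `det (N * M)` does not vanish. -/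
theorem exists_isPolyFun_of_mulVec_injective {σ m n : Type*} [Fintype m] [Fintype n]
    {M : (σ → ℂ) → Matrix m n ℂ} (hM : ∀ i j, IsPolyFun fun x => M x i j) {x₁ : σ → ℂ}
    (h : Function.Injective (M x₁).mulVec) :
    ∃ u, IsPolyFun u ∧ u x₁ ≠ 0 ∧ ∀ x, u x ≠ 0 → Function.Injective (M x).mulVec := by
  classical
  obtain ⟨g, hg⟩ := (M x₁).mulVecLin.exists_leftInverse_of_injective (LinearMap.ker_eq_bot.2 h)
  set N := LinearMap.toMatrix' g with hNdef
  have hN : N * M x₁ = 1 := by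
    rw [← LinearMap.toMatrix'_id, ← hg, LinearMap.toMatrix'_comp, ← Matrix.toLin'_apply',
      LinearMap.toMatrix'_toLin']
  refine ⟨fun x => (N * M x).det, IsPolyFun.det fun i j => ?_, by simp [hN], fun x hx => ?_⟩
  · simp only [Matrix.mul_apply]
    fun_prop
  · have : Function.Injective (N * M x).mulVec := by
      rw [Matrix.mulVec_injective_iff_isUnit, Matrix.isUnit_iff_isUnit_det]
      exact hx.isUnit
    intro v w hvw
    apply this
    rw [← Matrix.mulVec_mulVec, ← Matrix.mulVec_mulVec, hvw]

section Chart

variable {T σ τ : Type*} (coord : T → (τ → ℂ) → Prop)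

/-- The family of coordinate vectors `κ s` describes a family of elements of `T`, depending
polynomially on `s` where it is defined.  As an element of `T` has many coordinate vectors, we
require that any coordinate vector of a member of the family extends to a polynomial family of
coordinate vectors of nearby members. -/
def IsPolyChart (κ : (σ → ℂ) → τ → ℂ) : Prop :=
  ∀ s₁ x, coord x (κ s₁) → ∀ c, coord x c → ∃ C : (σ → ℂ) → τ → ℂ, (∀ k, IsPolyFun fun s => C s k) ∧
    C s₁ = c ∧ ∃ u, IsPolyFun u ∧ u s₁ ≠ 0 ∧ ∀ s, u s ≠ 0 → ∃ x', coord x' (κ s) ∧ coord x' (C s)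

variable {coord} {κ : (σ → ℂ) → τ → ℂ}

/-- A neighborhood of a member of the family contains all members for which some polynomial in the
parameters does not vanish. -/
theorem IsPolyChart.exists_isPolyFun_of_isOpen (hκ : IsPolyChart coord κ)
    (hcoord : ∀ x x' c, coord x c → coord x' c → x = x') {U : Set T}
    (hU : @IsOpen T (zariskiTopology coord) U) {s₁ : σ → ℂ} {x : T} (hx : coord x (κ s₁))
    (hxU : x ∈ U) :
    ∃ u, IsPolyFun u ∧ u s₁ ≠ 0 ∧ ∀ s, u s ≠ 0 → ∃ x' ∈ U, coord x' (κ s) := by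
  induction hU with
  | basic V hV =>
    obtain ⟨f, rfl⟩ := hV
    obtain ⟨c, hc, hfc⟩ := hxU
    obtain ⟨C, hC, hCs, u, hu, hus, h⟩ := hκ s₁ x hx c hc
    refine ⟨fun s => u s * MvPolynomial.eval (C s) f, hu.mul ?_, ?_, fun s hs => ?_⟩
    · exact IsPolyFun.comp ⟨f, fun _ => rfl⟩ hC
    · change u s₁ * MvPolynomial.eval (C s₁) f ≠ 0
      rw [hCs]
      exact mul_ne_zero hus hfc
    · obtain ⟨x', h1, h2⟩ := h s (left_ne_zero_of_mul hs)
      exact ⟨x', ⟨C s, h2, right_ne_zero_of_mul hs⟩, h1⟩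
  | univ =>
    obtain ⟨C, hC, hCs, u, hu, hus, h⟩ := hκ s₁ x hx _ hx
    exact ⟨u, hu, hus, fun s hs => (h s hs).imp fun x' hx' => ⟨trivial, hx'.1⟩⟩
  | inter V W _ _ ihV ihW =>
    obtain ⟨u, hu, hus, h⟩ := ihV hxU.1
    obtain ⟨u', hu', hus', h'⟩ := ihW hxU.2
    refine ⟨fun s => u s * u' s, hu.mul hu', mul_ne_zero hus hus', fun s hs => ?_⟩
    obtain ⟨x', h1, h2⟩ := h s (left_ne_zero_of_mul hs)
    obtain ⟨x'', h3, h4⟩ := h' s (right_ne_zero_of_mul hs)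
    obtain rfl := hcoord _ _ _ h2 h4
    exact ⟨x', ⟨h1, h3⟩, h2⟩
  | sUnion S _ ih =>
    obtain ⟨V, hVS, hxV⟩ := hxU
    obtain ⟨u, hu, hus, h⟩ := ih V hVS hxV
    exact ⟨u, hu, hus, fun s hs => (h s hs).imp fun x' hx' => ⟨⟨V, hVS, hx'.1⟩, hx'.2⟩⟩

/-- A set that is covered by one polynomial chart is irreducible, so that its nonempty open
subsets are dense. -/
theorem IsPolyChart.subset_closure (hκ : IsPolyChart coord κ)
    (hcoord : ∀ x x' c, coord x c → coord x' c → x = x') {V U : Set T}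
    (hV : ∀ x, x ∈ V ↔ ∃ s, coord x (κ s)) (hU : @IsOpen T (zariskiTopology coord) U)
    (hne : (V ∩ U).Nonempty) :
    V ⊆ @closure T (zariskiTopology coord) (V ∩ U) := by
  let := zariskiTopology coord
  intro x hx
  rw [mem_closure_iff]
  intro O hO hxO
  obtain ⟨s, hs⟩ := (hV x).1 hx
  obtain ⟨x₁, hx₁, hx₁U⟩ := hne
  obtain ⟨s₁, hs₁⟩ := (hV x₁).1 hx₁
  obtain ⟨u, hu, hus, h⟩ := hκ.exists_isPolyFun_of_isOpen hcoord hO hs hxO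
  obtain ⟨u', hu', hus', h'⟩ := hκ.exists_isPolyFun_of_isOpen hcoord hU hs₁ hx₁U
  obtain ⟨t, ht, ht'⟩ := hu.exists_ne_zero_and_ne_zero hu' ⟨_, hus⟩ ⟨_, hus'⟩
  obtain ⟨z, hz, hzt⟩ := h t ht
  obtain ⟨z', hz', hzt'⟩ := h' t ht'
  obtain rfl := hcoord _ _ _ hzt hzt'
  exact ⟨z, hz, (hV z).2 ⟨t, hzt⟩, hz'⟩

end Chart

/-! ### Frames of linear subspaces -/

namespace Gr

variable {k n : ℕ} {W : Gr k n}

theorem IsFrame.linearIndependent {b : Fin k → Fin n → ℂ} (h : W.IsFrame b) :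
    LinearIndependent ℂ b := by
  rw [linearIndependent_iff_card_eq_finrank_span, Set.finrank, h, W.2, Fintype.card_fin]

theorem IsFrame.mem {b : Fin k → Fin n → ℂ} (h : W.IsFrame b) (s : Fin k) : b s ∈ W.1 := by
  rw [← h]
  exact Submodule.subset_span ⟨s, rfl⟩

theorem IsFrame.eq {W' : Gr k n} {b : Fin k → Fin n → ℂ} (h : W.IsFrame b) (h' : W'.IsFrame b) :
    W = W' :=
  Subtype.ext (h.symm.trans h')

theorem isFrame_of_mem {b : Fin k → Fin n → ℂ} (hb : LinearIndependent ℂ b)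
    (hW : ∀ s, b s ∈ W.1) : W.IsFrame b := by
  apply Submodule.eq_of_le_of_finrank_eq
  · rw [Submodule.span_le]
    rintro _ ⟨s, rfl⟩
    exact hW s
  · rw [finrank_span_eq_card hb, W.2, Fintype.card_fin]

variable (W) in
theorem exists_isFrame : ∃ b, W.IsFrame b := by
  let b := Module.finBasisOfFinrankEq ℂ W.1 W.2
  refine ⟨fun s => b s, isFrame_of_mem ?_ fun s => (b s).2⟩
  exact b.linearIndependent.map' W.1.subtype W.1.ker_subtype

/-- The span of linearly independent vectors. -/
def ofLinearIndependent (b : Fin k → Fin n → ℂ) (hb : LinearIndependent ℂ b) : Gr k n :=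
  ⟨Submodule.span ℂ (Set.range b), by rw [finrank_span_eq_card hb, Fintype.card_fin]⟩

theorem isFrame_one_iff {W : Gr 1 n} {b : Fin 1 → Fin n → ℂ} :
    W.IsFrame b ↔ W.1 = Submodule.span ℂ {b 0} := by
  rw [IsFrame, Set.range_unique, eq_comm]
  rfl

theorem isFrame_two_iff {W : Gr 2 n} {b : Fin 2 → Fin n → ℂ} :
    W.IsFrame b ↔ W.1 = Submodule.span ℂ {b 0, b 1} := by
  rw [IsFrame, eq_comm, show Set.range b = {b 0, b 1} by ext; simp [Fin.exists_fin_two, eq_comm]]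

theorem exists_eq_span_singleton (W : Gr 1 n) : ∃ p ≠ 0, W.1 = Submodule.span ℂ {p} := by
  obtain ⟨b, hb⟩ := W.exists_isFrame
  exact ⟨b 0, hb.linearIndependent.ne_zero 0, isFrame_one_iff.1 hb⟩

/-- The line spanned by a nonzero vector, as a point of projective space. -/
def point (p : Fin n → ℂ) (hp : p ≠ 0) : Gr 1 n :=
  ⟨Submodule.span ℂ {p}, finrank_span_singleton hp⟩

/-- The span of two independent vectors, as a line of projective space. -/
def line (p q : Fin n → ℂ) (h : LinearIndependent ℂ ![p, q]) : Gr 2 n :=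
  ⟨Submodule.span ℂ {p, q}, by
    have := finrank_span_eq_card h
    rwa [Matrix.range_cons, Matrix.range_cons, Matrix.range_empty, Set.union_empty,
      Set.singleton_union, Fintype.card_fin] at this⟩

theorem eq_span_pair {W : Gr 2 n} {p q : Fin n → ℂ} (h : LinearIndependent ℂ ![p, q])
    (hp : p ∈ W.1) (hq : q ∈ W.1) : W.1 = Submodule.span ℂ {p, q} := by
  have : W.IsFrame ![p, q] := isFrame_of_mem h (Fin.forall_fin_two.2 ⟨hp, hq⟩)
  exact isFrame_two_iff.1 this

theorem exists_linearIndependent_pair (W : Gr 2 n) {p : Fin n → ℂ} (hp0 : p ≠ 0) :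
    ∃ q ∈ W.1, LinearIndependent ℂ ![p, q] := by
  have : ¬ W.1 ≤ Submodule.span ℂ {p} := by
    intro h
    have h1 := Submodule.finrank_mono h
    rw [W.2, finrank_span_singleton hp0] at h1
    omega
  obtain ⟨q, hq, hqp⟩ := SetLike.not_le_iff_exists.1 this
  refine ⟨q, hq, (LinearIndependent.pair_iff' hp0).2 fun a ha => hqp ?_⟩
  rw [← ha]
  exact Submodule.smul_mem _ _ (Submodule.mem_span_singleton_self p)

theorem exists_eq_span_pair (W : Gr 2 n) :
    ∃ p q, LinearIndependent ℂ ![p, q] ∧ W.1 = Submodule.span ℂ {p, q} := by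
  obtain ⟨b, hb⟩ := W.exists_isFrame
  refine ⟨b 0, b 1, ?_, isFrame_two_iff.1 hb⟩
  convert hb.linearIndependent using 1
  ext s
  fin_cases s <;> rfl

theorem IsFrame.exists_mul {b b' : Fin k → Fin n → ℂ} (h : W.IsFrame b)
    (h' : ∀ s, b' s ∈ W.1) : ∃ G : Matrix (Fin k) (Fin k) ℂ, ∀ s, b' s = ∑ t, G s t • b t := by
  have : ∀ s, ∃ g : Fin k → ℂ, ∑ t, g t • b t = b' s := fun s => by
    have := h' s
    rw [← h] at this
    exact (Submodule.mem_span_range_iff_exists_fun ℂ).1 this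
  choose G hG using this
  exact ⟨G, fun s => (hG s).symm⟩

/-- Any two frames of the same subspace differ by an invertible matrix, which can be applied to any
other frame as well. -/
theorem IsFrame.exists_change {b b' : Fin k → Fin n → ℂ} (h : W.IsFrame b) (h' : W.IsFrame b') :
    ∃ G : Matrix (Fin k) (Fin k) ℂ, (∀ s, b' s = ∑ t, G s t • b t) ∧
      ∀ (W₂ : Gr k n) (b₂ : Fin k → Fin n → ℂ), W₂.IsFrame b₂ →
        W₂.IsFrame fun s => ∑ t, G s t • b₂ t := by
  obtain ⟨G, hG⟩ := h.exists_mul h'.mem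
  obtain ⟨G', hG'⟩ := h'.exists_mul h.mem
  have hmul : G' * G = 1 := by
    have hb := h.linearIndependent
    rw [Fintype.linearIndependent_iff] at hb
    ext s t
    have h1 : ∑ t, ((G' * G) s t - (1 : Matrix _ _ ℂ) s t) • b t = 0 := by
      simp only [sub_smul, Finset.sum_sub_distrib, Matrix.one_apply, ite_smul, one_smul, zero_smul,
        Finset.sum_ite_eq, Finset.mem_univ, if_true]
      rw [sub_eq_zero]
      conv_rhs => rw [hG' s]
      simp only [hG, Matrix.mul_apply, Finset.sum_smul, Finset.smul_sum, smul_smul]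
      exact Finset.sum_comm
    exact sub_eq_zero.1 (hb _ h1 t)
  refine ⟨G, hG, fun W₂ b₂ h₂ => ?_⟩
  rw [IsFrame, ← h₂]
  apply le_antisymm
  · rw [Submodule.span_le]
    rintro _ ⟨s, rfl⟩
    exact Submodule.sum_mem _ fun t _ =>
      Submodule.smul_mem _ _ (Submodule.subset_span ⟨t, rfl⟩)
  · rw [Submodule.span_le]
    rintro _ ⟨s, rfl⟩
    have : b₂ s = ∑ r, G' s r • ∑ t, G r t • b₂ t := by
      have h2 : ∀ t, ∑ r, G' s r * G r t = (1 : Matrix _ _ ℂ) s t := fun t => by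
        rw [← hmul, Matrix.mul_apply]
      simp only [Finset.smul_sum, smul_smul]
      rw [Finset.sum_comm]
      simp only [← Finset.sum_smul, h2, Matrix.one_apply, ite_smul, one_smul, zero_smul,
        Finset.sum_ite_eq, Finset.mem_univ, if_true]
    rw [SetLike.mem_coe, this]
    exact Submodule.sum_mem _ fun t _ =>
      Submodule.smul_mem _ _ (Submodule.subset_span ⟨t, rfl⟩)

end Gr

/-- Linear independence of vectors that depend polynomially on parameters is an open condition. -/
theorem exists_isPolyFun_of_linearIndependent {σ : Type*} {k n : ℕ}
    {b : (σ → ℂ) → Fin k → Fin n → ℂ} (hb : ∀ s a, IsPolyFun fun x => b x s a) {x₁ : σ → ℂ}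
    (h : LinearIndependent ℂ (b x₁)) :
    ∃ u, IsPolyFun u ∧ u x₁ ≠ 0 ∧ ∀ x, u x ≠ 0 → LinearIndependent ℂ (b x) := by
  have := exists_isPolyFun_of_mulVec_injective (M := fun x => Matrix.of fun a s => b x s a)
    (fun i j => hb j i) (x₁ := x₁) (Matrix.mulVec_injective_iff.2 h)
  obtain ⟨u, hu, hu1, h⟩ := this
  exact ⟨u, hu, hu1, fun x hx => Matrix.mulVec_injective_iff.1 (h x hx)⟩

/-- A frame of one member of a polynomial family of subspaces extends to a polynomial family of frames
of nearby members. -/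
theorem Gr.IsFrame.exists_family {σ : Type*} {k n : ℕ} {W : Gr k n}
    {b : (σ → ℂ) → Fin k → Fin n → ℂ} (hb : ∀ s a, IsPolyFun fun x => b x s a) {x₁ : σ → ℂ}
    (h : W.IsFrame (b x₁)) {b' : Fin k → Fin n → ℂ} (h' : W.IsFrame b') :
    ∃ C : (σ → ℂ) → Fin k → Fin n → ℂ, (∀ s a, IsPolyFun fun x => C x s a) ∧ C x₁ = b' ∧
      ∃ u, IsPolyFun u ∧ u x₁ ≠ 0 ∧
        ∀ x, u x ≠ 0 → ∃ W' : Gr k n, W'.IsFrame (b x) ∧ W'.IsFrame (C x) := by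
  obtain ⟨G, hG, hG'⟩ := h.exists_change h'
  obtain ⟨u, hu, hu1, hli⟩ := exists_isPolyFun_of_linearIndependent hb h.linearIndependent
  refine ⟨fun x s => ∑ t, G s t • b x t, fun s a => ?_, (funext hG).symm, u, hu, hu1,
    fun x hx => ⟨Gr.ofLinearIndependent _ (hli x hx), rfl, hG' _ _ rfl⟩⟩
  simp only [Finset.sum_apply, Pi.smul_apply, smul_eq_mul]
  fun_prop

/-! ### Polynomial charts of the configuration spaces -/

section Charts

variable {P L : Type*}

theorem SpaceConfig.IsCoord.eq {S S' : SpaceConfig P L} {c : SpaceVar P L → ℂ} (h : S.IsCoord c)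
    (h' : S'.IsCoord c) : S = S' := by
  ext1
  · exact funext fun i => (h.1 i).eq (h'.1 i)
  · exact funext fun j => (h.2.1 j).eq (h'.2.1 j)
  · ext1
    · ext v a b
      rw [← h.2.2.1, ← h'.2.2.1]
    · ext v a
      rw [← h.2.2.2, ← h'.2.2.2]

theorem ImageConfig.IsCoord.eq {Q : PointLineProblem P L} {y y' : ImageConfig Q}
    {c : ImageVar Q → ℂ} (h : y.IsCoord c) (h' : y'.IsCoord c) : y = y' := by
  ext1
  · exact funext fun v => funext fun i => (h.1 v i).eq (h'.1 v i)
  · exact funext fun v => funext fun j => (h.2 v j).eq (h'.2 v j)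

theorem SpaceConfig.exists_isCoord (S : SpaceConfig P L) : ∃ c, S.IsCoord c := by
  choose p hp using fun i => (S.pt i).exists_isFrame
  choose l hl using fun j => (S.ln j).exists_isFrame
  exact ⟨fun
    | .pt i s a => p i s a
    | .ln j s a => l j s a
    | .rot v a b => S.cam.R v a b
    | .trans v a => S.cam.t v a, hp, hl, fun _ _ _ => rfl, fun _ _ => rfl⟩

theorem ImageConfig.exists_isCoord {Q : PointLineProblem P L} (y : ImageConfig Q) :
    ∃ c, y.IsCoord c := by
  choose p hp using fun v i => (y.pt v i).exists_isFrame
  choose l hl using fun v j => (y.ln v j).exists_isFrame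
  exact ⟨fun
    | .pt v i s a => p v i s a
    | .ln v j s a => l v j s a, hp, hl⟩

variable [Finite P] [Finite L] {σ : Type*}

theorem isPolyChart_space {κ : (σ → ℂ) → SpaceVar P L → ℂ}
    (hκ : ∀ k, IsPolyFun fun s => κ s k)
    (hcam : ∀ s, ∃ C : CameraConfig, (∀ v a b, κ s (.rot v a b) = C.R v a b) ∧
      ∀ v a, κ s (.trans v a) = C.t v a) :
    IsPolyChart SpaceConfig.IsCoord κ := by
  have := Fintype.ofFinite P
  have := Fintype.ofFinite L
  intro s₁ S hS c hc
  choose C hC hC1 u hu hu1 hW using fun i =>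
    (hS.1 i).exists_family (b := fun x t a => κ x (.pt i t a)) (fun t a => hκ _) (hc.1 i)
  choose C' hC' hC1' u' hu' hu1' hW' using fun j =>
    (hS.2.1 j).exists_family (b := fun x t a => κ x (.ln j t a)) (fun t a => hκ _) (hc.2.1 j)
  refine ⟨fun s k => match k with
    | .pt i t a => C i s t a
    | .ln j t a => C' j s t a
    | .rot v a b => κ s (.rot v a b)
    | .trans v a => κ s (.trans v a), ?_, ?_,
    fun s => (∏ i, u i s) * ∏ j, u' j s, by fun_prop, ?_, ?_⟩
  · rintro (⟨i, t, a⟩ | ⟨j, t, a⟩ | ⟨v, a, b⟩ | ⟨v, a⟩)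
    exacts [hC i t a, hC' j t a, hκ _, hκ _]
  · ext (⟨i, t, a⟩ | ⟨j, t, a⟩ | ⟨v, a, b⟩ | ⟨v, a⟩)
    · exact congrFun (congrFun (hC1 i) t) a
    · exact congrFun (congrFun (hC1' j) t) a
    · exact (hS.2.2.1 v a b).trans (hc.2.2.1 v a b).symm
    · exact (hS.2.2.2 v a).trans (hc.2.2.2 v a).symm
  · exact mul_ne_zero (Finset.prod_ne_zero_iff.2 fun i _ => hu1 i)
      (Finset.prod_ne_zero_iff.2 fun j _ => hu1' j)
  · intro s hs
    have h1 := Finset.prod_ne_zero_iff.1 (left_ne_zero_of_mul hs)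
    have h2 := Finset.prod_ne_zero_iff.1 (right_ne_zero_of_mul hs)
    choose p hp hp' using fun i => hW i s (h1 i (Finset.mem_univ i))
    choose l hl hl' using fun j => hW' j s (h2 j (Finset.mem_univ j))
    obtain ⟨cam, hR, ht⟩ := hcam s
    exact ⟨⟨p, l, cam⟩, ⟨hp, hl, hR, ht⟩, ⟨hp', hl', hR, ht⟩⟩

theorem isPolyChart_image {Q : PointLineProblem P L} {κ : (σ → ℂ) → ImageVar Q → ℂ}
    (hκ : ∀ k, IsPolyFun fun s => κ s k) : IsPolyChart ImageConfig.IsCoord κ := by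
  have := Fintype.ofFinite P
  have := Fintype.ofFinite L
  have := fun v => Fintype.ofFinite (Q.seesPt v)
  have := fun v => Fintype.ofFinite (Q.seesLn v)
  intro s₁ S hS c hc
  choose C hC hC1 u hu hu1 hW using fun v i =>
    (hS.1 v i).exists_family (b := fun x t a => κ x (.pt v i t a)) (fun t a => hκ _) (hc.1 v i)
  choose C' hC' hC1' u' hu' hu1' hW' using fun v j =>
    (hS.2 v j).exists_family (b := fun x t a => κ x (.ln v j t a)) (fun t a => hκ _) (hc.2 v j)
  refine ⟨fun s k => match k with
    | .pt v i t a => C v i s t a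
    | .ln v j t a => C' v j s t a, ?_, ?_,
    fun s => (∏ v, ∏ i, u v i s) * ∏ v, ∏ j, u' v j s, by fun_prop, ?_, ?_⟩
  · rintro (⟨v, i, t, a⟩ | ⟨v, j, t, a⟩)
    exacts [hC v i t a, hC' v j t a]
  · ext (⟨v, i, t, a⟩ | ⟨v, j, t, a⟩)
    · exact congrFun (congrFun (hC1 v i) t) a
    · exact congrFun (congrFun (hC1' v j) t) a
  · exact mul_ne_zero
      (Finset.prod_ne_zero_iff.2 fun v _ => Finset.prod_ne_zero_iff.2 fun i _ => hu1 v i)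
      (Finset.prod_ne_zero_iff.2 fun v _ => Finset.prod_ne_zero_iff.2 fun j _ => hu1' v j)
  · intro s hs
    have h1 := fun v i => Finset.prod_ne_zero_iff.1 (Finset.prod_ne_zero_iff.1
      (left_ne_zero_of_mul hs) v (Finset.mem_univ v)) i (Finset.mem_univ i)
    have h2 := fun v j => Finset.prod_ne_zero_iff.1 (Finset.prod_ne_zero_iff.1
      (right_ne_zero_of_mul hs) v (Finset.mem_univ v)) j (Finset.mem_univ j)
    choose p hp hp' using fun v i => hW v i s (h1 v i)
    choose l hl hl' using fun v j => hW' v j s (h2 v j)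
    exact ⟨⟨p, l⟩, ⟨hp, hl⟩, ⟨hp', hl'⟩⟩

end Charts

/-! ### A polynomial parametrization of the cameras -/

/-- The Euler-Rodrigues matrix of a quaternion. -/
def quaternionMatrix (a b c d : ℂ) : Matrix (Fin 3) (Fin 3) ℂ :=
  !![a ^ 2 + b ^ 2 - c ^ 2 - d ^ 2, 2 * (b * c - a * d), 2 * (b * d + a * c);
    2 * (b * c + a * d), a ^ 2 - b ^ 2 + c ^ 2 - d ^ 2, 2 * (c * d - a * b);
    2 * (b * d - a * c), 2 * (c * d + a * b), a ^ 2 - b ^ 2 - c ^ 2 + d ^ 2]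

theorem quaternionMatrix_mul_transpose {a b c d : ℂ} (h : a ^ 2 + b ^ 2 + c ^ 2 + d ^ 2 = 1) :
    quaternionMatrix a b c d * (quaternionMatrix a b c d).transpose = 1 := by
  have h2 : (a ^ 2 + b ^ 2 + c ^ 2 + d ^ 2) ^ 2 = 1 := by rw [h, one_pow]
  ext i j
  fin_cases i <;> fin_cases j <;>
    simp [quaternionMatrix, Matrix.mul_apply, Fin.sum_univ_three] <;>
    first | ring1 | linear_combination h2

theorem det_quaternionMatrix {a b c d : ℂ} (h : a ^ 2 + b ^ 2 + c ^ 2 + d ^ 2 = 1) :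
    (quaternionMatrix a b c d).det = 1 := by
  have h3 : (a ^ 2 + b ^ 2 + c ^ 2 + d ^ 2) ^ 3 = 1 := by rw [h, one_pow]
  rw [Matrix.det_fin_three]
  simp [quaternionMatrix]
  linear_combination h3

/-- If the trace of a rotation is not `-1`, then `1 + tr R` is four times the square of the real part
of the quaternion, and the other parts are read off from the skew-symmetric part of `R`. -/
theorem exists_quaternionMatrix_eq_of_trace_ne {R : Matrix (Fin 3) (Fin 3) ℂ}
    (hR : R * R.transpose = 1) (hdet : R.det = 1) (hT : 1 + R 0 0 + R 1 1 + R 2 2 ≠ 0) :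
    ∃ a b c d : ℂ, a ^ 2 + b ^ 2 + c ^ 2 + d ^ 2 = 1 ∧ quaternionMatrix a b c d = R := by
  have hR' : R.transpose * R = 1 := mul_eq_one_comm.1 hR
  have hadj : R.adjugate = R.transpose := by
    have h1 : R.transpose * (R * R.adjugate) = R.transpose := by
      rw [Matrix.mul_adjugate, hdet, one_smul, mul_one]
    rwa [← mul_assoc, hR', one_mul] at h1
  have row : ∀ i j, ∑ k, R i k * R j k = (1 : Matrix _ _ ℂ) i j := fun i j => by
    rw [← hR, Matrix.mul_apply]; rfl
  have col : ∀ i j, ∑ k, R k i * R k j = (1 : Matrix _ _ ℂ) i j := fun i j => by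
    rw [← hR', Matrix.mul_apply]; rfl
  have cof : ∀ i j, R.adjugate i j = R j i := fun i j => by rw [hadj]; rfl
  simp only [Fin.sum_univ_three] at row col
  have r00 := row 0 0
  have r11 := row 1 1
  have r22 := row 2 2
  have r01 := row 0 1
  have r02 := row 0 2
  have r12 := row 1 2
  have c00 := col 0 0
  have c11 := col 1 1
  have c22 := col 2 2
  have c01 := col 0 1
  have c02 := col 0 2
  have c12 := col 1 2
  have f00 := cof 0 0
  have f01 := cof 0 1
  have f02 := cof 0 2
  have f10 := cof 1 0
  have f11 := cof 1 1
  have f12 := cof 1 2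
  have f20 := cof 2 0
  have f21 := cof 2 1
  have f22 := cof 2 2
  simp only [Matrix.adjugate_fin_three, Matrix.of_apply, Matrix.cons_val] at f00 f01 f02 f10 f11 f12 f20 f21 f22
  simp only [Matrix.one_apply_eq] at r00 r11 r22 c00 c11 c22
  rw [Matrix.one_apply_ne (by decide)] at r01 r02 r12 c01 c02 c12
  obtain ⟨a, ha⟩ := IsAlgClosed.exists_pow_nat_eq ((1 + R 0 0 + R 1 1 + R 2 2) / 4) two_pos
  have ha0 : a ≠ 0 := by
    rintro rfl
    apply hT
    linear_combination -4 * ha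
  set T := 1 + R 0 0 + R 1 1 + R 2 2 with hTdef
  have ha4 : 4 * a ^ 2 = T := by rw [ha]; ring
  obtain ⟨b, hb⟩ : ∃ b, 4 * a * b = R 2 1 - R 1 2 := ⟨(R 2 1 - R 1 2) / (4 * a), by field_simp⟩
  obtain ⟨c, hc⟩ : ∃ c, 4 * a * c = R 0 2 - R 2 0 := ⟨(R 0 2 - R 2 0) / (4 * a), by field_simp⟩
  obtain ⟨d, hd⟩ : ∃ d, 4 * a * d = R 1 0 - R 0 1 := ⟨(R 1 0 - R 0 1) / (4 * a), by field_simp⟩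
  have hbb : 4 * b ^ 2 = 1 + R 0 0 - R 1 1 - R 2 2 := by
    apply mul_left_cancel₀ hT
    have : T * (4 * b ^ 2) = (4 * a * b) ^ 2 := by rw [← ha4]; ring
    rw [this, hb, hTdef]
    linear_combination r11 + r22 - c00 + 2 * f00
  have hcc : 4 * c ^ 2 = 1 - R 0 0 + R 1 1 - R 2 2 := by
    apply mul_left_cancel₀ hT
    have : T * (4 * c ^ 2) = (4 * a * c) ^ 2 := by rw [← ha4]; ring
    rw [this, hc, hTdef]
    linear_combination r00 + r22 - c11 + 2 * f11
  have hdd : 4 * d ^ 2 = 1 - R 0 0 - R 1 1 + R 2 2 := by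
    apply mul_left_cancel₀ hT
    have : T * (4 * d ^ 2) = (4 * a * d) ^ 2 := by rw [← ha4]; ring
    rw [this, hd, hTdef]
    linear_combination r00 + r11 - c22 + 2 * f22
  have hbc : 4 * b * c = R 0 1 + R 1 0 := by
    apply mul_left_cancel₀ hT
    have : T * (4 * b * c) = (4 * a * b) * (4 * a * c) := by rw [← ha4]; ring
    rw [this, hb, hc, hTdef]
    linear_combination -r01 - c01 + f01 + f10
  have hbd : 4 * b * d = R 0 2 + R 2 0 := by
    apply mul_left_cancel₀ hT
    have : T * (4 * b * d) = (4 * a * b) * (4 * a * d) := by rw [← ha4]; ring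
    rw [this, hb, hd, hTdef]
    linear_combination -r02 - c02 + f02 + f20
  have hcd : 4 * c * d = R 1 2 + R 2 1 := by
    apply mul_left_cancel₀ hT
    have : T * (4 * c * d) = (4 * a * c) * (4 * a * d) := by rw [← ha4]; ring
    rw [this, hc, hd, hTdef]
    linear_combination -r12 - c12 + f12 + f21
  refine ⟨a, b, c, d, ?_, ?_⟩
  · linear_combination (ha4 + hbb + hcc + hdd) / 4 + hTdef / 4
  · ext i j
    fin_cases i <;> fin_cases j <;> simp [quaternionMatrix]
    · linear_combination (ha4 + hbb - hcc - hdd) / 4 + hTdef / 4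
    · linear_combination (hbc - hd) / 2
    · linear_combination (hbd + hc) / 2
    · linear_combination (hbc + hd) / 2
    · linear_combination (ha4 - hbb + hcc - hdd) / 4 + hTdef / 4
    · linear_combination (hcd - hb) / 2
    · linear_combination (hbd - hc) / 2
    · linear_combination (hcd + hb) / 2
    · linear_combination (ha4 - hbb - hcc + hdd) / 4 + hTdef / 4

/-- Every complex rotation is the Euler-Rodrigues matrix of a unit quaternion.  If the trace of `R`
is `-1`, then one first multiplies `R` by a rotation by `π` about a coordinate axis. -/
theorem exists_quaternionMatrix_eq {R : Matrix (Fin 3) (Fin 3) ℂ}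
    (hR : R * R.transpose = 1) (hdet : R.det = 1) :
    ∃ a b c d : ℂ, a ^ 2 + b ^ 2 + c ^ 2 + d ^ 2 = 1 ∧ quaternionMatrix a b c d = R := by
  have key : ∀ e : Fin 3 → ℂ, e 0 * e 0 = 1 → e 1 * e 1 = 1 → e 2 * e 2 = 1 →
      e 0 * e 1 * e 2 = 1 → 1 + R 0 0 * e 0 + R 1 1 * e 1 + R 2 2 * e 2 ≠ 0 →
      ∃ a b c d : ℂ, a ^ 2 + b ^ 2 + c ^ 2 + d ^ 2 = 1 ∧
        R = quaternionMatrix a b c d * Matrix.diagonal e := by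
    intro e h0 h1 h2 he hne
    have hee : Matrix.diagonal e * Matrix.diagonal e = 1 := by
      rw [Matrix.diagonal_mul_diagonal, ← Matrix.diagonal_one]
      congr 1
      ext i
      fin_cases i <;> assumption
    obtain ⟨a, b, c, d, h, hq⟩ := exists_quaternionMatrix_eq_of_trace_ne
      (R := R * Matrix.diagonal e) (by
        rw [Matrix.transpose_mul, Matrix.diagonal_transpose, mul_assoc,
          ← mul_assoc (Matrix.diagonal e), hee, one_mul, hR])
      (by rw [Matrix.det_mul, hdet, Matrix.det_diagonal, Fin.prod_univ_three, he, one_mul])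
      (by simpa [Matrix.mul_diagonal] using hne)
    exact ⟨a, b, c, d, h, by rw [hq, mul_assoc, hee, mul_one]⟩
  by_cases hT : 1 + R 0 0 + R 1 1 + R 2 2 = 0
  · by_cases hT1 : 1 + R 0 0 - R 1 1 - R 2 2 = 0
    · by_cases hT2 : 1 - R 0 0 + R 1 1 - R 2 2 = 0
      · obtain ⟨a, b, c, d, h, hq⟩ := key ![-1, -1, 1] (by simp) (by simp) (by simp) (by simp) (by
          have : 1 - R 0 0 - R 1 1 + R 2 2 = 4 := by linear_combination -hT - hT1 - hT2
          simp
          intro h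
          have h4 : (4 : ℂ) = 0 := by linear_combination h - this
          norm_num at h4)
        refine ⟨-d, c, -b, a, by linear_combination h, ?_⟩
        rw [hq]
        ext i j
        fin_cases i <;> fin_cases j <;> simp [quaternionMatrix, Matrix.mul_diagonal] <;> ring
      · obtain ⟨a, b, c, d, h, hq⟩ := key ![-1, 1, -1] (by simp) (by simp) (by simp) (by simp) (by
          simp
          contrapose! hT2
          linear_combination hT2)
        refine ⟨-c, -d, a, b, by linear_combination h, ?_⟩
        rw [hq]
        ext i j
        fin_cases i <;> fin_cases j <;> simp [quaternionMatrix, Matrix.mul_diagonal] <;> ring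
    · obtain ⟨a, b, c, d, h, hq⟩ := key ![1, -1, -1] (by simp) (by simp) (by simp) (by simp) (by
        simp
        contrapose! hT1
        linear_combination hT1)
      refine ⟨-b, a, d, -c, by linear_combination h, ?_⟩
      rw [hq]
      ext i j
      fin_cases i <;> fin_cases j <;> simp [quaternionMatrix, Matrix.mul_diagonal] <;> ring
  · exact exists_quaternionMatrix_eq_of_trace_ne hR hdet hT

/-- A rotation that depends polynomially on four free parameters: the unit quaternions are identified
with `SL₂(ℂ)`, where the parameters yield the product of elementary matrices
`(1 x; 0 1) (1 0; y 1) (1 z; 0 1) (1 0; w 1)`. -/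
def rotationOfParams (x y z w : ℂ) : Matrix (Fin 3) (Fin 3) ℂ :=
  quaternionMatrix (((1 + x * y) * (1 + z * w) + x * w + (y * z + 1)) / 2)
    (-Complex.I * ((1 + x * y) * (1 + z * w) + x * w - (y * z + 1)) / 2)
    (((1 + x * y) * z + x - (y * (1 + z * w) + w)) / 2)
    (-Complex.I * ((1 + x * y) * z + x + (y * (1 + z * w) + w)) / 2)

theorem rotationOfParams_norm (x y z w : ℂ) :
    (((1 + x * y) * (1 + z * w) + x * w + (y * z + 1)) / 2) ^ 2 +
    (-Complex.I * ((1 + x * y) * (1 + z * w) + x * w - (y * z + 1)) / 2) ^ 2 +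
    (((1 + x * y) * z + x - (y * (1 + z * w) + w)) / 2) ^ 2 +
    (-Complex.I * ((1 + x * y) * z + x + (y * (1 + z * w) + w)) / 2) ^ 2 = 1 := by
  linear_combination ((((1 + x * y) * (1 + z * w) + x * w - (y * z + 1)) / 2) ^ 2 +
    (((1 + x * y) * z + x + (y * (1 + z * w) + w)) / 2) ^ 2) * Complex.I_sq

/-- The parametrization reaches every rotation, since every `2 × 2` matrix of determinant `1` is a
product of four elementary matrices. -/
theorem exists_rotationOfParams_eq {R : Matrix (Fin 3) (Fin 3) ℂ}
    (hR : R * R.transpose = 1) (hdet : R.det = 1) :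
    ∃ x y z w, rotationOfParams x y z w = R := by
  obtain ⟨a, b, c, d, h, hq⟩ := exists_quaternionMatrix_eq hR hdet
  have key : ∀ A B C D : ℂ, A * D - B * C = 1 → ∃ x y z w : ℂ,
      (1 + x * y) * (1 + z * w) + x * w = A ∧ (1 + x * y) * z + x = B ∧
      y * (1 + z * w) + w = C ∧ y * z + 1 = D := by
    intro A B C D hABCD
    by_cases hC : C = 0
    · have hD : D ≠ 0 := by
        rintro rfl
        simp [hC] at hABCD
      refine ⟨(A + B - 1) / D, D, (D - 1) / D, -1, ?_, ?_, ?_, ?_⟩ <;> field_simp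
      · linear_combination -hABCD - B * hC
      · linear_combination hABCD + B * hC
      · linear_combination -hC
      · ring
    · refine ⟨(A - 1) / C, C, (D - 1) / C, 0, ?_, ?_, ?_, ?_⟩ <;> field_simp
      · ring
      · linear_combination hABCD
      · ring
      · ring
  have hI := Complex.I_sq
  obtain ⟨x, y, z, w, h1, h2, h3, h4⟩ := key (a + Complex.I * b) (c + Complex.I * d)
    (-c + Complex.I * d) (a - Complex.I * b) (by
      linear_combination h - (b ^ 2 + d ^ 2) * hI)
  refine ⟨x, y, z, w, ?_⟩
  rw [rotationOfParams, h1, h2, h3, h4, ← hq]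
  congr 1
  · ring
  · linear_combination -b * hI
  · ring
  · linear_combination -d * hI

theorem isPolyFun_rotationOfParams {σ : Type*} {x y z w : (σ → ℂ) → ℂ} (hx : IsPolyFun x)
    (hy : IsPolyFun y) (hz : IsPolyFun z) (hw : IsPolyFun w) (a b : Fin 3) :
    IsPolyFun fun s => rotationOfParams (x s) (y s) (z s) (w s) a b := by
  simp only [rotationOfParams, quaternionMatrix, div_eq_mul_inv]
  fin_cases a <;> fin_cases b <;> simp <;> fun_prop

/-- The cameras with given translation vectors (apart from the entries fixed by the normalization)
and with the rotations of the last two views given by four parameters each. -/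
def CameraConfig.ofParams (r : Fin 3 → Fin 4 → ℂ) (t : Fin 3 → Fin 3 → ℂ) : CameraConfig where
  R v := if v = 0 then 1 else rotationOfParams (r v 0) (r v 1) (r v 2) (r v 3)
  t v a := if v = 0 then 0 else if v = 1 ∧ a = 0 then 1 else t v a
  orthogonal v := by
    split_ifs
    · simp
    · exact quaternionMatrix_mul_transpose (rotationOfParams_norm _ _ _ _)
  det_eq_one v := by
    split_ifs
    · simp
    · exact det_quaternionMatrix (rotationOfParams_norm _ _ _ _)
  R_zero := by simp
  t_zero := by ext; simp
  t_one := by simp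

theorem CameraConfig.exists_ofParams_eq (C : CameraConfig) : ∃ r, ofParams r C.t = C := by
  choose x y z w h using fun v => exists_rotationOfParams_eq (C.orthogonal v) (C.det_eq_one v)
  refine ⟨fun v => ![x v, y v, z v, w v], ?_⟩
  ext v a b
  · by_cases hv : v = 0
    · subst hv
      simp [ofParams, C.R_zero]
    · simp [ofParams, hv, h]
  · by_cases hv : v = 0
    · subst hv
      simp [ofParams, C.t_zero]
    · by_cases h1 : v = 1 ∧ a = 0
      · obtain ⟨rfl, rfl⟩ := h1
        simp [ofParams, C.t_one]
      · simp only [ofParams, hv, h1, if_false]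

/-! ### The space variety and the image variety are irreducible -/

theorem linearIndependent_pair_eta {n : ℕ} {b : Fin 2 → Fin n → ℂ} :
    LinearIndependent ℂ ![b 0, b 1] ↔ LinearIndependent ℂ b := by
  rw [show ![b 0, b 1] = b by ext s; fin_cases s <;> rfl]

theorem Gr.isFrame_of_linearIndependent_pair {n : ℕ} {W : Gr 2 n} {b : Fin 2 → Fin n → ℂ}
    (h : LinearIndependent ℂ ![b 0, b 1]) (h0 : b 0 ∈ W.1) (h1 : b 1 ∈ W.1) : W.IsFrame b :=
  Gr.isFrame_of_mem (linearIndependent_pair_eta.1 h) (by intro s; fin_cases s <;> assumption)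

namespace PL1P

variable {P L : Type*} (Q : PL1P P L)

open Classical in
/-- The rotation and translation parameters among the variables of a `SpaceConfig`; only four of the
nine variables for a rotation are used. -/
def cameraOfVars (x : SpaceVar P L → ℂ) : CameraConfig :=
  CameraConfig.ofParams (fun v => ![x (.rot v 0 0), x (.rot v 0 1), x (.rot v 0 2), x (.rot v 1 0)])
    fun v a => x (.trans v a)

open Classical in
/-- A polynomial chart of the space variety: a pin is the span of its point and of a second vector,
so that the incidences hold for all values of the variables. -/
def spaceChart (x : SpaceVar P L → ℂ) : SpaceVar P L → ℂ
  | .pt i s a => x (.pt i s a)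
  | .ln j s a => if s = 0 then
      if h : ∃ i, Q.inc i j then x (.pt h.choose 0 a) else x (.ln j 0 a)
    else x (.ln j 1 a)
  | .rot v a b => (cameraOfVars x).R v a b
  | .trans v a => (cameraOfVars x).t v a

open Classical in
/-- A polynomial chart of the image variety: an observed pin whose point is observed as well is the
span of this point and of a second vector. -/
def imageChart (x : ImageVar Q.toPointLineProblem → ℂ) : ImageVar Q.toPointLineProblem → ℂ
  | .pt v i s a => x (.pt v i s a)
  | .ln v j s a => if s = 0 then
      if h : ∃ i : Q.seesPt v, Q.inc i j then x (.pt v h.choose 0 a) else x (.ln v j 0 a)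
    else x (.ln v j 1 a)

theorem isPolyFun_cameraOfVars_R (v a b : Fin 3) :
    IsPolyFun fun x : SpaceVar P L → ℂ => (cameraOfVars x).R v a b := by
  by_cases hv : v = 0
  · simp [cameraOfVars, CameraConfig.ofParams, hv]
    fun_prop
  · simp only [cameraOfVars, CameraConfig.ofParams, hv, if_false]
    exact isPolyFun_rotationOfParams (.coord _) (.coord _) (.coord _) (.coord _) a b

theorem isPolyFun_cameraOfVars_t (v a : Fin 3) :
    IsPolyFun fun x : SpaceVar P L → ℂ => (cameraOfVars x).t v a := by
  by_cases hv : v = 0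
  · simp [cameraOfVars, CameraConfig.ofParams, hv]
    fun_prop
  · by_cases h1 : v = 1 ∧ a = 0
    · simp only [cameraOfVars, CameraConfig.ofParams, h1.1, h1.2]
      simp
      fun_prop
    · simp only [cameraOfVars, CameraConfig.ofParams, hv, h1, if_false]
      fun_prop

theorem isPolyFun_spaceChart (k : SpaceVar P L) : IsPolyFun fun x => Q.spaceChart x k := by
  rcases k with ⟨i, s, a⟩ | ⟨j, s, a⟩ | ⟨v, a, b⟩ | ⟨v, a⟩
  · exact .coord _
  · simp only [spaceChart]
    split_ifs <;> exact .coord _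
  · exact isPolyFun_cameraOfVars_R v a b
  · exact isPolyFun_cameraOfVars_t v a

theorem isPolyFun_imageChart (k : ImageVar Q.toPointLineProblem) :
    IsPolyFun fun x => Q.imageChart x k := by
  rcases k with ⟨v, i, s, a⟩ | ⟨v, j, s, a⟩
  · exact .coord _
  · simp only [imageChart]
    split_ifs <;> exact .coord _

variable {Q} in
theorem spaceChart_ln_of_inc {i : P} {j : L} (h : Q.inc i j) (x : SpaceVar P L → ℂ) (a : Fin 4) :
    Q.spaceChart x (.ln j 0 a) = x (.pt i 0 a) := by
  have h' : ∃ i, Q.inc i j := ⟨i, h⟩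
  simp only [spaceChart, if_true, dif_pos h', Q.at_most_one _ _ _ h'.choose_spec h]

variable {Q} in
theorem spaceChart_ln_of_forall_not_inc {j : L} (h : ∀ i, ¬ Q.inc i j) (x : SpaceVar P L → ℂ)
    (a : Fin 4) : Q.spaceChart x (.ln j 0 a) = x (.ln j 0 a) := by
  have h' : ¬ ∃ i, Q.inc i j := by simpa using h
  simp only [spaceChart, if_true, dif_neg h']

variable {Q} in
theorem imageChart_ln_of_inc {v : Fin 3} {i : Q.seesPt v} {j : Q.seesLn v} (h : Q.inc i j)
    (x : ImageVar Q.toPointLineProblem → ℂ) (a : Fin 3) :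
    Q.imageChart x (.ln v j 0 a) = x (.pt v i 0 a) := by
  have h' : ∃ i : Q.seesPt v, Q.inc i j := ⟨i, h⟩
  simp only [imageChart, if_true, dif_pos h',
    Subtype.ext (Q.at_most_one _ _ _ h'.choose_spec h)]

variable {Q} in
theorem imageChart_ln_of_forall_not_inc {v : Fin 3} {j : Q.seesLn v}
    (h : ∀ i : Q.seesPt v, ¬ Q.inc i j) (x : ImageVar Q.toPointLineProblem → ℂ) (a : Fin 3) :
    Q.imageChart x (.ln v j 0 a) = x (.ln v j 0 a) := by
  have h' : ¬ ∃ i : Q.seesPt v, Q.inc i j := by simpa using h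
  simp only [imageChart, if_true, dif_neg h']

theorem mem_spaceVariety_iff (S : SpaceConfig P L) :
    S ∈ Q.spaceVariety ↔ ∃ x, S.IsCoord (Q.spaceChart x) := by
  constructor
  · intro hS
    choose p hp0 hp using fun i => (S.pt i).exists_eq_span_singleton
    have hb : ∀ j, ∃ b : Fin 2 → Fin 4 → ℂ, LinearIndependent ℂ ![b 0, b 1] ∧ (b 0 ∈ (S.ln j).1) ∧
        (b 1 ∈ (S.ln j).1) ∧ ∀ i, Q.inc i j → b 0 = p i := by
      intro j
      by_cases h : ∃ i, Q.inc i j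
      · obtain ⟨i, hi⟩ := h
        have hpi : p i ∈ (S.ln j).1 := hS i j hi (by
          rw [hp]; exact Submodule.mem_span_singleton_self _)
        obtain ⟨q, hq, hli⟩ := (S.ln j).exists_linearIndependent_pair (hp0 i)
        exact ⟨![p i, q], hli, hpi, hq, fun i' hi' => by rw [Q.at_most_one _ _ _ hi' hi]; rfl⟩
      · push Not at h
        obtain ⟨p, q, hli, hl⟩ := (S.ln j).exists_eq_span_pair
        refine ⟨![p, q], hli, ?_, ?_, fun i hi => (h i hi).elim⟩ <;> rw [hl] <;>
          exact Submodule.subset_span (by simp)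
    choose b hli hb0 hb1 hbp using hb
    obtain ⟨r, hr⟩ := S.cam.exists_ofParams_eq
    let x : SpaceVar P L → ℂ
      | .pt i _ a => p i a
      | .ln j s a => b j s a
      | .rot v a c => r v (if c = 0 then (if a = 0 then 0 else 3) else if c = 1 then 1 else 2)
      | .trans v a => S.cam.t v a
    have hcam : cameraOfVars x = S.cam := by
      rw [← hr, cameraOfVars]
      congr 1
      ext v k
      fin_cases k <;> simp [x]
    refine ⟨x, fun i => Gr.isFrame_one_iff.2 (hp i), fun j => ?_, fun v a c => ?_, fun v a => ?_⟩
    · convert Gr.isFrame_of_linearIndependent_pair (hli j) (hb0 j) (hb1 j) using 1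
      ext s a
      fin_cases s
      · by_cases h : ∃ i, Q.inc i j
        · obtain ⟨i, hi⟩ := h
          exact (spaceChart_ln_of_inc hi x a).trans (congrFun (hbp j i hi).symm a)
        · push Not at h
          exact spaceChart_ln_of_forall_not_inc h x a
      · simp [spaceChart, x]
    · change (cameraOfVars x).R v a c = _
      rw [hcam]
    · change (cameraOfVars x).t v a = _
      rw [hcam]
  · rintro ⟨x, hx⟩ i j hij
    have h1 := Gr.isFrame_one_iff.1 (hx.1 i)
    rw [h1, Submodule.span_singleton_le_iff_mem]
    convert (hx.2.1 j).mem 0 using 1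
    ext a
    exact (spaceChart_ln_of_inc hij x a).symm

variable {Q} in
/-- Coordinates of an image can be used as values of the variables of the chart, unless the second
basis vector of a pin is proportional to its point. -/
theorem isCoord_imageChart {y : ImageConfig Q.toPointLineProblem} (hy : y ∈ Q.imageVariety)
    {c : ImageVar Q.toPointLineProblem → ℂ} (hc : y.IsCoord c)
    (hli : ∀ v (i : Q.seesPt v) (j : Q.seesLn v), Q.inc i j →
      LinearIndependent ℂ ![fun a => c (.pt v i 0 a), fun a => c (.ln v j 1 a)]) :
    y.IsCoord (Q.imageChart c) := by
  refine ⟨hc.1, fun v j => ?_⟩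
  by_cases h : ∃ i : Q.seesPt v, Q.inc i j
  · obtain ⟨i, hi⟩ := h
    have h0 : (fun a => Q.imageChart c (.ln v j 0 a)) = fun a => c (.pt v i 0 a) :=
      funext fun a => imageChart_ln_of_inc hi c a
    have h1 : (fun a => Q.imageChart c (.ln v j 1 a)) = fun a => c (.ln v j 1 a) := by
      ext a
      simp [imageChart]
    apply Gr.isFrame_of_linearIndependent_pair
    · rw [h0, h1]
      exact hli v i j hi
    · rw [h0]
      exact hy v i j hi ((hc.1 v i).mem 0)
    · rw [h1]
      exact (hc.2 v j).mem 1
  · push Not at h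
    convert hc.2 v j using 1
    ext s a
    fin_cases s
    · exact imageChart_ln_of_forall_not_inc h c a
    · simp [imageChart]

theorem mem_imageVariety_iff (y : ImageConfig Q.toPointLineProblem) :
    y ∈ Q.imageVariety ↔ ∃ x, y.IsCoord (Q.imageChart x) := by
  constructor
  · intro hy
    choose p hp0 hp using fun v i => (y.pt v i).exists_eq_span_singleton
    have hb : ∀ v (j : Q.seesLn v), ∃ b : Fin 2 → Fin 3 → ℂ, LinearIndependent ℂ ![b 0, b 1] ∧
        (b 0 ∈ (y.ln v j).1) ∧
        (b 1 ∈ (y.ln v j).1) ∧ ∀ i : Q.seesPt v, Q.inc i j → b 0 = p v i := by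
      intro v j
      by_cases h : ∃ i : Q.seesPt v, Q.inc i j
      · obtain ⟨i, hi⟩ := h
        have hpi : p v i ∈ (y.ln v j).1 := hy v i j hi (by
          rw [hp]; exact Submodule.mem_span_singleton_self _)
        obtain ⟨q, hq, hli⟩ := (y.ln v j).exists_linearIndependent_pair (hp0 v i)
        exact ⟨![p v i, q], hli, hpi, hq, fun i' hi' => by
          rw [Subtype.ext (Q.at_most_one _ _ _ hi' hi)]; rfl⟩
      · push Not at h
        obtain ⟨p, q, hli, hl⟩ := (y.ln v j).exists_eq_span_pair
        refine ⟨![p, q], hli, ?_, ?_, fun i hi => (h i hi).elim⟩ <;> rw [hl] <;>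
          exact Submodule.subset_span (by simp)
    choose b hli hb0 hb1 hbp using hb
    let x : ImageVar Q.toPointLineProblem → ℂ
      | .pt v i _ a => p v i a
      | .ln v j s a => b v j s a
    refine ⟨x, isCoord_imageChart hy ⟨fun v i => Gr.isFrame_one_iff.2 (hp v i), fun v j =>
      Gr.isFrame_of_linearIndependent_pair (hli v j) (hb0 v j) (hb1 v j)⟩ fun v i j hij => ?_⟩
    have := hli v j
    rwa [hbp v j i hij] at this
  · rintro ⟨x, hx⟩ v i j hij
    have h1 := Gr.isFrame_one_iff.1 (hx.1 v i)
    rw [h1, Submodule.span_singleton_le_iff_mem]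
    convert (hx.2 v j).mem 0 using 1
    ext a
    exact (imageChart_ln_of_inc hij x a).symm

variable [Finite P] [Finite L]

theorem isPolyChart_spaceChart : IsPolyChart SpaceConfig.IsCoord Q.spaceChart :=
  isPolyChart_space Q.isPolyFun_spaceChart fun x =>
    ⟨cameraOfVars x, fun _ _ _ => rfl, fun _ _ => rfl⟩

theorem isPolyChart_imageChart : IsPolyChart ImageConfig.IsCoord Q.imageChart :=
  isPolyChart_image Q.isPolyFun_imageChart

theorem spaceVariety_subset_closure {U : Set (SpaceConfig P L)} (hU : IsOpen U)
    (hne : (Q.spaceVariety ∩ U).Nonempty) : Q.spaceVariety ⊆ closure (Q.spaceVariety ∩ U) :=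
  Q.isPolyChart_spaceChart.subset_closure (fun _ _ _ h h' => h.eq h') Q.mem_spaceVariety_iff hU hne

theorem imageVariety_subset_closure {U : Set (ImageConfig Q.toPointLineProblem)} (hU : IsOpen U)
    (hne : (Q.imageVariety ∩ U).Nonempty) : Q.imageVariety ⊆ closure (Q.imageVariety ∩ U) :=
  Q.isPolyChart_imageChart.subset_closure (fun _ _ _ h h' => h.eq h') Q.mem_imageVariety_iff hU hne

end PL1P

/-! ### Camera centers and configurations in general position -/

namespace CameraConfig

variable (C : CameraConfig)

/-- The center of the `v`-th camera, normalized to have last coordinate `1`. -/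
def center (v : Fin 3) : Fin 4 → ℂ :=
  Fin.snoc (α := fun _ => ℂ) (fun b => -∑ a, C.R v a b * C.t v a) 1

theorem proj_apply (v : Fin 3) (x : Fin 4 → ℂ) (a : Fin 3) :
    C.proj v x a = ∑ b, C.R v a b * x b.castSucc + C.t v a * x 3 := by
  simp [proj, matrix, Matrix.mulVec, dotProduct, Fin.sum_univ_castSucc (n := 3), Fin.snoc]

theorem sum_R_mul_R (v a c : Fin 3) : ∑ b, C.R v a b * C.R v c b = if a = c then 1 else 0 := by
  rw [← Matrix.one_apply, ← C.orthogonal v, Matrix.mul_apply]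
  rfl

theorem sum_R_mul_R' (v a c : Fin 3) : ∑ b, C.R v b a * C.R v b c = if a = c then 1 else 0 := by
  rw [← Matrix.one_apply, ← mul_eq_one_comm.1 (C.orthogonal v), Matrix.mul_apply]
  rfl

theorem center_castSucc (v b : Fin 3) : C.center v b.castSucc = -∑ a, C.R v a b * C.t v a := by
  simp [center]

theorem center_last (v : Fin 3) : C.center v 3 = 1 :=
  Fin.snoc_last (α := fun _ => ℂ) _ _

theorem center_ne_zero (v : Fin 3) : C.center v ≠ 0 := fun h => by
  have := C.center_last v
  simp [h] at this

theorem ker_proj (v : Fin 3) : LinearMap.ker (C.proj v) = Submodule.span ℂ {C.center v} := by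
  apply le_antisymm
  · intro x hx
    rw [Submodule.mem_span_singleton]
    refine ⟨x 3, ?_⟩
    have h : ∀ a, ∑ b, C.R v a b * x b.castSucc + C.t v a * x 3 = 0 := fun a => by
      rw [← proj_apply, LinearMap.mem_ker.1 hx, Pi.zero_apply]
    ext k
    refine Fin.lastCases ?_ (fun b => ?_) k
    · exact (congrArg (x 3 * ·) (C.center_last v)).trans (mul_one _)
    · rw [Pi.smul_apply, center_castSucc, smul_eq_mul]
      have h1 : ∑ a, C.R v a b * (∑ c, C.R v a c * x c.castSucc + C.t v a * x 3) = 0 := by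
        simp [h]
      simp only [mul_add, Finset.sum_add_distrib, Finset.mul_sum] at h1
      rw [Finset.sum_comm] at h1
      simp only [← mul_assoc, ← Finset.sum_mul, C.sum_R_mul_R', ite_mul, one_mul, zero_mul,
        Finset.sum_ite_eq, Finset.mem_univ, if_true] at h1
      linear_combination -h1
  · rw [Submodule.span_singleton_le_iff_mem, LinearMap.mem_ker]
    ext a
    rw [proj_apply, center_last]
    simp only [center_castSucc, mul_neg, Finset.sum_neg_distrib, Finset.mul_sum]
    rw [Finset.sum_comm]
    simp only [← mul_assoc, ← Finset.sum_mul, C.sum_R_mul_R, ite_mul, one_mul, zero_mul,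
      Finset.sum_ite_eq, Finset.mem_univ, if_true, mul_one, neg_add_cancel, Pi.zero_apply]

theorem proj_center (v : Fin 3) : C.proj v (C.center v) = 0 := by
  rw [← LinearMap.mem_ker, ker_proj]
  exact Submodule.mem_span_singleton_self _

theorem proj_eq_zero_iff (v : Fin 3) (x : Fin 4 → ℂ) :
    C.proj v x = 0 ↔ ∃ a : ℂ, a • C.center v = x := by
  rw [← LinearMap.mem_ker, ker_proj, Submodule.mem_span_singleton]

theorem range_proj (v : Fin 3) : LinearMap.range (C.proj v) = ⊤ := by
  have h := (C.proj v).finrank_range_add_finrank_ker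
  rw [ker_proj, finrank_span_singleton (C.center_ne_zero v)] at h
  apply Submodule.eq_top_of_finrank_eq
  simp only [Module.finrank_fin_fun] at h ⊢
  omega

theorem finrank_comap_proj (v : Fin 3) (m : Submodule ℂ (Fin 3 → ℂ)) :
    Module.finrank ℂ (m.comap (C.proj v)) = Module.finrank ℂ m + 1 := by
  have h := ((C.proj v).domRestrict (m.comap (C.proj v))).finrank_range_add_finrank_ker
  rw [LinearMap.range_domRestrict, Submodule.map_comap_eq, range_proj, top_inf_eq,
    LinearMap.ker_domRestrict] at h
  rw [← h, LinearEquiv.finrank_eq (Submodule.comapSubtypeEquivOfLe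
    (show LinearMap.ker (C.proj v) ≤ m.comap (C.proj v) from LinearMap.ker_le_comap _)), ker_proj,
    finrank_span_singleton (C.center_ne_zero v)]

theorem disjoint_ker_proj {v : Fin 3} {W : Submodule ℂ (Fin 4 → ℂ)} (h : C.center v ∉ W) :
    Disjoint W (LinearMap.ker (C.proj v)) := by
  rw [ker_proj]
  exact Submodule.disjoint_span_singleton_of_notMem h

theorem eq_zero_of_proj_eq_zero {v : Fin 3} {W : Submodule ℂ (Fin 4 → ℂ)} (h : C.center v ∉ W)
    {x : Fin 4 → ℂ} (hx : x ∈ W) (h0 : C.proj v x = 0) : x = 0 :=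
  Submodule.disjoint_def.1 (C.disjoint_ker_proj h) x hx h0

theorem finrank_map_proj {v : Fin 3} {W : Submodule ℂ (Fin 4 → ℂ)} (h : C.center v ∉ W) :
    Module.finrank ℂ (W.map (C.proj v)) = Module.finrank ℂ W := by
  apply LinearEquiv.finrank_eq
  refine (LinearEquiv.ofInjective ((C.proj v).domRestrict W) ?_ ≪≫ₗ
    LinearEquiv.ofEq _ _ (LinearMap.range_domRestrict _ _)).symm
  rw [← LinearMap.ker_eq_bot, LinearMap.ker_domRestrict, ← Submodule.disjoint_iff_comap_eq_bot]
  exact C.disjoint_ker_proj h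

/-- If a line maps to a line, then it does not meet the center of the camera. -/
theorem center_notMem_of_finrank_map {v : Fin 3} {W : Submodule ℂ (Fin 4 → ℂ)}
    (h : Module.finrank ℂ (W.map (C.proj v)) = Module.finrank ℂ W) : C.center v ∉ W := by
  intro hc
  have h1 := ((C.proj v).domRestrict W).finrank_range_add_finrank_ker
  rw [LinearMap.range_domRestrict, h, LinearMap.ker_domRestrict] at h1
  have h2 : (LinearMap.ker (C.proj v)).comap W.subtype = ⊥ := by
    rw [← Submodule.finrank_eq_zero (R := ℂ)]
    omega
  have h3 : (⟨_, hc⟩ : W) ∈ (LinearMap.ker (C.proj v)).comap W.subtype := C.proj_center v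
  rw [h2, Submodule.mem_bot] at h3
  exact C.center_ne_zero v (congrArg Subtype.val h3)

/-- The line through the centers of two cameras. -/
def baseline (v w : Fin 3) : Submodule ℂ (Fin 4 → ℂ) :=
  Submodule.span ℂ (Set.range ![C.center v, C.center w])

theorem center_mem_baseline_left (v w : Fin 3) : C.center v ∈ C.baseline v w :=
  Submodule.subset_span ⟨0, rfl⟩

theorem center_mem_baseline_right (v w : Fin 3) : C.center w ∈ C.baseline v w :=
  Submodule.subset_span ⟨1, rfl⟩

theorem finrank_baseline_le (v w : Fin 3) : Module.finrank ℂ (C.baseline v w) ≤ 2 :=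
  (finrank_range_le_card _).trans (by simp)

end CameraConfig

theorem linearIndependent_append {V : Type*} [AddCommGroup V] [Module ℂ V] {k l : ℕ}
    {a : Fin k → V} {b : Fin l → V} :
    LinearIndependent ℂ (Fin.append a b) ↔ LinearIndependent ℂ a ∧ LinearIndependent ℂ b ∧
      Disjoint (Submodule.span ℂ (Set.range a)) (Submodule.span ℂ (Set.range b)) := by
  rw [← linearIndependent_equiv finSumFinEquiv, linearIndependent_sum]
  have h1 : (Fin.append a b ∘ finSumFinEquiv) ∘ Sum.inl = a := by ext; simp
  have h2 : (Fin.append a b ∘ finSumFinEquiv) ∘ Sum.inr = b := by ext; simp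
  rw [h1, h2]

namespace SpaceConfig

variable {P L : Type*}

/-- The camera centers are distinct, and no point or line meets a line through two of them. -/
structure IsGeneral (S : SpaceConfig P L) : Prop where
  centers : ∀ v w, v ≠ w → LinearIndependent ℂ ![S.cam.center v, S.cam.center w]
  pt : ∀ v w, v ≠ w → ∀ i, Disjoint (S.cam.baseline v w) (S.pt i).1
  ln : ∀ v w, v ≠ w → ∀ j, Disjoint (S.cam.baseline v w) (S.ln j).1

theorem exists_ne (v : Fin 3) : ∃ w, v ≠ w := by
  revert v; decide

theorem IsGeneral.center_notMem_pt {S : SpaceConfig P L} (h : S.IsGeneral) (v : Fin 3) (i : P) :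
    S.cam.center v ∉ (S.pt i).1 := by
  obtain ⟨w, hw⟩ := exists_ne v
  exact fun hc => S.cam.center_ne_zero v
    (Submodule.disjoint_def.1 (h.pt v w hw i) _ (S.cam.center_mem_baseline_left v w) hc)

theorem IsGeneral.center_notMem_ln {S : SpaceConfig P L} (h : S.IsGeneral) (v : Fin 3) (j : L) :
    S.cam.center v ∉ (S.ln j).1 := by
  obtain ⟨w, hw⟩ := exists_ne v
  exact fun hc => S.cam.center_ne_zero v
    (Submodule.disjoint_def.1 (h.ln v w hw j) _ (S.cam.center_mem_baseline_left v w) hc)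

theorem isOpen_setOf_linearIndependent {k : ℕ} {b : (SpaceVar P L → ℂ) → Fin k → Fin 4 → ℂ}
    (hb : ∀ s a, IsPolyFun fun x => b x s a) :
    IsOpen {S : SpaceConfig P L | ∃ c, S.IsCoord c ∧ LinearIndependent ℂ (b c)} := by
  rw [isOpen_iff_forall_mem_open]
  rintro S ⟨c, hc, hli⟩
  obtain ⟨u, ⟨f, hf⟩, hu, h⟩ := exists_isPolyFun_of_linearIndependent hb hli
  refine ⟨zariskiBasicOpen IsCoord f, ?_, TopologicalSpace.isOpen_generateFrom_of_mem ⟨f, rfl⟩,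
    c, hc, by rwa [hf]⟩
  rintro S' ⟨c', hc', hfc⟩
  exact ⟨c', hc', h c' (by rwa [← hf])⟩

/-- The camera centers in terms of the coordinates of a configuration. -/
def centerOfVars (c : SpaceVar P L → ℂ) (v : Fin 3) : Fin 4 → ℂ :=
  Fin.snoc (α := fun _ => ℂ) (fun b => -∑ a, c (.rot v a b) * c (.trans v a)) 1

theorem IsCoord.centerOfVars_eq {S : SpaceConfig P L} {c : SpaceVar P L → ℂ} (hc : S.IsCoord c)
    (v : Fin 3) : centerOfVars c v = S.cam.center v := by
  simp only [centerOfVars, CameraConfig.center, hc.2.2.1, hc.2.2.2]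

theorem isPolyFun_centerOfVars (v : Fin 3) (a : Fin 4) :
    IsPolyFun fun c : SpaceVar P L → ℂ => centerOfVars c v a := by
  refine Fin.lastCases ?_ (fun b => ?_) a
  · simp only [centerOfVars, Fin.snoc_last]
    fun_prop
  · simp only [centerOfVars, Fin.snoc_castSucc]
    fun_prop

theorem isPolyFun_centers (v w : Fin 3) (s : Fin 2) (a : Fin 4) :
    IsPolyFun fun c : SpaceVar P L → ℂ => ![centerOfVars c v, centerOfVars c w] s a := by
  fin_cases s
  · exact isPolyFun_centerOfVars v a
  · exact isPolyFun_centerOfVars w a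

theorem isPolyFun_append {k l : ℕ} {σ : Type*} {b : (σ → ℂ) → Fin k → Fin 4 → ℂ}
    {b' : (σ → ℂ) → Fin l → Fin 4 → ℂ} (hb : ∀ s a, IsPolyFun fun x => b x s a)
    (hb' : ∀ s a, IsPolyFun fun x => b' x s a) (s : Fin (k + l)) (a : Fin 4) :
    IsPolyFun fun x => Fin.append (b x) (b' x) s a := by
  refine Fin.addCases (fun s => ?_) (fun s => ?_) s
  · simpa using hb s a
  · simpa using hb' s a

theorem isOpen_setOf_isGeneral [Finite P] [Finite L] :
    IsOpen {S : SpaceConfig P L | S.IsGeneral} := by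
  have h0 := fun v w => isOpen_setOf_linearIndependent (P := P) (L := L) (isPolyFun_centers v w)
  have h1 := fun v w i => isOpen_setOf_linearIndependent (P := P) (L := L)
    (isPolyFun_append (isPolyFun_centers v w)
      (b' := fun c s a => c (.pt i s a)) fun s a => .coord _)
  have h2 := fun v w j => isOpen_setOf_linearIndependent (P := P) (L := L)
    (isPolyFun_append (isPolyFun_centers v w)
      (b' := fun c s a => c (.ln j s a)) fun s a => .coord _)
  have h := isOpen_iInter_of_finite fun v => isOpen_iInter_of_finite fun w =>
    isOpen_iInter_of_finite fun _ : v ≠ w =>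
    (h0 v w).inter ((isOpen_iInter_of_finite (h1 v w)).inter (isOpen_iInter_of_finite (h2 v w)))
  convert h using 1
  ext S
  simp only [Set.mem_iInter, Set.mem_inter_iff, Set.mem_ofPred_eq]
  constructor
  · intro hS v w hvw
    obtain ⟨c, hc⟩ := S.exists_isCoord
    have hcen : LinearIndependent ℂ ![centerOfVars c v, centerOfVars c w] := by
      rw [hc.centerOfVars_eq, hc.centerOfVars_eq]
      exact hS.centers v w hvw
    refine ⟨⟨c, hc, hcen⟩, fun i => ⟨c, hc, linearIndependent_append.2
      ⟨hcen, (hc.1 i).linearIndependent, ?_⟩⟩, fun i => ⟨c, hc, linearIndependent_append.2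
      ⟨hcen, (hc.2.1 i).linearIndependent, ?_⟩⟩⟩
    · rw [hc.centerOfVars_eq, hc.centerOfVars_eq, hc.1 i]
      exact hS.pt v w hvw i
    · rw [hc.centerOfVars_eq, hc.centerOfVars_eq, hc.2.1 i]
      exact hS.ln v w hvw i
  · intro hS
    refine ⟨fun v w hvw => ?_, fun v w hvw i => ?_, fun v w hvw i => ?_⟩
    · obtain ⟨c, hc, hcen⟩ := (hS v w hvw).1
      rwa [hc.centerOfVars_eq, hc.centerOfVars_eq] at hcen
    · obtain ⟨c, hc, h⟩ := (hS v w hvw).2.1 i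
      have := (linearIndependent_append.1 h).2.2
      rwa [hc.centerOfVars_eq, hc.centerOfVars_eq, hc.1 i] at this
    · obtain ⟨c, hc, h⟩ := (hS v w hvw).2.2 i
      have := (linearIndependent_append.1 h).2.2
      rwa [hc.centerOfVars_eq, hc.centerOfVars_eq, hc.2.1 i] at this

end SpaceConfig

/-- A subspace is not covered by finitely many subspaces that do not contain it. -/
theorem Submodule.exists_mem_forall_notMem {V ι : Type*} [AddCommGroup V] [Module ℂ V] [Finite ι]
    (W : Submodule ℂ V) (F : ι → Submodule ℂ V) (h : ∀ k, ¬ W ≤ F k) :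
    ∃ x ∈ W, ∀ k, x ∉ F k := by
  by_contra! hcon
  obtain ⟨k, hk⟩ := Subspace.exists_eq_top_of_iUnion_eq_univ
    (p := fun k => (F k).comap W.subtype) (by
      ext ⟨x, hx⟩
      simpa using hcon x hx)
  exact h k fun x hx => by
    have : (⟨x, hx⟩ : W) ∈ (F k).comap W.subtype := by rw [hk]; trivial
    exact this

namespace PL1P

variable {P L : Type*} (Q : PL1P P L) {K : Set P} {M : Set L}

/-- A point of `W` that does not lie in `H` or on a line through two camera centers. -/
theorem exists_generalPoint (C : CameraConfig) (W H : Submodule ℂ (Fin 4 → ℂ)) (hH : ¬ W ≤ H)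
    (hW : ∀ v w, v ≠ w → ¬ W ≤ C.baseline v w) :
    ∃ p ∈ W, p ≠ 0 ∧ p ∉ H ∧ ∀ v w, v ≠ w → p ∉ C.baseline v w := by
  obtain ⟨p, hpW, hp⟩ := W.exists_mem_forall_notMem
    (fun k : Option {k : Fin 3 × Fin 3 // k.1 ≠ k.2} =>
      k.elim H fun k => C.baseline k.1.1 k.1.2) (by
        rintro (_ | ⟨⟨v, w⟩, hvw⟩)
        · exact hH
        · exact hW v w hvw)
  refine ⟨p, hpW, ?_, hp none, fun v w hvw => hp (some ⟨(v, w), hvw⟩)⟩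
  rintro rfl
  exact hp none (Submodule.zero_mem _)

/-- A line through a given point that does not lie in `G` or meet a line through two camera centers. -/
theorem exists_generalLine (C : CameraConfig) {p : Fin 4 → ℂ} (hp : p ≠ 0)
    (hpC : ∀ v w, v ≠ w → p ∉ C.baseline v w) {G : Submodule ℂ (Fin 4 → ℂ)} (hG : G ≠ ⊤) :
    ∃ l : Gr 2 4, p ∈ l.1 ∧ ¬ l.1 ≤ G ∧ ∀ v w, v ≠ w → Disjoint (C.baseline v w) l.1 := by
  have hlt : ∀ v w, ¬ (⊤ : Submodule ℂ (Fin 4 → ℂ)) ≤ C.baseline v w ⊔ Submodule.span ℂ {p} := by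
    intro v w h
    have h1 := Submodule.finrank_mono h
    have h2 := Submodule.finrank_add_le_finrank_add_finrank (C.baseline v w)
      (Submodule.span ℂ {p})
    rw [finrank_span_singleton hp] at h2
    have h3 := C.finrank_baseline_le v w
    rw [finrank_top, Module.finrank_fin_fun] at h1
    omega
  obtain ⟨q, -, hq⟩ := (⊤ : Submodule ℂ (Fin 4 → ℂ)).exists_mem_forall_notMem
    (fun k : Option (Fin 3 × Fin 3) =>
      k.elim G fun k => C.baseline k.1 k.2 ⊔ Submodule.span ℂ {p}) (by
        rintro (_ | ⟨v, w⟩)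
        · simpa using hG
        · exact hlt v w)
  have hqp : ∀ a : ℂ, a • p ≠ q := fun a ha => hq (some (0, 0)) (by
    rw [← ha]
    exact Submodule.mem_sup_right (Submodule.smul_mem _ _ (Submodule.mem_span_singleton_self _)))
  refine ⟨Gr.line p q ((LinearIndependent.pair_iff' hp).2 hqp),
    Submodule.subset_span (by simp), fun h => hq none (h (Submodule.subset_span (by simp))), ?_⟩
  intro v w hvw
  rw [Submodule.disjoint_def]
  intro x hx hxl
  obtain ⟨a, b, rfl⟩ := Submodule.mem_span_pair.1 hxl
  have hb : b = 0 := by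
    by_contra hb
    apply hq (some (v, w))
    have h1 : b • q ∈ C.baseline v w ⊔ Submodule.span ℂ {p} := by
      have : b • q = (a • p + b • q) - a • p := by abel
      rw [this]
      exact Submodule.sub_mem _ (Submodule.mem_sup_left hx) (Submodule.mem_sup_right
        (Submodule.smul_mem _ _ (Submodule.mem_span_singleton_self _)))
    exact (Submodule.smul_mem_iff _ hb).1 h1
  subst hb
  have ha : a = 0 := by
    by_contra ha
    apply hpC v w hvw
    rw [zero_smul, add_zero] at hx
    exact (Submodule.smul_mem_iff _ ha).1 hx
  simp [ha]

/-- A configuration in general position extends to the forgotten points and lines, which can be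
chosen outside given subspaces. -/
theorem exists_extension (hKM : ∀ i ∉ K, ∀ j ∈ M, ∀ j' ∈ M, Q.inc i j → Q.inc i j' → j = j')
    {S' : SpaceConfig K M} (hS' : S' ∈ (Q.forget K M).spaceVariety) (hg : S'.IsGeneral)
    (H : P → Submodule ℂ (Fin 4 → ℂ)) (G : L → Submodule ℂ (Fin 4 → ℂ))
    (hH : ∀ i ∉ K, H i ≠ ⊤ ∧ ∀ j : M, Q.inc i j → ¬ (S'.ln j).1 ≤ H i)
    (hG : ∀ j ∉ M, G j ≠ ⊤) :
    ∃ S ∈ Q.spaceVariety, S.IsGeneral ∧ spaceForget K M S = S' ∧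
      (∀ i ∉ K, ¬ (S.pt i).1 ≤ H i) ∧ ∀ j ∉ M, ¬ (S.ln j).1 ≤ G j := by
  have hbase : ∀ (W : Submodule ℂ (Fin 4 → ℂ)) v w, v ≠ w → 2 < Module.finrank ℂ W →
      ¬ W ≤ S'.cam.baseline v w := by
    intro W v w _ h2 h
    have h1 := Submodule.finrank_mono h
    have := S'.cam.finrank_baseline_le v w
    omega
  have hpts : ∀ i, ∃ p : Gr 1 4, (∀ h : i ∈ K, p = S'.pt ⟨i, h⟩) ∧
      (∀ v w, v ≠ w → Disjoint (S'.cam.baseline v w) p.1) ∧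
      (i ∉ K → ¬ p.1 ≤ H i ∧ ∀ j : M, Q.inc i j → p.1 ≤ (S'.ln j).1) := by
    intro i
    by_cases hi : i ∈ K
    · exact ⟨S'.pt ⟨i, hi⟩, fun _ => rfl, fun v w hvw => hg.pt v w hvw ⟨i, hi⟩, fun h => (h hi).elim⟩
    · obtain ⟨W, hWH, hWb, hW⟩ : ∃ W : Submodule ℂ (Fin 4 → ℂ), ¬ W ≤ H i ∧
          (∀ v w, v ≠ w → ¬ W ≤ S'.cam.baseline v w) ∧
          ∀ j : M, Q.inc i j → W = (S'.ln j).1 := by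
        by_cases hj : ∃ j : M, Q.inc i j
        · obtain ⟨j, hj⟩ := hj
          refine ⟨(S'.ln j).1, (hH i hi).2 j hj, fun v w hvw h => ?_, fun j' hj' => ?_⟩
          · have h1 := (hg.ln v w hvw j).eq_bot_of_ge h
            have h2 := (S'.ln j).2
            rw [h1, finrank_bot] at h2
            omega
          · rw [Subtype.ext (hKM i hi j j.2 j' j'.2 hj hj')]
        · refine ⟨⊤, by simpa using (hH i hi).1, fun v w hvw => hbase _ v w hvw (by simp),
            fun j h => (hj ⟨j, h⟩).elim⟩
      obtain ⟨p, hpW, hp0, hpH, hpb⟩ := exists_generalPoint S'.cam W (H i) hWH hWb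
      refine ⟨Gr.point p hp0, fun h => (hi h).elim, fun v w hvw => ?_, fun _ => ⟨fun h => hpH ?_,
        fun j hj => ?_⟩⟩
      · exact Submodule.disjoint_span_singleton_of_notMem (hpb v w hvw)
      · exact h (Submodule.mem_span_singleton_self p)
      · rw [← hW j hj]
        exact (Submodule.span_singleton_le_iff_mem _ _).2 hpW
  choose p hpK hpb hpH using hpts
  have hlns : ∀ j, ∃ l : Gr 2 4, (∀ h : j ∈ M, l = S'.ln ⟨j, h⟩) ∧
      (∀ v w, v ≠ w → Disjoint (S'.cam.baseline v w) l.1) ∧ (j ∉ M → ¬ l.1 ≤ G j) ∧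
      ∀ i, Q.inc i j → (p i).1 ≤ l.1 := by
    intro j
    by_cases hj : j ∈ M
    · refine ⟨S'.ln ⟨j, hj⟩, fun _ => rfl, fun v w hvw => hg.ln v w hvw ⟨j, hj⟩,
        fun h => (h hj).elim, fun i hij => ?_⟩
      by_cases hi : i ∈ K
      · rw [hpK i hi]
        exact hS' ⟨i, hi⟩ ⟨j, hj⟩ hij
      · exact (hpH i hi).2 ⟨j, hj⟩ hij
    · obtain ⟨q, hq0, hqb, hq⟩ : ∃ q : Fin 4 → ℂ, q ≠ 0 ∧
          (∀ v w, v ≠ w → q ∉ S'.cam.baseline v w) ∧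
          ∀ i, Q.inc i j → (p i).1 = Submodule.span ℂ {q} := by
        by_cases h : ∃ i, Q.inc i j
        · obtain ⟨i, hij⟩ := h
          obtain ⟨q, hq0, hq⟩ := (p i).exists_eq_span_singleton
          refine ⟨q, hq0, fun v w hvw hqb => hq0 ?_, fun i' hi' => ?_⟩
          · refine Submodule.disjoint_def.1 (hpb i v w hvw) q hqb ?_
            rw [hq]
            exact Submodule.mem_span_singleton_self q
          · rw [Q.at_most_one _ _ _ hi' hij, hq]
        · obtain ⟨q, -, hq0, -, hqb⟩ := exists_generalPoint S'.cam ⊤ ⊥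
            (by simp) fun v w hvw => hbase _ v w hvw (by simp)
          exact ⟨q, hq0, hqb, fun i hi => (h ⟨i, hi⟩).elim⟩
      obtain ⟨l, hql, hlG, hlb⟩ := exists_generalLine S'.cam hq0 hqb (hG j hj)
      refine ⟨l, fun h => (hj h).elim, hlb, fun _ => hlG, fun i hij => ?_⟩
      rw [hq i hij]
      exact (Submodule.span_singleton_le_iff_mem _ _).2 hql
  choose l hlM hlb hlG hlp using hlns
  refine ⟨⟨p, l, S'.cam⟩, fun i j hij => hlp j i hij, ⟨hg.centers, fun v w hvw i => hpb i v w hvw,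
    fun v w hvw j => hlb j v w hvw⟩, ?_, fun i hi => (hpH i hi).1, hlG⟩
  ext1
  · exact funext fun i => hpK i i.2
  · exact funext fun j => hlM j j.2
  · rfl

/-- Cameras with distinct centers. -/
def standardCameras : CameraConfig where
  R _ := 1
  t := ![0, ![1, 0, 0], ![0, 1, 0]]
  orthogonal _ := by simp
  det_eq_one _ := by simp
  R_zero := rfl
  t_zero := rfl
  t_one := rfl

theorem linearIndependent_standardCameras_center (v w : Fin 3) (h : v ≠ w) :
    LinearIndependent ℂ ![standardCameras.center v, standardCameras.center w] := by
  rw [LinearIndependent.pair_iff]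
  intro a b hab
  have hc : ∀ v b, standardCameras.center v (Fin.castSucc b) = -standardCameras.t v b := by
    intro v b
    rw [CameraConfig.center_castSucc]
    simp [standardCameras, Matrix.one_apply]
  have h3 := congrFun hab 3
  have h0 := congrFun hab (Fin.castSucc 0)
  have h1 := congrFun hab (Fin.castSucc 1)
  simp only [Pi.add_apply, Pi.smul_apply, CameraConfig.center_last, smul_eq_mul, hc,
    Pi.zero_apply] at h3 h0 h1
  fin_cases v <;> fin_cases w <;> simp_all [standardCameras]

theorem exists_isGeneral : ∃ S ∈ Q.spaceVariety, S.IsGeneral := by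
  let S' : SpaceConfig (∅ : Set P) (∅ : Set L) :=
    ⟨fun i => i.2.elim, fun j => j.2.elim, standardCameras⟩
  obtain ⟨S, hS, hg, -⟩ := Q.exists_extension (K := ∅) (M := ∅) (S' := S')
    (by simp) (fun i => i.2.elim)
    ⟨linearIndependent_standardCameras_center, fun _ _ _ i => i.2.elim, fun _ _ _ j => j.2.elim⟩
    (fun _ => ⊥) (fun _ => ⊥) (fun _ _ => ⟨bot_ne_top, fun j => j.2.elim⟩) fun _ _ => bot_ne_top
  exact ⟨S, hS, hg⟩

end PL1P

/-! ### Lifting lines and points from their images -/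

namespace CameraConfig

variable (C : CameraConfig) {v w : Fin 3}

/-- The planes through two observed image lines meet in a line unless the image lines pass through
the images of the camera centers. -/
theorem finrank_comap_inf_comap {m m' : Gr 2 3} (h : C.proj v (C.center w) ∉ m.1) :
    Module.finrank ℂ (m.1.comap (C.proj v) ⊓ m'.1.comap (C.proj w) : Submodule ℂ (Fin 4 → ℂ)) =
      2 := by
  have h1 := Submodule.finrank_sup_add_finrank_inf_eq (m.1.comap (C.proj v))
    (m'.1.comap (C.proj w))
  rw [C.finrank_comap_proj, C.finrank_comap_proj, m.2, m'.2] at h1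
  have h2 : m.1.comap (C.proj v) < m.1.comap (C.proj v) ⊔ m'.1.comap (C.proj w) := by
    refine lt_of_le_of_ne le_sup_left fun heq => h ?_
    have h3 : C.center w ∈ m.1.comap (C.proj v) ⊔ m'.1.comap (C.proj w) :=
      Submodule.mem_sup_right (by
        rw [Submodule.mem_comap, proj_center]
        exact Submodule.zero_mem _)
    rwa [← heq] at h3
  have h3 := Submodule.finrank_lt_finrank_of_lt h2
  rw [C.finrank_comap_proj, m.2] at h3
  have h4 := Submodule.finrank_le (m.1.comap (C.proj v) ⊔ m'.1.comap (C.proj w))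
  rw [Module.finrank_fin_fun] at h4
  omega

theorem exists_line_lift {m m' : Gr 2 3} (h : C.proj v (C.center w) ∉ m.1)
    (h' : C.proj w (C.center v) ∉ m'.1) :
    ∃ l : Gr 2 4, l.1 = m.1.comap (C.proj v) ⊓ m'.1.comap (C.proj w) ∧
      l.1.map (C.proj v) = m.1 ∧ l.1.map (C.proj w) = m'.1 := by
  refine ⟨⟨_, C.finrank_comap_inf_comap h⟩, rfl, ?_, ?_⟩
  · apply Submodule.eq_of_le_of_finrank_eq
    · exact Submodule.map_le_iff_le_comap.2 inf_le_left
    · rw [C.finrank_map_proj, C.finrank_comap_inf_comap h, m.2]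
      exact fun hc => h' hc.2
  · apply Submodule.eq_of_le_of_finrank_eq
    · exact Submodule.map_le_iff_le_comap.2 inf_le_right
    · rw [C.finrank_map_proj, C.finrank_comap_inf_comap h, m'.2]
      exact fun hc => h hc.1

theorem line_lift_unique {m m' : Gr 2 3} (h : C.proj v (C.center w) ∉ m.1) {l l' : Gr 2 4}
    (h1 : l.1.map (C.proj v) = m.1) (h2 : l.1.map (C.proj w) = m'.1)
    (h1' : l'.1.map (C.proj v) = m.1) (h2' : l'.1.map (C.proj w) = m'.1) : l = l' := by
  have key : ∀ l : Gr 2 4, l.1.map (C.proj v) = m.1 → l.1.map (C.proj w) = m'.1 →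
      l.1 = m.1.comap (C.proj v) ⊓ m'.1.comap (C.proj w) := by
    intro l h1 h2
    apply Submodule.eq_of_le_of_finrank_eq
    · exact le_inf (Submodule.map_le_iff_le_comap.1 h1.le) (Submodule.map_le_iff_le_comap.1 h2.le)
    · rw [l.2, C.finrank_comap_inf_comap h]
  exact Subtype.ext ((key l h1 h2).trans (key l' h1' h2').symm)

theorem exists_point_lift {l : Gr 2 4} {q : Gr 1 3} (h : q.1 ≤ l.1.map (C.proj v)) :
    ∃ p : Gr 1 4, p.1 ≤ l.1 ∧ p.1.map (C.proj v) = q.1 := by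
  obtain ⟨u, hu0, hu⟩ := q.exists_eq_span_singleton
  obtain ⟨x, hx, rfl⟩ := h (by rw [hu]; exact Submodule.mem_span_singleton_self u)
  refine ⟨Gr.point x fun hx0 => hu0 (by rw [hx0, map_zero]),
    (Submodule.span_singleton_le_iff_mem _ _).2 hx, ?_⟩
  rw [hu, Gr.point, Submodule.map_span, Set.image_singleton]

theorem point_lift_unique {l : Gr 2 4} (hl : C.center v ∉ l.1) {p p' : Gr 1 4} (hp : p.1 ≤ l.1)
    (hp' : p'.1 ≤ l.1) (h : p.1.map (C.proj v) = p'.1.map (C.proj v)) : p = p' := by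
  obtain ⟨x, hx0, hx⟩ := p.exists_eq_span_singleton
  have hxp : x ∈ p.1 := by rw [hx]; exact Submodule.mem_span_singleton_self x
  obtain ⟨x', hx', hxx'⟩ : C.proj v x ∈ p'.1.map (C.proj v) := by
    rw [← h]
    exact Submodule.mem_map_of_mem hxp
  have : x' - x = 0 := C.eq_zero_of_proj_eq_zero hl (Submodule.sub_mem _ (hp' hx') (hp hxp))
    (by rw [map_sub, hxx', sub_self])
  rw [sub_eq_zero] at this
  subst this
  apply Subtype.ext
  apply Submodule.eq_of_le_of_finrank_eq
  · rw [hx]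
    exact (Submodule.span_singleton_le_iff_mem _ _).2 hx'
  · rw [p.2, p'.2]

end CameraConfig

namespace PL1P

variable {P L : Type*} (Q : PL1P P L) {K : Set P} {M : Set L}

/-- The points outside `K` and the lines outside `M` are of the four kinds that can be forgotten.
In the last kind it is not required that the pin is forgotten together with its point. -/
structure IsRemovable (K : Set P) (M : Set L) : Prop where
  pt : ∀ i ∉ K, Q.IsOneViewPointOnFullPin i ∨ ∃ j, Q.IsOneViewPointWithTwoViewPin i j
  ln : ∀ j ∉ M, Q.IsTwoViewPin j ∨ Q.IsTwoViewFreeLine j ∨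
    ∃ i ∉ K, Q.IsOneViewPointWithTwoViewPin i j

namespace IsRemovable

variable {Q} (h : Q.IsRemovable K M)
include h

theorem seenInExactlyTwoViews {j : L} (hj : j ∉ M) : Q.SeenInExactlyTwoViews j := by
  rcases h.ln j hj with h | h | ⟨i, -, h⟩
  exacts [h.1, h.1, h.2.2.2]

theorem seesPt_of_seesLn {i : P} {j : L} (hi : i ∈ K) (hj : j ∉ M) (hij : Q.inc i j) {v : Fin 3}
    (hv : j ∈ Q.seesLn v) : i ∈ Q.seesPt v := by
  rcases h.ln j hj with ⟨-, i', hi', h⟩ | h | ⟨i', hi', h⟩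
  · rw [Q.at_most_one _ _ _ hij hi']
    exact h v hv
  · exact (h.2 i hij).elim
  · rw [Q.at_most_one _ _ _ ((h.1 j).2 rfl) hij] at hi'
    exact (hi' hi).elim

theorem exists_isSinglePin {i : P} (hi : i ∉ K) : ∃ j, Q.IsSinglePin i j ∧
    ∃ v, i ∈ Q.seesPt v ∧ j ∈ Q.seesLn v ∧ ∀ v', i ∈ Q.seesPt v' → v' = v := by
  rcases h.pt i hi with ⟨j, hj, ⟨v, hv, hv'⟩, h⟩ | ⟨j, hj, ⟨v, hv, hv'⟩, h, -⟩
  · exact ⟨j, hj, v, hv, h v, hv'⟩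
  · exact ⟨j, hj, v, hv, h v hv, hv'⟩

theorem exists_views {j : L} (hj : j ∉ M) : ∃ v w, v ≠ w ∧ j ∈ Q.seesLn v ∧ j ∈ Q.seesLn w ∧
    ∀ u, j ∈ Q.seesLn u → u = v ∨ u = w := by
  obtain ⟨v, w, hvw, hset⟩ := Set.ncard_eq_two.1 (h.seenInExactlyTwoViews hj)
  have hmem : ∀ u, j ∈ Q.seesLn u ↔ u = v ∨ u = w := fun u => by
    have : u ∈ {u | j ∈ Q.seesLn u} ↔ u ∈ ({v, w} : Set (Fin 3)) := by rw [hset]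
    simpa using this
  exact ⟨v, w, hvw, (hmem v).2 (Or.inl rfl), (hmem w).2 (Or.inr rfl), fun u => (hmem u).1⟩

end IsRemovable

/-- No forgotten line passes, in a view that observes it, through the image of the center of another
camera that observes it. -/
def AvoidsEpipoles (C : CameraConfig) (M : Set L) (y : ImageConfig Q.toPointLineProblem) : Prop :=
  ∀ j ∉ M, ∀ v w, v ≠ w → ∀ hv : j ∈ Q.seesLn v, j ∈ Q.seesLn w →
    C.proj v (C.center w) ∉ (y.ln v ⟨j, hv⟩).1

variable {Q}

/-- Removable points and lines can be reconstructed from their images: a line is the intersection of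
the two planes through its images, and a forgotten point is then the point on its only pin with the
given image. -/
theorem IsRemovable.exists_lift (h : Q.IsRemovable K M) {S' : SpaceConfig K M}
    (hS' : S' ∈ (Q.forget K M).spaceVariety) {y : ImageConfig Q.toPointLineProblem}
    (hy : y ∈ Q.imageVariety) (hSy : (Q.forget K M).JointCameraMap S' (Q.imageForget K M y))
    (hgen : Q.AvoidsEpipoles S'.cam M y) :
    ∃ S ∈ Q.spaceVariety, Q.JointCameraMap S y ∧ spaceForget K M S = S' := by
  have hlns : ∀ j, ∃ l : Gr 2 4, (∀ h : j ∈ M, l = S'.ln ⟨j, h⟩) ∧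
      (∀ v (hv : j ∈ Q.seesLn v), l.1.map (S'.cam.proj v) = (y.ln v ⟨j, hv⟩).1) ∧
      ∀ i : K, Q.inc i j → (S'.pt i).1 ≤ l.1 := by
    intro j
    by_cases hj : j ∈ M
    · exact ⟨S'.ln ⟨j, hj⟩, fun _ => rfl, fun v hv => hSy.2 v ⟨⟨j, hj⟩, hv⟩,
        fun i hij => hS' i ⟨j, hj⟩ hij⟩
    · obtain ⟨v, w, hvw, hv, hw, hu⟩ := h.exists_views hj
      obtain ⟨l, hl, hlv, hlw⟩ := S'.cam.exists_line_lift (hgen j hj v w hvw hv hw)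
        (hgen j hj w v hvw.symm hw hv)
      refine ⟨l, fun h => (hj h).elim, fun u huj => ?_, fun i hij => ?_⟩
      · rcases hu u huj with rfl | rfl <;> assumption
      · rw [hl]
        have key : ∀ u (hu : j ∈ Q.seesLn u),
            (S'.pt i).1 ≤ (y.ln u ⟨j, hu⟩).1.comap (S'.cam.proj u) := fun u hu => by
          have hiu := h.seesPt_of_seesLn i.2 hj hij hu
          rw [← Submodule.map_le_iff_le_comap, hSy.1 u ⟨i, hiu⟩]
          exact hy u ⟨i, hiu⟩ ⟨j, hu⟩ hij
        exact le_inf (key v hv) (key w hw)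
  choose l hlM hly hlp using hlns
  have hpts : ∀ i, ∃ p : Gr 1 4, (∀ h : i ∈ K, p = S'.pt ⟨i, h⟩) ∧
      (∀ v (hv : i ∈ Q.seesPt v), p.1.map (S'.cam.proj v) = (y.pt v ⟨i, hv⟩).1) ∧
      ∀ j, Q.inc i j → p.1 ≤ (l j).1 := by
    intro i
    by_cases hi : i ∈ K
    · exact ⟨S'.pt ⟨i, hi⟩, fun _ => rfl, fun v hv => hSy.1 v ⟨⟨i, hi⟩, hv⟩, fun j => hlp j ⟨i, hi⟩⟩
    · obtain ⟨j, hj, v, hiv, hjv, hv⟩ := h.exists_isSinglePin hi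
      obtain ⟨p, hpl, hp⟩ := S'.cam.exists_point_lift (v := v) (l := l j) (q := y.pt v ⟨i, hiv⟩) (by
        rw [hly j v hjv]
        exact hy v ⟨i, hiv⟩ ⟨j, hjv⟩ ((hj j).2 rfl))
      refine ⟨p, fun h => (hi h).elim, fun v' hv' => ?_, fun j' hj' => ?_⟩
      · obtain rfl := hv v' hv'
        exact hp
      · rwa [(hj j').1 hj']
  choose p hpK hpy hpl using hpts
  refine ⟨⟨p, l, S'.cam⟩, fun i j => hpl i j, ⟨fun v i => hpy i v i.2, fun v j => hly j v j.2⟩, ?_⟩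
  ext1
  · exact funext fun i => hpK i i.2
  · exact funext fun j => hlM j j.2
  · rfl

/-- The reconstruction of removable points and lines from their images is unique. -/
theorem IsRemovable.lift_unique (h : Q.IsRemovable K M)
    {y : ImageConfig Q.toPointLineProblem} {S₁ S₂ : SpaceConfig P L}
    (h₁ : S₁ ∈ Q.solutions y) (h₂ : S₂ ∈ Q.solutions y)
    (h₁₂ : spaceForget K M S₁ = spaceForget K M S₂) (hgen : Q.AvoidsEpipoles S₁.cam M y) :
    S₁ = S₂ := by
  have hcam : S₁.cam = S₂.cam := congrArg (fun S => S.cam) h₁₂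
  have hln : ∀ j, S₁.ln j = S₂.ln j := by
    intro j
    by_cases hj : j ∈ M
    · exact congrArg (fun S => S.ln ⟨j, hj⟩) h₁₂
    · obtain ⟨v, w, hvw, hv, hw, -⟩ := h.exists_views hj
      refine S₁.cam.line_lift_unique (hgen j hj v w hvw hv hw) (h₁.2.2 v ⟨j, hv⟩)
        (h₁.2.2 w ⟨j, hw⟩) ?_ ?_ <;> rw [hcam]
      exacts [h₂.2.2 v ⟨j, hv⟩, h₂.2.2 w ⟨j, hw⟩]
  ext1
  · funext i
    by_cases hi : i ∈ K
    · exact congrArg (fun S => S.pt ⟨i, hi⟩) h₁₂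
    · obtain ⟨j, hj, v, hiv, hjv, -⟩ := h.exists_isSinglePin hi
      have hij : Q.inc i j := (hj j).2 rfl
      refine S₁.cam.point_lift_unique (v := v) (l := S₁.ln j) ?_ (h₁.1 i j hij) ?_ ?_
      · apply S₁.cam.center_notMem_of_finrank_map
        rw [h₁.2.2 v ⟨j, hjv⟩, (S₁.ln j).2, (y.ln v ⟨j, hjv⟩).2]
      · rw [hln j]
        exact h₂.1 i j hij
      · rw [h₁.2.1 v ⟨i, hiv⟩, hcam, h₂.2.1 v ⟨i, hiv⟩]
  · exact funext hln
  · exact hcam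

end PL1P

/-! ### Moving images off the epipoles -/

theorem ImageConfig.isOpen_setOf_linearIndependent {P L : Type*} {Q : PointLineProblem P L} {k : ℕ}
    {b : (ImageVar Q → ℂ) → Fin k → Fin 3 → ℂ} (hb : ∀ s a, IsPolyFun fun x => b x s a) :
    IsOpen {y : ImageConfig Q | ∃ c, y.IsCoord c ∧ LinearIndependent ℂ (b c)} := by
  rw [isOpen_iff_forall_mem_open]
  rintro S ⟨c, hc, hli⟩
  obtain ⟨u, ⟨f, hf⟩, hu, h⟩ := exists_isPolyFun_of_linearIndependent hb hli
  refine ⟨zariskiBasicOpen IsCoord f, ?_, TopologicalSpace.isOpen_generateFrom_of_mem ⟨f, rfl⟩,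
    c, hc, by rwa [hf]⟩
  rintro S' ⟨c', hc', hfc⟩
  exact ⟨c', hc', h c' (by rwa [← hf])⟩

theorem ImageConfig.isOpen_setOf_notMem_ln {P L : Type*} {Q : PointLineProblem P L} (v : Fin 3)
    (j : Q.seesLn v) {e : Fin 3 → ℂ} (he : e ≠ 0) :
    IsOpen {y : ImageConfig Q | e ∉ (y.ln v j).1} := by
  convert ImageConfig.isOpen_setOf_linearIndependent (Q := Q)
    (b := fun c => Fin.append (fun _ : Fin 1 => e) fun s a => c (.ln v j s a)) ?_ using 1
  · ext y
    have key : ∀ c, y.IsCoord c →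
        (LinearIndependent ℂ (Fin.append (fun _ : Fin 1 => e) fun s a => c (.ln v j s a)) ↔
          e ∉ (y.ln v j).1) := by
      intro c hc
      have h2 : Submodule.span ℂ (Set.range fun _ : Fin 1 => e) = Submodule.span ℂ {e} := by simp
      rw [linearIndependent_append, hc.2 v j, h2, disjoint_comm,
        Submodule.disjoint_span_singleton' he]
      exact ⟨fun h => h.2.2, fun h => ⟨LinearIndependent.of_subsingleton 0 he,
        (hc.2 v j).linearIndependent, h⟩⟩
    constructor
    · intro hy
      obtain ⟨c, hc⟩ := y.exists_isCoord
      exact ⟨c, hc, (key c hc).2 hy⟩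
    · rintro ⟨c, hc, hli⟩
      exact (key c hc).1 hli
  · intro s a
    refine Fin.addCases (fun s => ?_) (fun s => ?_) s
    · simp only [Fin.append_left]
      fun_prop
    · simp only [Fin.append_right]
      fun_prop

/-- A one-parameter family of transvections that moves a line of the plane off the point `e` while
fixing the point `q` of the line. -/
theorem exists_transvection (m : Gr 2 3) {e q : Fin 3 → ℂ} (hq : q ∈ m.1)
    (heq : e ∉ Submodule.span ℂ {q}) :
    ∃ N : (Fin 3 → ℂ) →ₗ[ℂ] (Fin 3 → ℂ), N ∘ₗ N = 0 ∧ N q = 0 ∧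
      ∀ t : ℂ, t ≠ 0 → ∀ x ∈ m.1, x + t • N x ≠ e := by
  by_cases he : e ∈ m.1
  · obtain ⟨u, hu⟩ : ∃ u, u ∉ m.1 := by
      by_contra! h
      have h2 := m.2
      rw [(Submodule.eq_top_iff'.2 h), finrank_top, Module.finrank_fin_fun] at h2
      omega
    have hne : e ∉ Submodule.span ℂ {q, u} := by
      intro h
      obtain ⟨a, b, hab⟩ := Submodule.mem_span_pair.1 h
      have hb : b = 0 := by
        by_contra hb
        apply hu
        rw [← Submodule.smul_mem_iff _ hb, ← add_sub_cancel_left (a • q) (b • u), hab]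
        exact Submodule.sub_mem _ he (Submodule.smul_mem _ _ hq)
      apply heq
      rw [← hab, hb, zero_smul, add_zero]
      exact Submodule.smul_mem _ _ (Submodule.mem_span_singleton_self q)
    obtain ⟨φ, hφe, hφ⟩ := Submodule.exists_le_ker_of_notMem hne
    have hφq : φ q = 0 := hφ (Submodule.subset_span (by simp))
    have hφu : φ u = 0 := hφ (Submodule.subset_span (by simp))
    refine ⟨φ.smulRight u, ?_, by simp [hφq], fun t ht x hx hxe => ?_⟩
    · ext x
      simp [hφu]
    · simp only [LinearMap.smulRight_apply, smul_smul] at hxe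
      have h1 : (t * φ x) • u ∈ m.1 := by
        rw [← add_sub_cancel_left x ((t * φ x) • u), hxe]
        exact Submodule.sub_mem _ he hx
      have h2 : t * φ x = 0 := by
        by_contra h2
        exact hu ((Submodule.smul_mem_iff _ h2).1 h1)
      rw [h2, zero_smul, add_zero] at hxe
      rw [hxe] at h2
      exact (mul_ne_zero ht hφe) h2
  · refine ⟨0, by simp, by simp, fun t _ x hx hxe => he ?_⟩
    rw [← hxe]
    simpa using hx

/-- The transvection `1 + t N`, for `N` of square zero. -/
def transvection {n : ℕ} (N : (Fin n → ℂ) →ₗ[ℂ] (Fin n → ℂ)) (hN : N ∘ₗ N = 0) (t : ℂ) :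
    (Fin n → ℂ) ≃ₗ[ℂ] (Fin n → ℂ) :=
  have hNN : ∀ x, N (N x) = 0 := fun x => congrArg (fun f => f x) hN
  LinearEquiv.ofLinearMap (LinearMap.id + t • N) (LinearMap.id - t • N)
    (by ext; simp [hNN]) (by ext; simp [hNN])

theorem transvection_apply {n : ℕ} (N : (Fin n → ℂ) →ₗ[ℂ] (Fin n → ℂ)) (hN : N ∘ₗ N = 0) (t : ℂ)
    (x : Fin n → ℂ) : transvection N hN t x = x + t • N x := rfl

/-- The image of a subspace under a linear equivalence. -/
def Gr.map {k n : ℕ} (W : Gr k n) (g : (Fin n → ℂ) ≃ₗ[ℂ] (Fin n → ℂ)) : Gr k n :=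
  ⟨W.1.map (g : (Fin n → ℂ) →ₗ[ℂ] (Fin n → ℂ)), by rw [LinearEquiv.finrank_map_eq, W.2]⟩

theorem Gr.IsFrame.map {k n : ℕ} {W : Gr k n} {b : Fin k → Fin n → ℂ} (h : W.IsFrame b)
    (g : (Fin n → ℂ) ≃ₗ[ℂ] (Fin n → ℂ)) : (W.map g).IsFrame fun s => g (b s) := by
  change _ = Submodule.map _ W.1
  rw [← h, Submodule.map_span, ← Set.range_comp]
  rfl

theorem Gr.map_transvection_eq {k n : ℕ} (W : Gr k n) {N : (Fin n → ℂ) →ₗ[ℂ] (Fin n → ℂ)}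
    (hN : N ∘ₗ N = 0) (t : ℂ) (h : ∀ x ∈ W.1, N x = 0) : W.map (transvection N hN t) = W := by
  obtain ⟨b, hb⟩ := W.exists_isFrame
  have h1 := hb.map (transvection N hN t)
  have h2 : (fun s => transvection N hN t (b s)) = b := by
    funext s
    rw [transvection_apply, h _ (hb.mem s), smul_zero, add_zero]
  rw [h2] at h1
  exact h1.eq hb

theorem SpaceConfig.IsGeneral.proj_center_ne_zero {P L : Type*} {S : SpaceConfig P L}
    (hg : S.IsGeneral) {v w : Fin 3} (hvw : v ≠ w) : S.cam.proj v (S.cam.center w) ≠ 0 := by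
  intro h
  obtain ⟨a, ha⟩ := (S.cam.proj_eq_zero_iff v _).1 h
  exact (LinearIndependent.pair_iff' (S.cam.center_ne_zero v)).1 (hg.centers v w hvw) a ha

theorem SpaceConfig.IsGeneral.proj_center_notMem {P L : Type*} {S : SpaceConfig P L}
    (hg : S.IsGeneral) {v w : Fin 3} (hvw : v ≠ w) (i : P) :
    S.cam.proj v (S.cam.center w) ∉ (S.pt i).1.map (S.cam.proj v) := by
  rintro ⟨x, hx, h⟩
  obtain ⟨a, ha⟩ := (S.cam.proj_eq_zero_iff v (x - S.cam.center w)).1 (by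
    rw [map_sub, h, sub_self])
  have hx0 : x = 0 := Submodule.disjoint_def.1 (hg.pt v w hvw i) x (by
    rw [← sub_add_cancel x (S.cam.center w), ← ha]
    exact Submodule.add_mem _ (Submodule.smul_mem _ _ (S.cam.center_mem_baseline_left v w))
      (S.cam.center_mem_baseline_right v w)) hx
  rw [hx0, map_zero] at h
  exact hg.proj_center_ne_zero hvw h.symm

namespace PL1P

variable {P L : Type*} {Q : PL1P P L} {K : Set P} {M : Set L}

theorem isOpen_setOf_avoidsEpipoles [Finite L] {C : CameraConfig} (M : Set L)
    (hC : ∀ v w, v ≠ w → C.proj v (C.center w) ≠ 0) :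
    IsOpen {y | Q.AvoidsEpipoles C M y} := by
  simp only [AvoidsEpipoles, Set.ofPred_forall]
  exact isOpen_iInter_of_finite fun j => isOpen_iInter_of_finite fun _ =>
    isOpen_iInter_of_finite fun v => isOpen_iInter_of_finite fun w =>
    isOpen_iInter_of_finite fun hvw => isOpen_iInter_of_finite fun hv =>
    isOpen_iInter_of_finite fun _ => ImageConfig.isOpen_setOf_notMem_ln v ⟨j, hv⟩ (hC v w hvw)

/-- For a general configuration of the kept features, generic images in the fiber over its joint
image avoid the epipoles: any image in the fiber can be moved off the epipoles by transvections of
the forgotten lines. -/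
theorem IsRemovable.forGeneric_avoidsEpipoles [Finite P] [Finite L] (h : Q.IsRemovable K M)
    {S' : SpaceConfig K M} (hg : S'.IsGeneral) :
    ForGeneric {y | y ∈ Q.imageVariety ∧
      (Q.forget K M).JointCameraMap S' (Q.imageForget K M y)} (Q.AvoidsEpipoles S'.cam M) := by
  refine ⟨{y | Q.AvoidsEpipoles S'.cam M y},
    isOpen_setOf_avoidsEpipoles M fun v w hvw => hg.proj_center_ne_zero hvw, ?_, fun y hy => hy.2⟩
  rintro y ⟨hy, hSy⟩
  -- transvections of the lines that fix the kept lines and the kept points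
  have hN : ∀ v (j : Q.seesLn v), ∃ N : (Fin 3 → ℂ) →ₗ[ℂ] (Fin 3 → ℂ), N ∘ₗ N = 0 ∧
      ((j : L) ∈ M → N = 0) ∧
      (∀ i : Q.seesPt v, (i : P) ∈ K → Q.inc i j → ∀ x ∈ (y.pt v i).1, N x = 0) ∧
      ((j : L) ∉ M → ∀ w, v ≠ w → (j : L) ∈ Q.seesLn w → ∀ t : ℂ, t ≠ 0 → ∀ x ∈ (y.ln v j).1,
        x + t • N x ≠ S'.cam.proj v (S'.cam.center w)) := by
    intro v j
    by_cases hj : (j : L) ∈ M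
    · exact ⟨0, by simp, fun _ => rfl, by simp, fun h => (h hj).elim⟩
    · obtain ⟨w, hvw, hw⟩ : ∃ w, v ≠ w ∧ ∀ u, v ≠ u → (j : L) ∈ Q.seesLn u → u = w := by
        obtain ⟨v', w', hne, -, -, hall⟩ := h.exists_views hj
        rcases hall v j.2 with rfl | rfl
        · exact ⟨w', hne, fun u hu hju => (hall u hju).resolve_left hu.symm⟩
        · exact ⟨v', hne.symm, fun u hu hju => (hall u hju).resolve_right hu.symm⟩
      obtain ⟨q, hq, hqe, hqi⟩ : ∃ q ∈ (y.ln v j).1,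
          S'.cam.proj v (S'.cam.center w) ∉ Submodule.span ℂ {q} ∧
          ∀ i : Q.seesPt v, (i : P) ∈ K → Q.inc i j → (y.pt v i).1 = Submodule.span ℂ {q} := by
        by_cases hi : ∃ i : Q.seesPt v, (i : P) ∈ K ∧ Q.inc i j
        · obtain ⟨i, hi, hij⟩ := hi
          obtain ⟨q, hq0, hq⟩ := (y.pt v i).exists_eq_span_singleton
          refine ⟨q, hy v i j hij (by rw [hq]; exact Submodule.mem_span_singleton_self q), ?_, ?_⟩
          · have h1 := hSy.1 v ⟨⟨i, hi⟩, i.2⟩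
            have h2 := hg.proj_center_notMem hvw ⟨i, hi⟩
            rw [h1] at h2
            rw [← hq]
            exact h2
          · intro i' _ hi'
            rw [← hq, Subtype.ext (Q.at_most_one _ _ _ hi' hij)]
        · exact ⟨0, Submodule.zero_mem _, by simpa using hg.proj_center_ne_zero hvw,
            fun i hi' hij => (hi ⟨i, hi', hij⟩).elim⟩
      obtain ⟨N, hNN, hNq, hN⟩ := exists_transvection (y.ln v j) hq hqe
      refine ⟨N, hNN, fun h => (hj h).elim, fun i hi hij x hx => ?_, fun _ u hu hju t ht x hx => ?_⟩
      · rw [hqi i hi hij, Submodule.mem_span_singleton] at hx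
        obtain ⟨a, rfl⟩ := hx
        rw [map_smul, hNq, smul_zero]
      · rw [hw u hu hju]
        exact hN t ht x hx
  choose N hNN hNM hNK hNe using hN
  -- a forgotten point moves along with its pin
  have hNp : ∀ v (i : Q.seesPt v), ∃ N' : (Fin 3 → ℂ) →ₗ[ℂ] (Fin 3 → ℂ), N' ∘ₗ N' = 0 ∧
      ((i : P) ∈ K → N' = 0) ∧
      ∀ j : Q.seesLn v, Q.inc i j → ∀ x ∈ (y.pt v i).1, N' x = N v j x := by
    intro v i
    by_cases hi : (i : P) ∈ K
    · exact ⟨0, by simp, fun _ => rfl, fun j hij x hx => (hNK v j i hi hij x hx).symm⟩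
    · obtain ⟨j, hj, -⟩ := h.exists_isSinglePin hi
      by_cases hjv : j ∈ Q.seesLn v
      · refine ⟨N v ⟨j, hjv⟩, hNN v _, fun h => (hi h).elim, fun j' hj' x _ => ?_⟩
        obtain rfl : j' = ⟨j, hjv⟩ := Subtype.ext ((hj j').1 hj')
        rfl
      · refine ⟨0, by simp, fun _ => rfl, fun j' hj' x _ => (hjv ?_).elim⟩
        rw [← (hj j').1 hj']
        exact j'.2
  choose N' hNN' hNK' hNN'' using hNp
  let yt : ℂ → ImageConfig Q.toPointLineProblem := fun t =>
    ⟨fun v i => (y.pt v i).map (transvection (N' v i) (hNN' v i) t),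
      fun v j => (y.ln v j).map (transvection (N v j) (hNN v j) t)⟩
  have hyt : ∀ t, yt t ∈ Q.imageVariety := by
    rintro t v i j hij _ ⟨x, hx, rfl⟩
    refine ⟨x, hy v i j hij hx, ?_⟩
    change transvection _ _ _ _ = transvection _ _ _ _
    rw [transvection_apply, transvection_apply, hNN'' v i j hij x hx]
  have hytS : ∀ t, (Q.forget K M).JointCameraMap S' (Q.imageForget K M (yt t)) := by
    intro t
    constructor
    · intro v i
      refine (hSy.1 v i).trans (congrArg Subtype.val (Gr.map_transvection_eq _ _ t ?_)).symm
      intro x _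
      rw [hNK' v ⟨i.1.1, i.2⟩ i.1.2]
      rfl
    · intro v j
      refine (hSy.2 v j).trans (congrArg Subtype.val (Gr.map_transvection_eq _ _ t ?_)).symm
      intro x _
      rw [hNM v ⟨j.1.1, j.2⟩ j.1.2]
      rfl
  have hgen : ∀ t, t ≠ 0 → Q.AvoidsEpipoles S'.cam M (yt t) := by
    rintro t ht j hj v w hvw hv hw ⟨x, hx, hxe⟩
    exact hNe v ⟨j, hv⟩ hj w hvw hw t ht x hx hxe
  -- the images `yt t` form a polynomial family, so that they are near `y` for almost all `t`
  obtain ⟨c, hc⟩ := y.exists_isCoord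
  let κ : (Unit → ℂ) → ImageVar Q.toPointLineProblem → ℂ := fun t k => match k with
    | .pt v i s a => (c (.pt v i s a)) + t () * N' v i (fun a => c (.pt v i s a)) a
    | .ln v j s a => (c (.ln v j s a)) + t () * N v j (fun a => c (.ln v j s a)) a
  have hκ : ∀ k, IsPolyFun fun t => κ t k := by
    rintro (⟨v, i, s, a⟩ | ⟨v, j, s, a⟩) <;> simp only [κ] <;> fun_prop
  have hκt : ∀ t, (yt (t ())).IsCoord (κ t) := fun t =>
    ⟨fun v i => (hc.1 v i).map _, fun v j => (hc.2 v j).map _⟩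
  have hy0 : yt 0 = y := by
    ext1
    · funext v i
      apply Subtype.ext
      change Submodule.map _ _ = _
      convert Submodule.map_id _
      ext1 x
      simp [transvection]
    · funext v i
      apply Subtype.ext
      change Submodule.map _ _ = _
      convert Submodule.map_id _
      ext1 x
      simp [transvection]
  rw [mem_closure_iff]
  intro O hO hyO
  obtain ⟨u, hu, hu0, hut⟩ := (isPolyChart_image hκ).exists_isPolyFun_of_isOpen
    (fun _ _ _ h h' => h.eq h') hO (s₁ := fun _ => 0) (x := y) (by
      have := hκt fun _ => 0
      rwa [hy0] at this) hyO
  obtain ⟨t, ht, ht0⟩ := hu.exists_ne_zero_and_ne_zero (IsPolyFun.coord ()) ⟨_, hu0⟩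
    ⟨fun _ => 1, one_ne_zero⟩
  obtain ⟨x, hxO, hx⟩ := hut t ht
  obtain rfl := hx.eq (hκt t)
  exact ⟨_, hxO, ⟨hyt _, hytS _⟩, hgen _ ht0⟩

/-- The points and lines of the four kinds can be forgotten. -/
theorem IsRemovable.isReducibleTo [Finite P] [Finite L] (h : Q.IsRemovable K M) :
    Q.IsReducibleTo K M := by
  refine ⟨fun i hi j _ j' _ hij hij' => ?_, {S | S.IsGeneral}, SpaceConfig.isOpen_setOf_isGeneral,
    ?_, ?_⟩
  · obtain ⟨j₀, hj₀, -⟩ := h.exists_isSinglePin hi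
    rw [(hj₀ j).1 hij, (hj₀ j').1 hij']
  · exact (Q.forget K M).spaceVariety_subset_closure SpaceConfig.isOpen_setOf_isGeneral
      (Q.forget K M).exists_isGeneral
  · rintro S' ⟨hS', hg⟩
    obtain ⟨U, hU, hUd, hUy⟩ := h.forGeneric_avoidsEpipoles hg
    exact ⟨U, hU, hUd, fun y hy => h.exists_lift hS' hy.1.1 hy.1.2 (hUy y hy)⟩

end PL1P

/-! ### Images without lifts -/

namespace PointLineProblem

variable {P L : Type*} (Q : PointLineProblem P L)

/-- An observed point or line together with a view that observes it. -/
abbrev Observation := (v : Fin 3) × (Q.seesPt v ⊕ Q.seesLn v)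

variable {Q}

/-- The dimension of the linear subspace that represents an observed point or line. -/
def Observation.dim : Q.Observation → ℕ
  | ⟨_, .inl _⟩ => 1
  | ⟨_, .inr _⟩ => 2

/-- The observed point or line in the image. -/
def Observation.image (y : ImageConfig Q) : Q.Observation → Submodule ℂ (Fin 3 → ℂ)
  | ⟨v, .inl i⟩ => (y.pt v i).1
  | ⟨v, .inr j⟩ => (y.ln v j).1

/-- The observed point or line in space. -/
def Observation.space (S : SpaceConfig P L) : Q.Observation → Submodule ℂ (Fin 4 → ℂ)
  | ⟨_, .inl i⟩ => (S.pt i).1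
  | ⟨_, .inr j⟩ => (S.ln j).1

/-- The basis of the observed point or line in the image that is given by a coordinate vector. -/
def Observation.frame (c : ImageVar Q → ℂ) : (o : Q.Observation) → Fin o.dim → Fin 3 → ℂ
  | ⟨v, .inl i⟩ => fun s a => c (.pt v i s a)
  | ⟨v, .inr j⟩ => fun s a => c (.ln v j s a)

theorem Observation.isPolyFun_frame (o : Q.Observation) (s : Fin o.dim) (a : Fin 3) :
    IsPolyFun fun c => o.frame c s a := by
  obtain ⟨v, i | j⟩ := o <;> exact .coord _

theorem Observation.span_frame (o : Q.Observation) {y : ImageConfig Q} {c : ImageVar Q → ℂ}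
    (hc : y.IsCoord c) : Submodule.span ℂ (Set.range (o.frame c)) = o.image y := by
  obtain ⟨v, i | j⟩ := o
  exacts [hc.1 v i, hc.2 v j]

theorem Observation.linearIndependent_frame (o : Q.Observation) {y : ImageConfig Q}
    {c : ImageVar Q → ℂ} (hc : y.IsCoord c) : LinearIndependent ℂ (o.frame c) := by
  obtain ⟨v, i | j⟩ := o
  exacts [(hc.1 v i).linearIndependent, (hc.2 v j).linearIndependent]

/-- It is an open condition on an image that the subspaces of space which are back-projected from
finitely many observations meet a given subspace only in `0`. -/
theorem isOpen_setOf_inf_comap_eq_bot (C : CameraConfig) (W : Submodule ℂ (Fin 4 → ℂ)) {n : ℕ}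
    (o : Fin n → Q.Observation) :
    IsOpen {y : ImageConfig Q | ∀ x ∈ W, (∀ k, C.proj (o k).1 x ∈ (o k).image y) → x = 0} := by
  rw [isOpen_iff_forall_mem_open]
  intro y hy
  obtain ⟨c, hc⟩ := y.exists_isCoord
  let w := Module.finBasis ℂ W
  -- the columns are the images of a basis of `W` and the bases of the observed subspaces
  let A : (ImageVar Q → ℂ) → Matrix (Fin n × Fin 3)
      (Fin (Module.finrank ℂ W) ⊕ (k : Fin n) × Fin (o k).dim) ℂ := fun c =>
    Matrix.of fun r => Sum.elim (fun s => C.proj (o r.1).1 (w s) r.2)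
      fun t => if r.1 = t.1 then (o t.1).frame c t.2 r.2 else 0
  have hA : ∀ c z, A c *ᵥ z = 0 ↔ ∀ k, C.proj (o k).1 (∑ s, z (.inl s) • (w s : Fin 4 → ℂ)) +
      ∑ s, z (.inr ⟨k, s⟩) • (o k).frame c s = 0 := by
    intro c z
    have : ∀ k a, (A c *ᵥ z) (k, a) = (C.proj (o k).1 (∑ s, z (.inl s) • (w s : Fin 4 → ℂ)) +
      ∑ s, z (.inr ⟨k, s⟩) • (o k).frame c s) a := by
      intro k a
      simp only [Matrix.mulVec, dotProduct, Fintype.sum_sum_type, A, Matrix.of_apply, Sum.elim_inl,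
        Sum.elim_inr, Fintype.sum_sigma, ite_mul, zero_mul, map_sum, map_smul, Pi.add_apply,
        Finset.sum_apply, Pi.smul_apply, smul_eq_mul]
      congr 1
      · exact Finset.sum_congr rfl fun s _ => mul_comm _ _
      · rw [Finset.sum_eq_single k]
        · simp only [if_true]
          exact Finset.sum_congr rfl fun s _ => mul_comm _ _
        · intro k' _ hk'
          simp [hk'.symm]
        · simp
    constructor
    · intro h k
      ext a
      rw [← this k a, h]
      rfl
    · intro h
      ext ⟨k, a⟩
      rw [this k a, h k]
      rfl
  have hinj : Function.Injective (A c).mulVec := by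
    rw [← Matrix.coe_mulVecLin, ← LinearMap.ker_eq_bot, LinearMap.ker_eq_bot']
    intro z hz
    rw [Matrix.mulVecLin_apply, hA] at hz
    have hx := hy (∑ s, z (.inl s) • (w s : Fin 4 → ℂ))
      (Submodule.sum_mem _ fun s _ => Submodule.smul_mem _ _ (w s).2) fun k => by
        rw [eq_neg_of_add_eq_zero_left (hz k), ← (o k).span_frame hc]
        exact Submodule.neg_mem _ (Submodule.sum_mem _ fun s _ =>
          Submodule.smul_mem _ _ (Submodule.subset_span ⟨s, rfl⟩))
    have hw : LinearIndependent ℂ fun s => (w s : Fin 4 → ℂ) :=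
      w.linearIndependent.map' W.subtype W.ker_subtype
    ext (s | ⟨k, s⟩)
    · exact Fintype.linearIndependent_iff.1 hw _ hx s
    · have := hz k
      rw [hx, map_zero, zero_add] at this
      exact Fintype.linearIndependent_iff.1 ((o k).linearIndependent_frame hc) _ this s
  obtain ⟨u, ⟨f, hf⟩, hu, h⟩ := exists_isPolyFun_of_mulVec_injective (M := A) (fun r t => by
    rcases t with s | t
    · exact .const _
    · simp only [A, Matrix.of_apply, Sum.elim_inr]
      split_ifs
      · exact Observation.isPolyFun_frame _ _ _
      · exact .const _) hinj
  refine ⟨zariskiBasicOpen ImageConfig.IsCoord f, ?_,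
    TopologicalSpace.isOpen_generateFrom_of_mem ⟨f, rfl⟩, c, hc, by rwa [hf]⟩
  rintro y' ⟨c', hc', hfc⟩ x hxW hx
  have hinj' := h c' (by rwa [← hf])
  have hβ : ∀ k, ∃ β : Fin (o k).dim → ℂ, ∑ s, β s • (o k).frame c' s = C.proj (o k).1 x := by
    intro k
    have := hx k
    rw [← (o k).span_frame hc'] at this
    exact (Submodule.mem_span_range_iff_exists_fun ℂ).1 this
  choose β hβ using hβ
  have hwx : ∑ s, w.repr ⟨x, hxW⟩ s • (w s : Fin 4 → ℂ) = x := by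
    simpa only [map_sum, map_smul, Submodule.subtype_apply] using
      congrArg W.subtype (w.sum_repr ⟨x, hxW⟩)
  have hz : A c' *ᵥ (Sum.elim (fun s => w.repr ⟨x, hxW⟩ s) fun t => -β t.1 t.2) = A c' *ᵥ 0 := by
    rw [Matrix.mulVec_zero, hA]
    intro k
    simp only [Sum.elim_inl, Sum.elim_inr, hwx, neg_smul, Finset.sum_neg_distrib, hβ k,
      add_neg_cancel]
  have hzero := hinj' hz
  rw [← hwx]
  refine Finset.sum_eq_zero fun s _ => ?_
  have := congrFun hzero (.inl s)
  simp only [Sum.elim_inl, Pi.zero_apply] at this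
  rw [this, zero_smul]

/-- The image whose part in view `v` is the image of `S v`. -/
def mixedImage (Q : PointLineProblem P L) (S : Fin 3 → SpaceConfig P L)
    (hp : ∀ v (i : Q.seesPt v), (S v).cam.center v ∉ ((S v).pt i).1)
    (hl : ∀ v (j : Q.seesLn v), (S v).cam.center v ∉ ((S v).ln j).1) : ImageConfig Q where
  pt v i := ⟨((S v).pt i).1.map ((S v).cam.proj v), by
    rw [CameraConfig.finrank_map_proj _ (hp v i), ((S v).pt i).2]⟩
  ln v j := ⟨((S v).ln j).1.map ((S v).cam.proj v), by
    rw [CameraConfig.finrank_map_proj _ (hl v j), ((S v).ln j).2]⟩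

end PointLineProblem

namespace PL1P

variable {P L : Type*} {Q : PL1P P L} {K : Set P} {M : Set L}

/-- Every image in the fiber over the joint image of `S'` is approximated by images of
configurations that extend `S'`. -/
def HasLiftsNear (Q : PL1P P L) (S' : SpaceConfig K M) : Prop :=
  ∀ y ∈ Q.imageVariety, (Q.forget K M).JointCameraMap S' (Q.imageForget K M y) →
    ∀ O : Set (ImageConfig Q.toPointLineProblem), IsOpen O → y ∈ O →
    ∃ y' ∈ O, ∃ S ∈ Q.spaceVariety, Q.JointCameraMap S y' ∧ spaceForget K M S = S'

theorem IsReducibleTo.exists_hasLiftsNear [Finite P] [Finite L] (h : Q.IsReducibleTo K M) :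
    ∃ S' ∈ (Q.forget K M).spaceVariety, S'.IsGeneral ∧ Q.HasLiftsNear S' := by
  obtain ⟨-, U, hU, hUd, hlift⟩ := h
  obtain ⟨S₁, hS₁, hg₁⟩ := (Q.forget K M).exists_isGeneral
  obtain ⟨S', hg, hS'⟩ := mem_closure_iff.1 (hUd hS₁) _ SpaceConfig.isOpen_setOf_isGeneral hg₁
  refine ⟨S', hS'.1, hg, fun y hy hSy O hO hyO => ?_⟩
  obtain ⟨V, hV, hVd, hVl⟩ := hlift S' hS'
  obtain ⟨y', hyO', hy'⟩ := mem_closure_iff.1 (hVd ⟨hy, hSy⟩) O hO hyO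
  exact ⟨y', hyO', hVl y' hy'⟩

/-- If the images in the three views of configurations `S v` that agree with `S'` are such that the
back-projections of some observations meet `W` only in `0`, then there is an extension `T` of `S'`
for which the observed points and lines meet `W` only in `0`. -/
theorem HasLiftsNear.exists_extension {S' : SpaceConfig K M} (h : Q.HasLiftsNear S')
    (S : Fin 3 → SpaceConfig P L) (hcam : ∀ v, (S v).cam = S'.cam)
    (hp : ∀ v (i : Q.seesPt v), (S v).cam.center v ∉ ((S v).pt i).1)
    (hl : ∀ v (j : Q.seesLn v), (S v).cam.center v ∉ ((S v).ln j).1)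
    (hinc : ∀ v (i : Q.seesPt v) (j : Q.seesLn v), Q.inc i j → ((S v).pt i).1 ≤ ((S v).ln j).1)
    (hK : ∀ v (i : K), (i : P) ∈ Q.seesPt v → (S v).pt i = S'.pt i)
    (hM : ∀ v (j : M), (j : L) ∈ Q.seesLn v → (S v).ln j = S'.ln j)
    (W : Submodule ℂ (Fin 4 → ℂ)) {n : ℕ} (o : Fin n → Q.Observation)
    (ho : ∀ x ∈ W, (∀ k, x ∈ (o k).space (S (o k).1) ⊔ Submodule.span ℂ {S'.cam.center (o k).1}) →
      x = 0) :
    ∃ T ∈ Q.spaceVariety, spaceForget K M T = S' ∧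
      ∀ x ∈ W, (∀ k, x ∈ (o k).space T) → x = 0 := by
  obtain ⟨y', hy', T, hT, hTy, hTS⟩ := h (Q.mixedImage S hp hl)
    (fun v i j hij => Submodule.map_mono (hinc v i j hij))
    ⟨fun v i => by
      change (S'.pt i).1.map _ = ((S v).pt i).1.map _
      rw [hK v i i.2, hcam v], fun v j => by
      change (S'.ln j).1.map _ = ((S v).ln j).1.map _
      rw [hM v j j.2, hcam v]⟩
    _ (PointLineProblem.isOpen_setOf_inf_comap_eq_bot S'.cam W o) (by
      intro x hx hk
      refine ho x hx fun k => ?_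
      have key : (o k).image (Q.mixedImage S hp hl) =
          ((o k).space (S (o k).1)).map (S'.cam.proj (o k).1) := by
        rcases o k with ⟨v, i | j⟩ <;>
        · rw [← hcam v]
          rfl
      have := hk k
      rwa [key, ← Submodule.mem_comap, Submodule.comap_map_eq, CameraConfig.ker_proj] at this)
  refine ⟨T, hT, hTS, fun x hx hk => hy' x hx fun k => ?_⟩
  have hTcam : T.cam = S'.cam := congrArg (fun S => S.cam) hTS
  have key : (o k).image y' = ((o k).space T).map (S'.cam.proj (o k).1) := by
    rw [← hTcam]
    rcases o k with ⟨v, i | j⟩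
    · exact (hTy.1 v i).symm
    · exact (hTy.2 v j).symm
  rw [key]
  exact Submodule.mem_map_of_mem (hk k)

end PL1P

namespace SpaceConfig.IsGeneral

variable {P L : Type*} {S : SpaceConfig P L} (hg : S.IsGeneral) {v w : Fin 3} (hvw : v ≠ w)
include hg hvw

/-- A subspace that does not meet the baseline contains no nontrivial difference of multiples of the
two camera centers. -/
theorem eq_zero_of_smul_sub_smul_mem {a b : ℂ} {W : Submodule ℂ (Fin 4 → ℂ)}
    (hW : Disjoint (S.cam.baseline v w) W)
    (h : a • S.cam.center v - b • S.cam.center w ∈ W) : a = 0 ∧ b = 0 := by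
  have h0 := Submodule.disjoint_def.1 hW _ (Submodule.sub_mem _
    (Submodule.smul_mem _ a (S.cam.center_mem_baseline_left v w))
    (Submodule.smul_mem _ b (S.cam.center_mem_baseline_right v w))) h
  have := LinearIndependent.pair_iff.1 (hg.centers v w hvw) a (-b) (by
    rw [neg_smul, ← sub_eq_add_neg, h0])
  exact ⟨this.1, neg_eq_zero.1 this.2⟩

/-- The planes that join a line to two camera centers meet in this line. -/
theorem mem_ln_of_mem_sup {j : L} {x : Fin 4 → ℂ}
    (hv : x ∈ (S.ln j).1 ⊔ Submodule.span ℂ {S.cam.center v})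
    (hw : x ∈ (S.ln j).1 ⊔ Submodule.span ℂ {S.cam.center w}) : x ∈ (S.ln j).1 := by
  obtain ⟨l, hl, _, hc, rfl⟩ := Submodule.mem_sup.1 hv
  obtain ⟨a, rfl⟩ := Submodule.mem_span_singleton.1 hc
  obtain ⟨l', hl', _, hc', h⟩ := Submodule.mem_sup.1 hw
  obtain ⟨b, rfl⟩ := Submodule.mem_span_singleton.1 hc'
  have h1 := hg.eq_zero_of_smul_sub_smul_mem hvw (a := a) (b := b) (hg.ln v w hvw j) (by
    have : a • S.cam.center v - b • S.cam.center w = l' - l := by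
      rw [sub_eq_sub_iff_add_eq_add, add_comm, ← h]
    rw [this]
    exact Submodule.sub_mem _ hl' hl)
  rw [h1.1, zero_smul, add_zero]
  exact hl

end SpaceConfig.IsGeneral

namespace PL1P

variable {P L : Type*} {Q : PL1P P L} {K : Set P} {M : Set L} {S' : SpaceConfig K M}

/-- A subspace of dimension at most three is not all of `ℂ⁴`. -/
theorem ne_top_of_finrank_le {W : Submodule ℂ (Fin 4 → ℂ)} (h : Module.finrank ℂ W ≤ 3) :
    W ≠ ⊤ := by
  rintro rfl
  rw [finrank_top, Module.finrank_fin_fun] at h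
  omega

theorem finrank_sup_span_singleton_le (W : Submodule ℂ (Fin 4 → ℂ)) (x : Fin 4 → ℂ) :
    Module.finrank ℂ (W ⊔ Submodule.span ℂ {x} : Submodule ℂ (Fin 4 → ℂ)) ≤
      Module.finrank ℂ W + 1 := by
  have h1 := Submodule.finrank_add_le_finrank_add_finrank W (Submodule.span ℂ {x})
  have h2 : Module.finrank ℂ (Submodule.span ℂ {x}) ≤ 1 := by
    simpa using finrank_span_le_card (R := ℂ) ({x} : Set (Fin 4 → ℂ))
  omega

/-- For a point `p` different from `c` there is a line that spans with `c` a plane not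
containing `p`. -/
theorem exists_line_disjoint (p : Gr 1 4) {c : Fin 4 → ℂ} (hc0 : c ≠ 0) (hc : c ∉ p.1) :
    ∃ l : Gr 2 4, c ∉ l.1 ∧ ∀ x ∈ p.1, x ∈ l.1 ⊔ Submodule.span ℂ {c} → x = 0 := by
  have hdisj := Submodule.disjoint_span_singleton_of_notMem hc
  have h2 : Module.finrank ℂ (p.1 ⊔ Submodule.span ℂ {c} : Submodule ℂ (Fin 4 → ℂ)) = 2 := by
    rw [← Nat.add_right_cancel_iff, Submodule.finrank_sup_add_finrank_inf_eq, hdisj.eq_bot,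
      finrank_bot, p.2, finrank_span_singleton hc0]
  obtain ⟨l, hl⟩ := Submodule.exists_isCompl (p.1 ⊔ Submodule.span ℂ {c})
  have hl2 := Submodule.finrank_add_eq_of_isCompl hl
  rw [h2, Module.finrank_fin_fun] at hl2
  have hcl : ∀ x ∈ p.1 ⊔ Submodule.span ℂ {c}, x ∈ l → x = 0 := Submodule.disjoint_def.1 hl.disjoint
  have hcs : c ∈ p.1 ⊔ Submodule.span ℂ {c} :=
    Submodule.mem_sup_right (Submodule.mem_span_singleton_self c)
  refine ⟨⟨l, by omega⟩, fun h => hc0 (hcl c hcs h), fun x hx hxl => ?_⟩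
  obtain ⟨y, hy, z, hz, rfl⟩ := Submodule.mem_sup.1 hxl
  have hy0 : y = 0 := by
    refine hcl y ?_ hy
    rw [← add_sub_cancel_right y z]
    exact Submodule.sub_mem _ (Submodule.mem_sup_left hx) (Submodule.mem_sup_right hz)
  rw [hy0, zero_add] at hx ⊢
  exact Submodule.disjoint_def.1 hdisj z hx hz

theorem exists_isGeneral_extension
    (hKM : ∀ i ∉ K, ∀ j ∈ M, ∀ j' ∈ M, Q.inc i j → Q.inc i j' → j = j')
    (hS' : S' ∈ (Q.forget K M).spaceVariety) (hg : S'.IsGeneral) :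
    ∃ S ∈ Q.spaceVariety, S.IsGeneral ∧ spaceForget K M S = S' := by
  obtain ⟨S, hS, hgS, hf, -⟩ := Q.exists_extension hKM hS' hg (fun _ => ⊥) (fun _ => ⊥)
    (fun i _ => ⟨bot_ne_top, fun j _ h => by
      have h1 := (S'.ln j).2
      rw [le_bot_iff.1 h, finrank_bot] at h1
      omega⟩) fun _ _ => bot_ne_top
  exact ⟨S, hS, hgS, hf⟩

section

variable (hKM : ∀ i ∉ K, ∀ j ∈ M, ∀ j' ∈ M, Q.inc i j → Q.inc i j' → j = j')
  (hS' : S' ∈ (Q.forget K M).spaceVariety) (hg : S'.IsGeneral) (hlift : Q.HasLiftsNear S')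
include hKM hS' hg hlift

/-- The image of a forgotten pin of a kept point has to pass through the image of the point, but
this incidence is not visible in a view that does not observe the point. -/
theorem HasLiftsNear.seesPt_of_seesLn {i : P} (hi : i ∈ K) {j : L} (hj : j ∉ M) (hij : Q.inc i j)
    {w : Fin 3} (hw : j ∈ Q.seesLn w) : i ∈ Q.seesPt w := by
  classical
  by_contra hiw
  obtain ⟨S₀, hS₀, hg₀, hf⟩ := exists_isGeneral_extension hKM hS' hg
  have hcam : S₀.cam = S'.cam := congrArg (fun S => S.cam) hf
  have hpt : ∀ i : K, S₀.pt i = S'.pt i := fun i => congrArg (fun S => S.pt i) hf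
  have hln : ∀ j : M, S₀.ln j = S'.ln j := fun j => congrArg (fun S => S.ln j) hf
  obtain ⟨l, hcl, hl⟩ := exists_line_disjoint (S₀.pt i) (S₀.cam.center_ne_zero w)
    (hg₀.center_notMem_pt w i)
  obtain ⟨T, hT, hTS, h⟩ := hlift.exists_extension
    (fun v => if v = w then ⟨S₀.pt, Function.update S₀.ln j l, S₀.cam⟩ else S₀)
    (fun v => by split_ifs <;> exact hcam)
    (fun v i => by split_ifs <;> exact hg₀.center_notMem_pt v i)
    (fun v j' => by
      split_ifs with hv
      · subst hv
        by_cases hjj : (j' : L) = j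
        · simpa [hjj] using hcl
        · simpa [hjj] using hg₀.center_notMem_ln v j'
      · exact hg₀.center_notMem_ln v j')
    (fun v i' j' hij' => by
      split_ifs with hv
      · have hjj : (j' : L) ≠ j := by
          intro hjj
          rw [hjj] at hij'
          apply hiw
          rw [← Q.at_most_one _ _ _ hij' hij, ← hv]
          exact i'.2
        simpa [hjj] using hS₀ i' j' hij'
      · exact hS₀ i' j' hij')
    (fun v i _ => by split_ifs <;> exact hpt i)
    (fun v j' _ => by
      split_ifs
      · have hjj : (j' : L) ≠ j := fun h => hj (h ▸ j'.2)
        simpa [hjj] using hln j'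
      · exact hln j')
    (S₀.pt i).1 ![⟨w, .inr ⟨j, hw⟩⟩] (by
      intro x hx hk
      refine hl x hx ?_
      have := hk 0
      rw [← hcam] at this
      simpa [PointLineProblem.Observation.space] using this)
  obtain ⟨x, hx0, hx⟩ := (S₀.pt i).exists_eq_span_singleton
  have hxp : x ∈ (S₀.pt i).1 := by rw [hx]; exact Submodule.mem_span_singleton_self x
  refine hx0 (h x hxp fun k => ?_)
  fin_cases k
  refine hT i j hij ?_
  have : T.pt i = S₀.pt i := (congrArg (fun S => S.pt ⟨i, hi⟩) hTS).trans (hpt ⟨i, hi⟩).symm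
  rw [this]
  exact hxp

/-- Three generic image lines do not come from a line in space, so that a line which is observed in
all views is kept. -/
theorem HasLiftsNear.not_forall_seesLn {j : L} (hj : j ∉ M) : ¬ ∀ v, j ∈ Q.seesLn v := by
  intro hall
  obtain ⟨S₀, hS₀, hg₀, hf⟩ := exists_isGeneral_extension hKM hS' hg
  have hcam : S₀.cam = S'.cam := congrArg (fun S => S.cam) hf
  have hpt : ∀ i : K, S₀.pt i = S'.pt i := fun i => congrArg (fun S => S.pt i) hf
  have hln : ∀ j : M, S₀.ln j = S'.ln j := fun j => congrArg (fun S => S.ln j) hf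
  obtain ⟨S₂, hS₂, hg₂, hf₂, -, hG⟩ := Q.exists_extension hKM hS' hg (fun _ => ⊥)
    (fun j => (S₀.ln j).1 ⊔ Submodule.span ℂ {S₀.cam.center 2})
    (fun i _ => ⟨bot_ne_top, fun j _ h => by
      have h1 := (S'.ln j).2
      rw [le_bot_iff.1 h, finrank_bot] at h1
      omega⟩) fun j _ => ne_top_of_finrank_le (by
        have := finrank_sup_span_singleton_le (S₀.ln j).1 (S₀.cam.center 2)
        rw [(S₀.ln j).2] at this
        exact this)
  have hcam₂ : S₂.cam = S'.cam := congrArg (fun S => S.cam) hf₂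
  have hpt₂ : ∀ i : K, S₂.pt i = S'.pt i := fun i => congrArg (fun S => S.pt i) hf₂
  have hln₂ : ∀ j : M, S₂.ln j = S'.ln j := fun j => congrArg (fun S => S.ln j) hf₂
  -- the planes through the images in the first two views meet in `S₀.ln j`, which is not contained in
  -- the plane `P₂` through the third image
  set P₂ := (S₂.ln j).1 ⊔ Submodule.span ℂ {S'.cam.center 2} with hP₂
  have hnle : ¬ (S₀.ln j).1 ≤ P₂ := by
    intro hle
    have hle' : (S₀.ln j).1 ⊔ Submodule.span ℂ {S₀.cam.center 2} ≤ P₂ := by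
      rw [hcam]
      exact sup_le hle le_sup_right
    have h3 : Module.finrank ℂ
        ((S₀.ln j).1 ⊔ Submodule.span ℂ {S₀.cam.center 2} : Submodule ℂ (Fin 4 → ℂ)) = 3 := by
      rw [← Nat.add_right_cancel_iff, Submodule.finrank_sup_add_finrank_inf_eq,
        (Submodule.disjoint_span_singleton_of_notMem (hg₀.center_notMem_ln 2 j)).eq_bot,
        finrank_bot, (S₀.ln j).2, finrank_span_singleton (S₀.cam.center_ne_zero 2)]
    have h4 := finrank_sup_span_singleton_le (S₂.ln j).1 (S'.cam.center 2)
    rw [(S₂.ln j).2] at h4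
    have heq := Submodule.eq_of_le_of_finrank_le hle' (by rw [h3]; exact h4)
    apply hG j hj
    rw [heq]
    exact le_sup_left
  have hlt : (S₀.ln j).1 ⊓ P₂ < (S₀.ln j).1 :=
    lt_of_le_of_ne inf_le_left fun h => hnle (inf_eq_left.1 h)
  have h1 := Submodule.finrank_lt_finrank_of_lt hlt
  rw [(S₀.ln j).2] at h1
  obtain ⟨W, hW⟩ := Submodule.exists_isCompl ((S₀.ln j).1 ⊓ P₂)
  have hWr := Submodule.finrank_add_eq_of_isCompl hW
  rw [Module.finrank_fin_fun] at hWr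
  obtain ⟨T, hT, hTS, h⟩ := hlift.exists_extension ![S₀, S₀, S₂]
    (by intro v; fin_cases v <;> assumption)
    (by
      intro v i
      fin_cases v
      exacts [hg₀.center_notMem_pt _ _, hg₀.center_notMem_pt _ _, hg₂.center_notMem_pt _ _])
    (by
      intro v i
      fin_cases v
      exacts [hg₀.center_notMem_ln _ _, hg₀.center_notMem_ln _ _, hg₂.center_notMem_ln _ _])
    (by
      intro v i j hij
      fin_cases v
      exacts [hS₀ i j hij, hS₀ i j hij, hS₂ i j hij])
    (by
      intro v i _
      fin_cases v
      exacts [hpt i, hpt i, hpt₂ i])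
    (by
      intro v i _
      fin_cases v
      exacts [hln i, hln i, hln₂ i])
    W (fun v : Fin 3 => ⟨v, .inr ⟨j, hall v⟩⟩) (by
      intro x hx hk
      refine Submodule.disjoint_def.1 hW.disjoint x ⟨?_, hk 2⟩ hx
      have h0 := hk 0
      have h1 := hk 1
      rw [← hcam] at h0 h1
      exact hg₀.mem_ln_of_mem_sup (v := 0) (w := 1) (by decide) h0 h1)
  have h5 : (T.ln j).1 ⊓ W = ⊥ := by
    rw [eq_bot_iff]
    exact fun x hx => h x hx.2 fun _ => hx.1
  have h6 := Submodule.finrank_sup_add_finrank_inf_eq (T.ln j).1 W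
  rw [h5, finrank_bot, (T.ln j).2] at h6
  have h7 := Submodule.finrank_le ((T.ln j).1 ⊔ W)
  rw [Module.finrank_fin_fun] at h7
  omega

/-- Two generic image points do not come from a point in space, even if the point is required to lie
on a given line and its images are required to lie on the images of this line. -/
theorem HasLiftsNear.eq_of_seesPt {i : P} (hi : i ∉ K) {v w : Fin 3} (hv : i ∈ Q.seesPt v)
    (hw : i ∈ Q.seesPt w) : v = w := by
  by_contra hvw
  obtain ⟨S₀, hS₀, hg₀, hf⟩ := exists_isGeneral_extension hKM hS' hg
  have hcam : S₀.cam = S'.cam := congrArg (fun S => S.cam) hf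
  have hpt : ∀ i : K, S₀.pt i = S'.pt i := fun i => congrArg (fun S => S.pt i) hf
  have hln : ∀ j : M, S₀.ln j = S'.ln j := fun j => congrArg (fun S => S.ln j) hf
  obtain ⟨S₁, hS₁, hg₁, hf₁, hH, -⟩ := Q.exists_extension hKM hS' hg
    (fun i => S₀.cam.baseline v w ⊔ (S₀.pt i).1) (fun _ => ⊥)
    (fun i _ => ⟨ne_top_of_finrank_le (by
      have h1 := Submodule.finrank_add_le_finrank_add_finrank (S₀.cam.baseline v w) (S₀.pt i).1
      have h2 := S₀.cam.finrank_baseline_le v w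
      have h3 := (S₀.pt i).2
      omega), fun j hij hle => by
      have hle' : (S₀.ln j).1 ≤ (S₀.pt i).1 := by
        intro x hx
        have hx' := hx
        rw [hln j] at hx'
        obtain ⟨b, hb, p, hp, rfl⟩ := Submodule.mem_sup.1 (hle hx')
        have hb0 : b = 0 := by
          refine Submodule.disjoint_def.1 (hg₀.ln v w hvw j) b hb ?_
          rw [← add_sub_cancel_right b p]
          exact Submodule.sub_mem _ hx (hS₀ i j hij hp)
        rw [hb0, zero_add]
        exact hp
      have h1 := Submodule.finrank_mono hle'
      rw [(S₀.ln j).2, (S₀.pt i).2] at h1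
      omega⟩) fun _ _ => bot_ne_top
  have hcam₁ : S₁.cam = S'.cam := congrArg (fun S => S.cam) hf₁
  have hpt₁ : ∀ i : K, S₁.pt i = S'.pt i := fun i => congrArg (fun S => S.pt i) hf₁
  have hln₁ : ∀ j : M, S₁.ln j = S'.ln j := fun j => congrArg (fun S => S.ln j) hf₁
  -- the rays through the two images are skew, as `S₁.pt i` avoids the plane spanned by the baseline and
  -- `S₀.pt i`
  obtain ⟨T, hT, hTS, h⟩ := hlift.exists_extension (fun u => if u = w then S₁ else S₀)
    (fun u => by split_ifs <;> assumption)
    (fun u i => by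
      split_ifs
      exacts [hg₁.center_notMem_pt u i, hg₀.center_notMem_pt u i])
    (fun u j => by
      split_ifs
      exacts [hg₁.center_notMem_ln u j, hg₀.center_notMem_ln u j])
    (fun u i j hij => by
      split_ifs
      exacts [hS₁ i j hij, hS₀ i j hij])
    (fun u i _ => by
      split_ifs
      exacts [hpt₁ i, hpt i])
    (fun u i _ => by
      split_ifs
      exacts [hln₁ i, hln i])
    ⊤ ![⟨v, .inl ⟨i, hv⟩⟩, ⟨w, .inl ⟨i, hw⟩⟩] (by
      intro x _ hk
      have h0 := hk 0
      have h1 := hk 1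
      simp only [Matrix.cons_val, hvw, if_true, if_false, PointLineProblem.Observation.space,
        ← hcam] at h0 h1
      obtain ⟨p, hp, _, hc, rfl⟩ := Submodule.mem_sup.1 h0
      obtain ⟨a, rfl⟩ := Submodule.mem_span_singleton.1 hc
      obtain ⟨p', hp', _, hc', hx⟩ := Submodule.mem_sup.1 h1
      obtain ⟨b, rfl⟩ := Submodule.mem_span_singleton.1 hc'
      have hp0 : p' = 0 := by
        by_contra hp0
        apply hH i hi
        have hspan : (S₁.pt i).1 = Submodule.span ℂ {p'} :=
          (Submodule.eq_of_le_of_finrank_eq ((Submodule.span_singleton_le_iff_mem _ _).2 hp')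
            (by rw [finrank_span_singleton hp0, (S₁.pt i).2])).symm
        rw [hspan, Submodule.span_singleton_le_iff_mem, ← add_sub_cancel_right p'
          (b • S₀.cam.center w), hx]
        refine Submodule.sub_mem _ (Submodule.add_mem _ (Submodule.mem_sup_right hp)
          (Submodule.mem_sup_left ?_)) (Submodule.mem_sup_left ?_)
        · exact Submodule.smul_mem _ _ (S₀.cam.center_mem_baseline_left v w)
        · exact Submodule.smul_mem _ _ (S₀.cam.center_mem_baseline_right v w)
      rw [hp0, zero_add] at hx
      have h2 := hg₀.eq_zero_of_smul_sub_smul_mem hvw (a := a) (b := b) (hg₀.pt v w hvw i) (by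
        rw [hx, sub_add_cancel_right]
        exact Submodule.neg_mem _ hp)
      rw [← hx, h2.2, zero_smul])
  obtain ⟨x, hx0, hx⟩ := (T.pt i).exists_eq_span_singleton
  have hxp : x ∈ (T.pt i).1 := by rw [hx]; exact Submodule.mem_span_singleton_self x
  exact hx0 (h x trivial fun k => by fin_cases k <;> exact hxp)

/-- A point that is observed in one view has no pins that are observed one each in the other views,
unless they are kept. -/
theorem HasLiftsNear.mem_of_two_pins {i : P} {v w u : Fin 3} (hvu : v ≠ u)
    (hvw : v ≠ w) (hwu : w ≠ u) (hv : i ∈ Q.seesPt v) (hiw : i ∉ Q.seesPt w) {j₁ j₂ : L}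
    (hij₁ : Q.inc i j₁) (hij₂ : Q.inc i j₂) (hw : j₁ ∈ Q.seesLn w) (hu : j₂ ∈ Q.seesLn u) :
    j₁ ∈ M := by
  classical
  by_contra hj
  obtain ⟨S₀, hS₀, hg₀, hf⟩ := exists_isGeneral_extension hKM hS' hg
  have hcam : S₀.cam = S'.cam := congrArg (fun S => S.cam) hf
  have hpt : ∀ i : K, S₀.pt i = S'.pt i := fun i => congrArg (fun S => S.pt i) hf
  have hln : ∀ j : M, S₀.ln j = S'.ln j := fun j => congrArg (fun S => S.ln j) hf
  obtain ⟨l, hcl, hl⟩ := exists_line_disjoint (S₀.pt i) (S₀.cam.center_ne_zero w)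
    (hg₀.center_notMem_pt w i)
  obtain ⟨T, hT, hTS, h⟩ := hlift.exists_extension
    (fun v => if v = w then ⟨S₀.pt, Function.update S₀.ln j₁ l, S₀.cam⟩ else S₀)
    (fun v => by split_ifs <;> exact hcam)
    (fun v i => by split_ifs <;> exact hg₀.center_notMem_pt v i)
    (fun v j' => by
      split_ifs with hv
      · subst hv
        by_cases hjj : (j' : L) = j₁
        · simpa [hjj] using hcl
        · simpa [hjj] using hg₀.center_notMem_ln v j'
      · exact hg₀.center_notMem_ln v j')
    (fun v i' j' hij' => by
      split_ifs with hv
      · have hjj : (j' : L) ≠ j₁ := by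
          intro hjj
          rw [hjj] at hij'
          apply hiw
          rw [← Q.at_most_one _ _ _ hij' hij₁, ← hv]
          exact i'.2
        simpa [hjj] using hS₀ i' j' hij'
      · exact hS₀ i' j' hij')
    (fun v i _ => by split_ifs <;> exact hpt i)
    (fun v j' _ => by
      split_ifs
      · have hjj : (j' : L) ≠ j₁ := fun h => hj (h ▸ j'.2)
        simpa [hjj] using hln j'
      · exact hln j')
    ⊤ ![⟨v, .inl ⟨i, hv⟩⟩, ⟨w, .inr ⟨j₁, hw⟩⟩, ⟨u, .inr ⟨j₂, hu⟩⟩] (by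
      intro x _ hk
      have h0 := hk 0
      have h1 := hk 1
      have h2 := hk 2
      simp only [Matrix.cons_val, hvw, hwu.symm, if_true, if_false,
        PointLineProblem.Observation.space, ← hcam,
        Function.update_self] at h0 h1 h2
      refine hl x ?_ h1
      obtain ⟨p, hp, _, hc, rfl⟩ := Submodule.mem_sup.1 h0
      obtain ⟨a, rfl⟩ := Submodule.mem_span_singleton.1 hc
      obtain ⟨p', hp', _, hc', hx⟩ := Submodule.mem_sup.1 h2
      obtain ⟨b, rfl⟩ := Submodule.mem_span_singleton.1 hc'
      have h3 := hg₀.eq_zero_of_smul_sub_smul_mem hvu (a := a) (b := b) (hg₀.ln v u hvu j₂) (by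
        have : a • S₀.cam.center v - b • S₀.cam.center u = p' - p := by
          rw [sub_eq_sub_iff_add_eq_add, add_comm, ← hx]
        rw [this]
        exact Submodule.sub_mem _ hp' (hS₀ i j₂ hij₂ hp))
      rw [h3.1, zero_smul, add_zero]
      exact hp)
  obtain ⟨x, hx0, hx⟩ := (T.pt i).exists_eq_span_singleton
  have hxp : x ∈ (T.pt i).1 := by rw [hx]; exact Submodule.mem_span_singleton_self x
  exact hx0 (h x trivial fun k => by
    fin_cases k
    exacts [hxp, hT i j₁ hij₁ hxp, hT i j₂ hij₂ hxp])

/-- If a forgotten point has a pin that is observed in two other views, then a view that observes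
the point observes some pin of it: otherwise the image of the point in this view is not restricted to
the image of the pin. -/
theorem HasLiftsNear.exists_seesLn {i : P} (hi : i ∉ K) {v w u : Fin 3} (hwu : w ≠ u)
    (hvw : v ≠ w) (hvu : v ≠ u) (hv : i ∈ Q.seesPt v) {j : L} (hij : Q.inc i j)
    (hw : j ∈ Q.seesLn w) (hu : j ∈ Q.seesLn u) : ∃ j', Q.inc i j' ∧ j' ∈ Q.seesLn v := by
  classical
  by_contra! hnone
  obtain ⟨S₀, hS₀, hg₀, hf⟩ := exists_isGeneral_extension hKM hS' hg
  have hcam : S₀.cam = S'.cam := congrArg (fun S => S.cam) hf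
  have hpt : ∀ i : K, S₀.pt i = S'.pt i := fun i => congrArg (fun S => S.pt i) hf
  have hln : ∀ j : M, S₀.ln j = S'.ln j := fun j => congrArg (fun S => S.ln j) hf
  obtain ⟨q, hq⟩ : ∃ q, q ∉ (S₀.ln j).1 ⊔ Submodule.span ℂ {S₀.cam.center v} := by
    by_contra! hq
    refine ne_top_of_finrank_le ?_ (Submodule.eq_top_iff'.2 hq)
    have := finrank_sup_span_singleton_le (S₀.ln j).1 (S₀.cam.center v)
    rwa [(S₀.ln j).2] at this
  have hq0 : q ≠ 0 := by
    rintro rfl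
    exact hq (Submodule.zero_mem _)
  obtain ⟨T, hT, hTS, h⟩ := hlift.exists_extension
    (fun u => if u = v then ⟨Function.update S₀.pt i (Gr.point q hq0), S₀.ln, S₀.cam⟩ else S₀)
    (fun v => by split_ifs <;> exact hcam)
    (fun u i' => by
      split_ifs with huv
      · subst huv
        by_cases hii : (i' : P) = i
        · intro hc
          simp only [hii, Function.update_self] at hc
          obtain ⟨a, ha⟩ := Submodule.mem_span_singleton.1 hc
          have ha0 : a ≠ 0 := by
            rintro rfl
            rw [zero_smul] at ha
            exact S₀.cam.center_ne_zero u ha.symm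
          apply hq
          rw [← Submodule.smul_mem_iff _ ha0, ha]
          exact Submodule.mem_sup_right (Submodule.mem_span_singleton_self _)
        · simpa [hii] using hg₀.center_notMem_pt u i'
      · exact hg₀.center_notMem_pt u i')
    (fun v i => by split_ifs <;> exact hg₀.center_notMem_ln v i)
    (fun u i' j' hij' => by
      split_ifs with huv
      · have hii : (i' : P) ≠ i := by
          intro hii
          rw [hii] at hij'
          exact hnone j' hij' (huv ▸ j'.2)
        simpa [hii] using hS₀ i' j' hij'
      · exact hS₀ i' j' hij')
    (fun v i' _ => by
      split_ifs
      · have hii : (i' : P) ≠ i := fun h => hi (h ▸ i'.2)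
        simpa [hii] using hpt i'
      · exact hpt i')
    (fun v i _ => by split_ifs <;> exact hln i)
    ⊤ ![⟨v, .inl ⟨i, hv⟩⟩, ⟨w, .inr ⟨j, hw⟩⟩, ⟨u, .inr ⟨j, hu⟩⟩] (by
      intro x _ hk
      have h0 := hk 0
      have h1 := hk 1
      have h2 := hk 2
      simp only [Matrix.cons_val, hvw.symm, hvu.symm, if_true, if_false,
        PointLineProblem.Observation.space, ← hcam,
        Function.update_self] at h0 h1 h2
      have hx := hg₀.mem_ln_of_mem_sup hwu h1 h2
      obtain ⟨p, hp, _, hc, rfl⟩ := Submodule.mem_sup.1 h0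
      obtain ⟨b, rfl⟩ := Submodule.mem_span_singleton.1 hc
      obtain ⟨a, rfl⟩ := Submodule.mem_span_singleton.1 hp
      have ha : a = 0 := by
        by_contra ha
        apply hq
        rw [← Submodule.smul_mem_iff _ ha, ← add_sub_cancel_right (a • q) (b • S₀.cam.center v)]
        exact Submodule.sub_mem _ (Submodule.mem_sup_left hx) (Submodule.mem_sup_right hc)
      rw [ha, zero_smul, zero_add] at hx ⊢
      by_contra hb
      have hb0 : b ≠ 0 := by
        rintro rfl
        exact hb (zero_smul _ _)
      exact hg₀.center_notMem_ln v j ((Submodule.smul_mem_iff _ hb0).1 hx))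
  obtain ⟨x, hx0, hx⟩ := (T.pt i).exists_eq_span_singleton
  have hxp : x ∈ (T.pt i).1 := by rw [hx]; exact Submodule.mem_span_singleton_self x
  exact hx0 (h x trivial fun k => by
    fin_cases k
    exacts [hxp, hT i j hij hxp, hT i j hij hxp])

end

end PL1P

/-! ### Necessary conditions for minimality -/

namespace PL1P

variable {P L : Type*} {Q : PL1P P L} {K : Set P} {M : Set L}

/-- Conditions that exclude points and lines which can be moved without changing their images. -/
structure IsTame (Q : PL1P P L) : Prop where
  exists_seesLn : ∀ j, ∃ v w, v ≠ w ∧ j ∈ Q.seesLn v ∧ j ∈ Q.seesLn w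
  exists_seesPt : ∀ i, ∃ v, i ∈ Q.seesPt v
  exists_inc : ∀ i, (∃! v, i ∈ Q.seesPt v) → ∃ j, Q.inc i j

/-- If a point can move in a direction that is not visible, then there are infinitely many solutions. -/
theorem infinite_solutions_of_pt {y : ImageConfig Q.toPointLineProblem} {S : SpaceConfig P L}
    (hS : S ∈ Q.solutions y) {i : P} {r : Fin 4 → ℂ} (hr : r ∉ (S.pt i).1)
    (hln : ∀ j, Q.inc i j → r ∈ (S.ln j).1) (hv : ∀ v, i ∈ Q.seesPt v → S.cam.proj v r = 0) :
    (Q.solutions y).Infinite := by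
  classical
  obtain ⟨p, hp0, hp⟩ := (S.pt i).exists_eq_span_singleton
  have hpm : p ∈ (S.pt i).1 := by rw [hp]; exact Submodule.mem_span_singleton_self p
  have hli : LinearIndependent ℂ ![p, r] := by
    rw [LinearIndependent.pair_iff' hp0]
    intro a ha
    exact hr (ha ▸ Submodule.smul_mem _ a hpm)
  have hne : ∀ t : ℂ, p + t • r ≠ 0 := fun t h =>
    one_ne_zero (LinearIndependent.pair_iff.1 hli 1 t (by rw [one_smul, h])).1
  refine Set.infinite_of_injective_forall_mem (f := fun t : ℂ =>
    (⟨Function.update S.pt i (Gr.point (p + t • r) (hne t)), S.ln, S.cam⟩ : SpaceConfig P L)) ?_ ?_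
  · intro t t' h
    have h1 := congrFun (congrArg SpaceConfig.pt h) i
    simp only [Function.update_self] at h1
    have h2 : p + t • r ∈ Submodule.span ℂ {p + t' • r} := by
      change p + t • r ∈ (Gr.point (p + t' • r) (hne t')).1
      rw [← h1]
      exact Submodule.mem_span_singleton_self _
    obtain ⟨a, ha⟩ := Submodule.mem_span_singleton.1 h2
    have h3 := LinearIndependent.pair_iff.1 hli (a - 1) (a * t' - t) (by
      rw [smul_add, smul_smul] at ha
      rw [sub_smul, sub_smul, one_smul, sub_add_sub_comm, ha, sub_self])
    rw [sub_eq_zero.1 h3.1, one_mul] at h3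
    exact (sub_eq_zero.1 h3.2).symm
  · intro t
    refine ⟨fun i' j hij => ?_, fun v i' => ?_, hS.2.2⟩
    · by_cases hi : i' = i
      · subst hi
        simp only [Function.update_self]
        exact (Submodule.span_singleton_le_iff_mem _ _).2
          (Submodule.add_mem _ (hS.1 i' j hij hpm) (Submodule.smul_mem _ t (hln j hij)))
      · simpa [hi] using hS.1 i' j hij
    · by_cases hi : (i' : P) = i
      · rw [← hS.2.1 v i']
        simp only [hi, Function.update_self]
        rw [hp]
        change (Submodule.span ℂ {p + t • r}).map _ = _
        rw [Submodule.map_span, Submodule.map_span, Set.image_singleton, Set.image_singleton,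
          map_add, map_smul, hv v (hi ▸ i'.2), smul_zero, add_zero]
      · simpa [hi] using hS.2.1 v i'

/-- If a line can move in a direction that is not visible, then there are infinitely many solutions. -/
theorem infinite_solutions_of_ln {y : ImageConfig Q.toPointLineProblem} {S : SpaceConfig P L}
    (hS : S ∈ Q.solutions y) {j : L} {r : Fin 4 → ℂ} (hr : r ∉ (S.ln j).1)
    (hv : ∀ v, j ∈ Q.seesLn v → S.cam.proj v r = 0) :
    (Q.solutions y).Infinite := by
  classical
  -- the line rotates about a point, which is the point whose pin it is if there is one
  obtain ⟨p, hp0, hpm, hpi⟩ : ∃ p, p ≠ 0 ∧ p ∈ (S.ln j).1 ∧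
      ∀ i, Q.inc i j → (S.pt i).1 = Submodule.span ℂ {p} := by
    by_cases h : ∃ i, Q.inc i j
    · obtain ⟨i, hi⟩ := h
      obtain ⟨p, hp0, hp⟩ := (S.pt i).exists_eq_span_singleton
      refine ⟨p, hp0, hS.1 i j hi (by rw [hp]; exact Submodule.mem_span_singleton_self p), ?_⟩
      intro i' hi'
      rw [Q.at_most_one _ _ _ hi' hi, hp]
    · obtain ⟨b, hb⟩ := (S.ln j).exists_isFrame
      exact ⟨b 0, hb.linearIndependent.ne_zero 0, hb.mem 0, fun i hi => (h ⟨i, hi⟩).elim⟩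
  obtain ⟨q, hq, hpq⟩ := (S.ln j).exists_linearIndependent_pair hp0
  have hln := Gr.eq_span_pair hpq hpm hq
  have hzero : ∀ a b c : ℂ, a • p + b • q + c • r = 0 → a = 0 ∧ b = 0 ∧ c = 0 := by
    intro a b c h
    have hc : c = 0 := by
      by_contra hc
      apply hr
      rw [← Submodule.smul_mem_iff _ hc, ← neg_eq_of_add_eq_zero_right h]
      exact Submodule.neg_mem _ (Submodule.add_mem _ (Submodule.smul_mem _ _ hpm)
        (Submodule.smul_mem _ _ hq))
    rw [hc, zero_smul, add_zero] at h
    exact ⟨(LinearIndependent.pair_iff.1 hpq a b h).1, (LinearIndependent.pair_iff.1 hpq a b h).2, hc⟩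
  have hli : ∀ t : ℂ, LinearIndependent ℂ ![p, q + t • r] := by
    intro t
    rw [LinearIndependent.pair_iff]
    intro a b h
    have := hzero a b (b * t) (by rw [← h, smul_add, smul_smul, add_assoc])
    exact ⟨this.1, this.2.1⟩
  refine Set.infinite_of_injective_forall_mem (f := fun t : ℂ =>
    (⟨S.pt, Function.update S.ln j (Gr.line p (q + t • r) (hli t)), S.cam⟩ : SpaceConfig P L)) ?_ ?_
  · intro t t' h
    have h1 := congrFun (congrArg SpaceConfig.ln h) j
    simp only [Function.update_self] at h1
    have h2 : q + t • r ∈ Submodule.span ℂ {p, q + t' • r} := by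
      change q + t • r ∈ (Gr.line p (q + t' • r) (hli t')).1
      rw [← h1]
      exact Submodule.mem_span_of_mem (by simp)
    obtain ⟨a, b, hab⟩ := Submodule.mem_span_pair.1 h2
    have h3 := hzero a (b - 1) (b * t' - t) (by
      rw [← sub_eq_zero] at hab
      rw [← hab]
      module)
    rw [sub_eq_zero.1 h3.2.1, one_mul] at h3
    exact (sub_eq_zero.1 h3.2.2).symm
  · intro t
    refine ⟨fun i j' hij => ?_, hS.2.1, fun v j' => ?_⟩
    · by_cases hj : j' = j
      · subst hj
        simp only [Function.update_self]
        rw [hpi i hij]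
        exact (Submodule.span_singleton_le_iff_mem _ _).2 (Submodule.mem_span_of_mem (by simp))
      · simpa [hj] using hS.1 i j' hij
    · by_cases hj : (j' : L) = j
      · rw [← hS.2.2 v j']
        simp only [hj, Function.update_self]
        rw [hln]
        change (Submodule.span ℂ {p, q + t • r}).map _ = _
        rw [Submodule.map_span, Submodule.map_span, Set.image_pair, Set.image_pair,
          map_add, map_smul, hv v (hj ▸ j'.2), smul_zero, add_zero]
      · simpa [hj] using hS.2.2 v j'

theorem exists_mem_imageVariety (Q : PL1P P L) [Finite P] [Finite L] :
    Q.imageVariety.Nonempty := by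
  obtain ⟨S, hS, hg⟩ := Q.exists_isGeneral
  exact ⟨Q.mixedImage (fun _ => S) (fun v i => hg.center_notMem_pt v i)
    (fun v j => hg.center_notMem_ln v j), fun v i j hij => Submodule.map_mono (hS i j hij)⟩

theorem _root_.ForGeneric.exists_mem {T : Type*} [TopologicalSpace T] {V : Set T} {p : T → Prop}
    (h : ForGeneric V p) (hV : V.Nonempty) : ∃ x ∈ V, p x := by
  obtain ⟨U, -, hUd, hUp⟩ := h
  obtain ⟨x, hx⟩ := closure_nonempty_iff.1 (hV.mono hUd)
  exact ⟨x, hx.1, hUp x hx⟩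

/-- A line that is observed by at most one view moves in the plane through its image, an unobserved
point moves along its pin, and a point that is observed by one view and has no pin moves along the
ray through its image. -/
theorem isTame_of_isMinimal [Finite P] [Finite L] (h : Q.IsMinimal) : Q.IsTame := by
  obtain ⟨y, -, ⟨S, hS⟩, hfin⟩ := ForGeneric.exists_mem h Q.exists_mem_imageVariety
  have hcl : ∀ v (j : Q.seesLn v), S.cam.center v ∉ (S.ln j).1 := fun v j =>
    S.cam.center_notMem_of_finrank_map (by rw [hS.2.2 v j, (y.ln v j).2, (S.ln j).2])
  have hcp : ∀ v (i : Q.seesPt v), S.cam.center v ∉ (S.pt i).1 := fun v i =>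
    S.cam.center_notMem_of_finrank_map (by rw [hS.2.1 v i, (y.pt v i).2, (S.pt i).2])
  have hnotMem : ∀ {k} (W : Gr k 4), k < 4 → ∃ r, r ∉ W.1 := by
    intro k W hk
    by_contra! hW
    have := W.2
    rw [Submodule.eq_top_iff'.2 hW, finrank_top, Module.finrank_fin_fun] at this
    omega
  have hln : ∀ j, ∃ v w, v ≠ w ∧ j ∈ Q.seesLn v ∧ j ∈ Q.seesLn w := by
    intro j
    by_contra! hj
    obtain ⟨r, hr, hrv⟩ : ∃ r, r ∉ (S.ln j).1 ∧ ∀ v, j ∈ Q.seesLn v → S.cam.proj v r = 0 := by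
      by_cases h : ∃ v, j ∈ Q.seesLn v
      · obtain ⟨v, hv⟩ := h
        refine ⟨S.cam.center v, hcl v ⟨j, hv⟩, fun w hw => ?_⟩
        rw [show w = v from by_contra fun hwv => hj w v hwv hw hv, S.cam.proj_center]
      · obtain ⟨r, hr⟩ := hnotMem (S.ln j) (by norm_num)
        exact ⟨r, hr, fun v hv => (h ⟨v, hv⟩).elim⟩
    exact infinite_solutions_of_ln hS hr hrv hfin
  refine ⟨hln, fun i => ?_, fun i hi => ?_⟩
  · by_contra! hi
    obtain ⟨r, hr, hrj⟩ : ∃ r, r ∉ (S.pt i).1 ∧ ∀ j, Q.inc i j → r ∈ (S.ln j).1 := by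
      by_cases h : ∃ j, Q.inc i j
      · obtain ⟨j, hj⟩ := h
        have : ¬ (S.ln j).1 ≤ (S.pt i).1 := by
          intro hle
          have := Submodule.finrank_mono hle
          rw [(S.ln j).2, (S.pt i).2] at this
          omega
        obtain ⟨r, hr, hri⟩ := SetLike.not_le_iff_exists.1 this
        refine ⟨r, hri, fun j' hj' => ?_⟩
        by_cases hjj : j = j'
        · rwa [← hjj]
        -- two of three views see each of the pins, so that one of them sees both
        obtain ⟨v, w, hvw, hv, hw⟩ := hln j
        obtain ⟨v', w', hvw', hv', hw'⟩ := hln j'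
        have hcommon : ∃ u, j ∈ Q.seesLn u ∧ j' ∈ Q.seesLn u := by
          rcases (by decide : ∀ v w v' w' : Fin 3, v ≠ w → v' ≠ w' →
            v = v' ∨ v = w' ∨ w = v' ∨ w = w') v w v' w' hvw hvw' with rfl | rfl | rfl | rfl
          exacts [⟨_, hv, hv'⟩, ⟨_, hv, hw'⟩, ⟨_, hw, hv'⟩, ⟨_, hw, hw'⟩]
        obtain ⟨u, hu, hu'⟩ := hcommon
        exact (hi u (Q.sees_meet u i j j' hjj hj hj' hu hu')).elim
      · obtain ⟨r, hr⟩ := hnotMem (S.pt i) (by norm_num)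
        exact ⟨r, hr, fun j hj => (h ⟨j, hj⟩).elim⟩
    exact infinite_solutions_of_pt hS hr hrj (fun v hv => (hi v hv).elim) hfin
  · by_contra! hj
    obtain ⟨v, hv, huniq⟩ := hi
    refine infinite_solutions_of_pt hS (hcp v ⟨i, hv⟩) (fun j hij => (hj j hij).elim)
      (fun w hw => ?_) hfin
    rw [huniq w hw, S.cam.proj_center]

theorem IsTame.seenInExactlyTwoViews (h : Q.IsTame) {j : L} (hj : ¬ ∀ v, j ∈ Q.seesLn v) :
    Q.SeenInExactlyTwoViews j := by
  obtain ⟨v, w, hvw, hv, hw⟩ := h.exists_seesLn j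
  refine Set.ncard_eq_two.2 ⟨v, w, hvw, Set.ext fun u => ⟨fun hu => ?_, ?_⟩⟩
  · by_contra huvw
    refine hj fun x => ?_
    rcases (by decide : ∀ v w u x : Fin 3, v ≠ w → ¬ (u = v ∨ u = w) → x = v ∨ x = w ∨ x = u)
      v w u x hvw huvw with rfl | rfl | rfl
    exacts [hv, hw, hu]
  · rintro (rfl | rfl)
    exacts [hv, hw]

/-- Under the necessary conditions for minimality, only points and lines of the four kinds can be
forgotten. -/
theorem IsTame.isRemovable_of_isReducibleTo [Finite P] [Finite L] (h : Q.IsTame)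
    (hred : Q.IsReducibleTo K M) : Q.IsRemovable K M := by
  have hKM := hred.1
  obtain ⟨S', hS', hg, hlift⟩ := hred.exists_hasLiftsNear
  have hpt : ∀ i ∉ K, Q.IsOneViewPointOnFullPin i ∨ ∃ j, Q.IsOneViewPointWithTwoViewPin i j := by
    intro i hi
    obtain ⟨v, hv⟩ := h.exists_seesPt i
    have hex : ∃! v, i ∈ Q.seesPt v :=
      ⟨v, hv, fun w hw => HasLiftsNear.eq_of_seesPt hKM hS' hg hlift hi hw hv⟩
    have huniq : ∀ w, i ∈ Q.seesPt w → w = v := fun w hw => hex.unique hw hv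
    obtain ⟨j, hij⟩ := h.exists_inc i hex
    have hsingle : Q.IsSinglePin i j := by
      refine fun j' => ⟨fun hij' => ?_, fun hj => hj ▸ hij⟩
      by_contra hne
      -- only `v` can see both pins, so that each of the other views sees exactly one of them
      have hmeet : ∀ u, j ∈ Q.seesLn u → j' ∈ Q.seesLn u → u = v := fun u hu hu' =>
        huniq u (Q.sees_meet u i j' j hne hij' hij hu' hu)
      have hother : ∀ j, ∃ w, w ≠ v ∧ j ∈ Q.seesLn w := by
        intro j
        obtain ⟨a, b, hab, ha, hb⟩ := h.exists_seesLn j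
        by_cases hav : a = v
        · exact ⟨b, fun hbv => hab (hav.trans hbv.symm), hb⟩
        · exact ⟨a, hav, ha⟩
      obtain ⟨w, hwv, hw⟩ := hother j
      obtain ⟨u, huv, hu⟩ := hother j'
      have hwu : w ≠ u := fun hwu => hwv (hmeet w hw (hwu ▸ hu))
      have hj := HasLiftsNear.mem_of_two_pins hKM hS' hg hlift huv.symm hwv.symm hwu hv
        (fun hiw => hwv (huniq w hiw)) hij hij' hw hu
      have hj' := HasLiftsNear.mem_of_two_pins hKM hS' hg hlift hwv.symm huv.symm hwu.symm hv
        (fun hiu => huv (huniq u hiu)) hij' hij hu hw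
      exact hne (hKM i hi j' hj' j hj hij' hij)
    by_cases hall : ∀ v, j ∈ Q.seesLn v
    · exact .inl ⟨j, hsingle, hex, hall⟩
    · refine .inr ⟨j, hsingle, hex, fun v' hv' => ?_, h.seenInExactlyTwoViews hall⟩
      rw [huniq v' hv']
      by_contra hjv
      obtain ⟨w, u, hwu, hw, hu⟩ := h.exists_seesLn j
      obtain ⟨j', hij', hj'⟩ := HasLiftsNear.exists_seesLn hKM hS' hg hlift hi hwu
        (fun hvw : v = w => hjv (hvw ▸ hw)) (fun hvu : v = u => hjv (hvu ▸ hu)) hv hij hw hu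
      exact hjv ((hsingle j').1 hij' ▸ hj')
  refine ⟨hpt, fun j hj => ?_⟩
  have hall := HasLiftsNear.not_forall_seesLn hKM hS' hg hlift hj
  have htwo := h.seenInExactlyTwoViews hall
  by_cases hfree : ∃ i, Q.inc i j
  · obtain ⟨i, hij⟩ := hfree
    by_cases hi : i ∈ K
    · exact .inl ⟨htwo, i, hij, fun v hv =>
        HasLiftsNear.seesPt_of_seesLn hKM hS' hg hlift hi hj hij hv⟩
    · rcases hpt i hi with ⟨j', hj', -, hall'⟩ | ⟨j', hj'⟩
      · rw [(hj' j).1 hij] at hall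
        exact (hall hall').elim
      · rw [← (hj'.1 j).1 hij] at hj'
        exact .inr (.inr ⟨i, hi, hj'⟩)
  · exact .inr (.inl ⟨htwo, fun i hi => hfree ⟨i, hi⟩⟩)

end PL1P

/-! ### The unique reduced problem -/

namespace PL1P

variable {P L : Type*} {Q : PL1P P L} {K : Set P} {M : Set L}

/-- A pin of a kept point that is observed in only one view is not removable. -/
theorem IsRemovable.mem_of_inc (h : Q.IsRemovable K M) {i : P} (hi : i ∈ K)
    (hv : ∃! v, i ∈ Q.seesPt v) {j : L} (hij : Q.inc i j) : j ∈ M := by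
  by_contra hj
  obtain ⟨v, w, hvw, hjv, hjw, -⟩ := h.exists_views hj
  exact hvw (hv.unique (h.seesPt_of_seesLn hi hj hij hjv) (h.seesPt_of_seesLn hi hj hij hjw))

theorem IsRemovable.isSinglePin_forget_iff (h : Q.IsRemovable K M) {i : K}
    (hv : ∃! v, (i : P) ∈ Q.seesPt v) {j : M} :
    (Q.forget K M).IsSinglePin i j ↔ Q.IsSinglePin i j := by
  refine ⟨fun hj j' => ⟨fun hij' => ?_, ?_⟩, fun hj j' => (hj j').trans Subtype.ext_iff.symm⟩
  · exact congrArg Subtype.val ((hj ⟨j', h.mem_of_inc i.2 hv hij'⟩).1 hij')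
  · rintro rfl
    exact (hj j).2 rfl

theorem IsRemovable.isOneViewPointOnFullPin_forget_iff (h : Q.IsRemovable K M) {i : K} :
    (Q.forget K M).IsOneViewPointOnFullPin i ↔ Q.IsOneViewPointOnFullPin i := by
  constructor
  · rintro ⟨j, hj, hv, hall⟩
    exact ⟨j, (h.isSinglePin_forget_iff hv).1 hj, hv, hall⟩
  · rintro ⟨j, hj, hv, hall⟩
    exact ⟨⟨j, h.mem_of_inc i.2 hv ((hj j).2 rfl)⟩, (h.isSinglePin_forget_iff hv).2 hj, hv, hall⟩

theorem IsRemovable.isOneViewPointWithTwoViewPin_forget_iff (h : Q.IsRemovable K M) {i : K}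
    {j : M} : (Q.forget K M).IsOneViewPointWithTwoViewPin i j ↔
      Q.IsOneViewPointWithTwoViewPin i j := by
  constructor
  · rintro ⟨hj, hv, h'⟩
    exact ⟨(h.isSinglePin_forget_iff hv).1 hj, hv, h'⟩
  · rintro ⟨hj, hv, h'⟩
    exact ⟨(h.isSinglePin_forget_iff hv).2 hj, hv, h'⟩

theorem IsTame.forget (h : Q.IsTame) (hr : Q.IsRemovable K M) : (Q.forget K M).IsTame where
  exists_seesLn j := h.exists_seesLn j
  exists_seesPt i := h.exists_seesPt i
  exists_inc i hv := by
    obtain ⟨j, hij⟩ := h.exists_inc i hv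
    exact ⟨⟨j, hr.mem_of_inc i.2 hv hij⟩, hij⟩

/-- The points that are not of the kinds that can be forgotten. -/
def coreKeptPoints (Q : PL1P P L) : Set P :=
  {i | ¬ (Q.IsOneViewPointOnFullPin i ∨ ∃ j, Q.IsOneViewPointWithTwoViewPin i j)}

/-- The lines that are not of the kinds that can be forgotten. -/
def coreKeptLines (Q : PL1P P L) : Set L :=
  {j | ¬ (Q.IsTwoViewPin j ∨ Q.IsTwoViewFreeLine j ∨ ∃ i, Q.IsOneViewPointWithTwoViewPin i j)}

theorem isRemovable_core (Q : PL1P P L) : Q.IsRemovable Q.coreKeptPoints Q.coreKeptLines where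
  pt _ hi := not_not.1 hi
  ln _ hj := by
    rcases not_not.1 hj with h | h | ⟨i, h⟩
    exacts [.inl h, .inr (.inl h), .inr (.inr ⟨i, fun hi => hi (.inr ⟨_, h⟩), h⟩)]

/-- The points and lines of the remaining problem that can be forgotten could have been forgotten in
the given problem. -/
theorem IsTame.isReduced_core [Finite P] [Finite L] (h : Q.IsTame) :
    (Q.forget Q.coreKeptPoints Q.coreKeptLines).IsReduced := by
  intro K M hKM
  have hr := Q.isRemovable_core
  replace hKM := (h.forget hr).isRemovable_of_isReducibleTo hKM
  constructor
  · refine Set.eq_univ_of_forall fun i => by_contra fun hi => i.2 ?_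
    rcases hKM.pt i hi with h | ⟨j, h⟩
    exacts [.inl (hr.isOneViewPointOnFullPin_forget_iff.1 h),
      .inr ⟨j, hr.isOneViewPointWithTwoViewPin_forget_iff.1 h⟩]
  · refine Set.eq_univ_of_forall fun j => by_contra fun hj => j.2 ?_
    rcases hKM.ln j hj with ⟨h, i, hij, hv⟩ | ⟨h, hfree⟩ | ⟨i, -, h⟩
    · exact .inl ⟨h, i, hij, hv⟩
    · refine .inr (.inl ⟨h, fun i hij => ?_⟩)
      have hi : i ∉ Q.coreKeptPoints := fun hi => hfree ⟨i, hi⟩ hij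
      rcases not_not.1 hi with ⟨j', hj', -, hall⟩ | ⟨j', hj'⟩
      · obtain ⟨v, w, -, hset⟩ := Set.ncard_eq_two.1 h
        have hv : ∀ u : Fin 3, u ∈ ({v, w} : Set (Fin 3)) := fun u => by
          rw [← hset]
          change (j : L) ∈ Q.seesLn u
          rw [(hj' j).1 hij]
          exact hall u
        have : ∀ v w : Fin 3, ∃ u, ¬ (u = v ∨ u = w) := by decide
        obtain ⟨u, hu⟩ := this v w
        exact hu (hv u)
      · exact j.2 (.inr (.inr ⟨i, ((hj'.1 j).1 hij).symm ▸ hj'⟩))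
    · exact .inr (.inr ⟨i, hr.isOneViewPointWithTwoViewPin_forget_iff.1 h⟩)

/-- If fewer points and lines are forgotten, then the remaining ones can still be forgotten, one at a
time. -/
theorem IsRemovable.eq_core [Finite P] [Finite L] (h : Q.IsRemovable K M)
    (hred : (Q.forget K M).IsReduced) : K = Q.coreKeptPoints ∧ M = Q.coreKeptLines := by
  have hpt : K = Q.coreKeptPoints := by
    refine Set.Subset.antisymm (fun i hi hi' => ?_) fun i hi => by_contra fun hiK => hi (h.pt i hiK)
    have hr : (Q.forget K M).IsRemovable {⟨i, hi⟩}ᶜ Set.univ := by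
      refine ⟨fun i' hi'' => ?_, fun j hj => (hj trivial).elim⟩
      rw [Set.notMem_compl_iff, Set.mem_singleton_iff] at hi''
      rw [hi'']
      rcases hi' with h' | ⟨j, h'⟩
      · exact .inl (h.isOneViewPointOnFullPin_forget_iff.2 h')
      · exact .inr ⟨⟨j, h.mem_of_inc hi h'.2.1 ((h'.1 j).2 rfl)⟩,
          h.isOneViewPointWithTwoViewPin_forget_iff.2 h'⟩
    have := (hred _ _ hr.isReducibleTo).1.ge (Set.mem_univ ⟨i, hi⟩)
    exact this rfl
  refine ⟨hpt, Set.Subset.antisymm (fun j hj hj' => ?_) fun j hj => by_contra fun hjM => hj ?_⟩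
  · have hr : (Q.forget K M).IsRemovable Set.univ {⟨j, hj⟩}ᶜ := by
      refine ⟨fun i hi => (hi trivial).elim, fun j' hj'' => ?_⟩
      rw [Set.notMem_compl_iff, Set.mem_singleton_iff] at hj''
      rw [hj'']
      have htwo : Q.SeenInExactlyTwoViews j := by
        rcases hj' with h' | h' | ⟨i, h'⟩
        exacts [h'.1, h'.1, h'.2.2.2]
      -- a pin whose point has been forgotten is a free line now
      by_cases hfree : ∃ i ∈ K, Q.inc i j
      · obtain ⟨i, hi, hij⟩ := hfree
        rcases hj' with ⟨-, i', hij', hv⟩ | ⟨-, h'⟩ | ⟨i', h'⟩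
        · refine .inl ⟨htwo, ⟨i, hi⟩, hij, fun v hjv => ?_⟩
          change i ∈ Q.seesPt v
          rw [Q.at_most_one _ _ _ hij hij']
          exact hv v hjv
        · exact (h' i hij).elim
        · rw [hpt] at hi
          rw [← Q.at_most_one _ _ _ hij ((h'.1 j).2 rfl)] at h'
          exact (hi (.inr ⟨j, h'⟩)).elim
      · exact .inr (.inl ⟨htwo, fun i hij => hfree ⟨i, i.2, hij⟩⟩)
    have := (hred _ _ hr.isReducibleTo).2.ge (Set.mem_univ ⟨j, hj⟩)
    exact this rfl
  · rcases h.ln j hjM with h' | h' | ⟨i, -, h'⟩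
    exacts [.inl h', .inr (.inl h'), .inr (.inr ⟨i, h'⟩)]

end PL1P

/-! ### Polynomial conditions on generic images -/

instance SpaceVar.instFinite {P L : Type*} [Finite P] [Finite L] : Finite (SpaceVar P L) := by
  refine Finite.of_surjective (α := (P × Fin 1 × Fin 4) ⊕ (L × Fin 2 × Fin 4) ⊕
    (Fin 3 × Fin 3 × Fin 3) ⊕ (Fin 3 × Fin 3)) (fun
    | .inl k => .pt k.1 k.2.1 k.2.2
    | .inr (.inl k) => .ln k.1 k.2.1 k.2.2
    | .inr (.inr (.inl k)) => .rot k.1 k.2.1 k.2.2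
    | .inr (.inr (.inr k)) => .trans k.1 k.2) ?_
  rintro (⟨i, s, a⟩ | ⟨j, s, a⟩ | ⟨v, a, b⟩ | ⟨v, a⟩)
  exacts [⟨.inl (i, s, a), rfl⟩, ⟨.inr (.inl (j, s, a)), rfl⟩, ⟨.inr (.inr (.inl (v, a, b))), rfl⟩,
    ⟨.inr (.inr (.inr (v, a))), rfl⟩]

instance ImageVar.instFinite {P L : Type*} [Finite P] [Finite L] (Q : PointLineProblem P L) :
    Finite (ImageVar Q) := by
  refine Finite.of_surjective (α := ((v : Fin 3) × Q.seesPt v × Fin 1 × Fin 3) ⊕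
    ((v : Fin 3) × Q.seesLn v × Fin 2 × Fin 3)) (fun
    | .inl k => .pt k.1 k.2.1 k.2.2.1 k.2.2.2
    | .inr k => .ln k.1 k.2.1 k.2.2.1 k.2.2.2) ?_
  rintro (⟨v, i, s, a⟩ | ⟨v, j, s, a⟩)
  exacts [⟨.inl ⟨v, i, s, a⟩, rfl⟩, ⟨.inr ⟨v, j, s, a⟩, rfl⟩]

theorem IsPolyFun.exists_of_finite_values {σ τ : Type*} [Finite σ] [Finite τ]
    {F : (σ → ℂ) → τ → ℂ} (hF : ∀ k, IsPolyFun fun x => F x k) {g : (σ → ℂ) → ℂ}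
    (hg : IsPolyFun g) (hg0 : ∃ x, g x ≠ 0) {u : (τ → ℂ) → ℂ} (hu : IsPolyFun u)
    (hu0 : ∃ η, u η ≠ 0) (hfin : ∀ η, u η ≠ 0 → {z | ∃ x, F x = η ∧ g x = z}.Finite) :
    ∃ f, IsPolyFun f ∧ (∃ η, f η ≠ 0) ∧ ∀ x, g x = 0 → f (F x) = 0 := by
  choose F' hF' using hF
  obtain ⟨g', hg'⟩ := hg
  obtain ⟨u', hu'⟩ := hu
  have hFF : ∀ x, (fun k => MvPolynomial.eval x (F' k)) = F x := fun x => funext fun k => hF' k x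
  obtain ⟨f, hf, h⟩ := exists_polynomial_of_finite_values F' g'
    (by
      rintro rfl
      obtain ⟨x, hx⟩ := hg0
      exact hx (by rw [← hg', map_zero])) u'
    (by
      rintro rfl
      obtain ⟨x, hx⟩ := hu0
      exact hx (by rw [← hu', map_zero]))
    (fun η hη => by
      rw [hu'] at hη
      refine (hfin η hη).subset ?_
      rintro z ⟨x, hx, rfl⟩
      exact ⟨x, by rw [← hFF]; exact funext hx, (hg' x).symm⟩)
  refine ⟨fun η => MvPolynomial.eval η f, ⟨f, fun _ => rfl⟩, MvPolynomial.exists_eval_ne_zero hf,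
    fun x hx => ?_⟩
  change MvPolynomial.eval (F x) f = 0
  rw [← hFF]
  exact h x (by rw [hg', hx])

namespace PL1P

variable {P L : Type*} (Q : PL1P P L) (K : Set P) (M : Set L)

open Classical in
/-- Replace the values of those variables which do not occur in the chart of the image variety. -/
def replaceUnused (d c : ImageVar Q.toPointLineProblem → ℂ) : ImageVar Q.toPointLineProblem → ℂ
  | .pt v i s a => c (.pt v i s a)
  | .ln v j s a =>
    if s = 0 ∧ ∃ i : Q.seesPt v, Q.inc i j then d (.ln v j s a) else c (.ln v j s a)

variable {Q} in
theorem imageChart_ln_of_not {v : Fin 3} {j : Q.seesLn v} {s : Fin 2}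
    (h : ¬ (s = 0 ∧ ∃ i : Q.seesPt v, Q.inc i j)) (c : ImageVar Q.toPointLineProblem → ℂ)
    (a : Fin 3) : Q.imageChart c (.ln v j s a) = c (.ln v j s a) := by
  have hs : s = 0 ∨ s = 1 := by omega
  rcases hs with rfl | rfl
  · exact imageChart_ln_of_forall_not_inc (fun i hi => h ⟨rfl, i, hi⟩) c a
  · simp [imageChart]

theorem imageChart_replaceUnused (d c : ImageVar Q.toPointLineProblem → ℂ) :
    Q.imageChart (Q.replaceUnused d c) = Q.imageChart c := by
  ext (⟨v, i, s, a⟩ | ⟨v, j, s, a⟩)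
  · rfl
  · by_cases h : s = 0 ∧ ∃ i : Q.seesPt v, Q.inc i j
    · obtain ⟨rfl, i, hi⟩ := h
      rw [imageChart_ln_of_inc hi, imageChart_ln_of_inc hi]
      rfl
    · rw [imageChart_ln_of_not h, imageChart_ln_of_not h, replaceUnused, if_neg h]

theorem replaceUnused_imageChart (d : ImageVar Q.toPointLineProblem → ℂ) :
    Q.replaceUnused d (Q.imageChart d) = d := by
  ext (⟨v, i, s, a⟩ | ⟨v, j, s, a⟩)
  · rfl
  · by_cases h : s = 0 ∧ ∃ i : Q.seesPt v, Q.inc i j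
    · rw [replaceUnused, if_pos h]
    · rw [replaceUnused, if_neg h, imageChart_ln_of_not h]

/-- A nonzero polynomial does not vanish on a generic image, in the variables of the chart. -/
theorem forGeneric_exists_ne_zero [Finite P] [Finite L] {f : (ImageVar Q.toPointLineProblem → ℂ) → ℂ}
    (hf : IsPolyFun f) (hf0 : ∃ s, f s ≠ 0) :
    ForGeneric Q.imageVariety fun y => ∃ s, y.IsCoord (Q.imageChart s) ∧ f s ≠ 0 := by
  have := Fintype.ofFinite P
  have := Fintype.ofFinite L
  have := fun v => Fintype.ofFinite (Q.seesPt v)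
  have := fun v => Fintype.ofFinite (Q.seesLn v)
  obtain ⟨y₀, hy₀⟩ := Q.exists_mem_imageVariety
  obtain ⟨s₀, hs₀⟩ := (Q.mem_imageVariety_iff y₀).1 hy₀
  obtain ⟨u, hu, hus, huy⟩ := Q.isPolyChart_imageChart.exists_isPolyFun_of_isOpen
    (fun _ _ _ h h' => h.eq h') (U := Set.univ) (@isOpen_univ _ (ImageConfig.instTopologicalSpace _))
    hs₀ trivial
  obtain ⟨s₁, hfs₁, hus₁⟩ := hf.exists_ne_zero_and_ne_zero hu hf0 ⟨_, hus⟩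
  obtain ⟨y₁, -, hy₁⟩ := huy s₁ hus₁
  have hli : ∀ v (i : Q.seesPt v) (j : Q.seesLn v), ∃ h, IsPolyFun h ∧ h (Q.imageChart s₁) ≠ 0 ∧
      ∀ c, h c ≠ 0 → Q.inc i j →
        LinearIndependent ℂ ![fun a => c (.pt v i 0 a), fun a => c (.ln v j 1 a)] := by
    intro v i j
    by_cases hij : Q.inc i j
    · obtain ⟨h, hh, h1, h2⟩ := exists_isPolyFun_of_linearIndependent
        (b := fun c : ImageVar Q.toPointLineProblem → ℂ =>
          ![fun a => c (.pt v i 0 a), fun a => c (.ln v j 1 a)]) (x₁ := Q.imageChart s₁)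
        (by intro s a; fin_cases s <;> exact .coord _) (by
          have h3 := (hy₁.2 v j).linearIndependent
          rw [← linearIndependent_pair_eta] at h3
          convert h3 using 3
          exact (imageChart_ln_of_inc hij s₁ _).symm)
      exact ⟨h, hh, h1, fun c hc _ => h2 c hc⟩
    · exact ⟨fun _ => 1, .const _, one_ne_zero, fun _ _ h => (hij h).elim⟩
  choose h hh h1 hli using hli
  have hpoly : IsPolyFun fun c => (∏ v, ∏ i, ∏ j, h v i j c) * f (Q.replaceUnused s₁ c) := by
    refine .mul (.prod _ fun v => .prod _ fun i => .prod _ fun j => hh v i j) (hf.comp ?_)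
    rintro (⟨v, i, s, a⟩ | ⟨v, j, s, a⟩)
    · exact .coord _
    · by_cases hd : s = 0 ∧ ∃ i : Q.seesPt v, Q.inc i j
      · simpa only [replaceUnused, if_pos hd] using .const _
      · simpa only [replaceUnused, if_neg hd] using .coord _
  obtain ⟨F, hF⟩ := hpoly
  have hopen : IsOpen (zariskiBasicOpen (ImageConfig.IsCoord (Q := Q.toPointLineProblem)) F) :=
    TopologicalSpace.isOpen_generateFrom_of_mem ⟨F, rfl⟩
  refine ⟨zariskiBasicOpen ImageConfig.IsCoord F, hopen,
    Q.imageVariety_subset_closure hopen ⟨y₁, (Q.mem_imageVariety_iff y₁).2 ⟨s₁, hy₁⟩,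
      Q.imageChart s₁, hy₁, ?_⟩, ?_⟩
  · rw [hF]
    refine mul_ne_zero (Finset.prod_ne_zero_iff.2 fun v _ => Finset.prod_ne_zero_iff.2 fun i _ =>
      Finset.prod_ne_zero_iff.2 fun j _ => h1 v i j) ?_
    rwa [replaceUnused_imageChart]
  · rintro y ⟨hy, c, hc, hcF⟩
    rw [hF] at hcF
    refine ⟨Q.replaceUnused s₁ c, ?_, right_ne_zero_of_mul hcF⟩
    rw [imageChart_replaceUnused]
    refine isCoord_imageChart hy hc fun v i j hij => hli v i j c ?_ hij
    exact Finset.prod_ne_zero_iff.1 (Finset.prod_ne_zero_iff.1 (Finset.prod_ne_zero_iff.1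
      (left_ne_zero_of_mul hcF) v (Finset.mem_univ v)) i (Finset.mem_univ i)) j (Finset.mem_univ j)

/-! ### The projection that forgets points and lines in the images -/

/-- The inclusion of the coordinates of the points and lines that are kept. -/
def imageVarOfForget :
    ImageVar (Q.forget K M).toPointLineProblem → ImageVar Q.toPointLineProblem
  | .pt v i s a => .pt v ⟨i.1.1, i.2⟩ s a
  | .ln v j s a => .ln v ⟨j.1.1, j.2⟩ s a

theorem continuous_imageForget : Continuous (Q.imageForget K M) := by
  classical
  refine continuous_generateFrom_iff.2 ?_
  rintro _ ⟨f, rfl⟩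
  suffices h : Q.imageForget K M ⁻¹' zariskiBasicOpen ImageConfig.IsCoord f =
      zariskiBasicOpen ImageConfig.IsCoord (MvPolynomial.rename (Q.imageVarOfForget K M) f) by
    rw [h]
    exact TopologicalSpace.isOpen_generateFrom_of_mem ⟨_, rfl⟩
  ext y
  constructor
  · rintro ⟨c', hc', hf⟩
    obtain ⟨c, hc⟩ := y.exists_isCoord
    let c₁ : ImageVar Q.toPointLineProblem → ℂ
      | .pt v i s a => if h : (i : P) ∈ K then c' (.pt v ⟨⟨i, h⟩, i.2⟩ s a) else c (.pt v i s a)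
      | .ln v j s a => if h : (j : L) ∈ M then c' (.ln v ⟨⟨j, h⟩, j.2⟩ s a) else c (.ln v j s a)
    refine ⟨c₁, ⟨fun v i => ?_, fun v j => ?_⟩, ?_⟩
    · by_cases h : (i : P) ∈ K
      · simp only [c₁, dif_pos h]
        exact hc'.1 v ⟨⟨i, h⟩, i.2⟩
      · simpa only [c₁, dif_neg h] using hc.1 v i
    · by_cases h : (j : L) ∈ M
      · simp only [c₁, dif_pos h]
        exact hc'.2 v ⟨⟨j, h⟩, j.2⟩
      · simpa only [c₁, dif_neg h] using hc.2 v j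
    · rw [MvPolynomial.eval_rename]
      convert hf using 2
      congr 1
      ext (⟨v, i, s, a⟩ | ⟨v, j, s, a⟩)
      · exact dif_pos i.1.2
      · exact dif_pos j.1.2
  · rintro ⟨c, hc, hf⟩
    rw [MvPolynomial.eval_rename] at hf
    exact ⟨c ∘ Q.imageVarOfForget K M, ⟨fun v i => hc.1 v ⟨i.1.1, i.2⟩,
      fun v j => hc.2 v ⟨j.1.1, j.2⟩⟩, hf⟩

variable {Q K M}

/-- The projection between the image varieties is surjective. -/
theorem exists_imageForget_eq
    (hKM : ∀ i ∉ K, ∀ j ∈ M, ∀ j' ∈ M, Q.inc i j → Q.inc i j' → j = j')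
    {y' : ImageConfig (Q.forget K M).toPointLineProblem} (hy' : y' ∈ (Q.forget K M).imageVariety) :
    ∃ y ∈ Q.imageVariety, Q.imageForget K M y = y' := by
  have hle : ∀ l : Gr 2 3, ∃ p : Gr 1 3, p.1 ≤ l.1 := fun l => by
    obtain ⟨b, hb⟩ := l.exists_isFrame
    exact ⟨Gr.point (b 0) (hb.linearIndependent.ne_zero 0),
      (Submodule.span_singleton_le_iff_mem _ _).2 (hb.mem 0)⟩
  have hge : ∀ p : Gr 1 3, ∃ l : Gr 2 3, p.1 ≤ l.1 := fun p => by
    obtain ⟨x, hx0, hx⟩ := p.exists_eq_span_singleton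
    obtain ⟨q, hq⟩ : ∃ q, q ∉ p.1 := by
      by_contra! h
      have := p.2
      rw [Submodule.eq_top_iff'.2 h, finrank_top, Module.finrank_fin_fun] at this
      omega
    refine ⟨Gr.line x q ((LinearIndependent.pair_iff' hx0).2 fun a ha => hq ?_), ?_⟩
    · rw [hx, ← ha]
      exact Submodule.smul_mem _ _ (Submodule.mem_span_singleton_self x)
    · exact hx.le.trans ((Submodule.span_singleton_le_iff_mem _ _).2
        (Submodule.mem_span_of_mem (by simp)))
  have hl₀ : Nonempty (Gr 2 3) :=
    ⟨Gr.ofLinearIndependent (fun s : Fin 2 => Pi.basisFun ℂ (Fin 3) s.castSucc)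
      ((Pi.basisFun ℂ (Fin 3)).linearIndependent.comp _ (Fin.castSucc_injective 2))⟩
  obtain ⟨l₀⟩ := hl₀
  have hp : ∀ v (i : Q.seesPt v), ∃ p : Gr 1 3,
      (∀ hi : (i : P) ∈ K, p = y'.pt v ⟨⟨i, hi⟩, i.2⟩) ∧
      ∀ (j : L) (hj : j ∈ M) (hjv : j ∈ Q.seesLn v), Q.inc i j →
        p.1 ≤ (y'.ln v ⟨⟨j, hj⟩, hjv⟩).1 := by
    intro v i
    by_cases hi : (i : P) ∈ K
    · exact ⟨_, fun _ => rfl, fun j hj hjv hij =>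
        hy' v ⟨⟨i, hi⟩, i.2⟩ ⟨⟨j, hj⟩, hjv⟩ hij⟩
    · by_cases h : ∃ j : L, ∃ hj : j ∈ M, ∃ hjv : j ∈ Q.seesLn v, Q.inc i j
      · obtain ⟨j, hj, hjv, hij⟩ := h
        obtain ⟨p, hp⟩ := hle (y'.ln v ⟨⟨j, hj⟩, hjv⟩)
        refine ⟨p, fun h => (hi h).elim, fun j' hj' hjv' hij' => ?_⟩
        obtain rfl := hKM i hi j hj j' hj' hij hij'
        exact hp
      · obtain ⟨p, -⟩ := hle l₀
        exact ⟨p, fun h => (hi h).elim, fun j hj hjv hij => (h ⟨j, hj, hjv, hij⟩).elim⟩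
  choose p hpK hpM using hp
  have hl : ∀ v (j : Q.seesLn v), ∃ l : Gr 2 3,
      (∀ hj : (j : L) ∈ M, l = y'.ln v ⟨⟨j, hj⟩, j.2⟩) ∧
      ∀ i : Q.seesPt v, Q.inc i j → (p v i).1 ≤ l.1 := by
    intro v j
    by_cases hj : (j : L) ∈ M
    · exact ⟨_, fun _ => rfl, fun i hij => hpM v i j hj j.2 hij⟩
    · by_cases h : ∃ i : Q.seesPt v, Q.inc i j
      · obtain ⟨i, hij⟩ := h
        obtain ⟨l, hl⟩ := hge (p v i)
        refine ⟨l, fun h => (hj h).elim, fun i' hij' => ?_⟩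
        obtain rfl : i = i' := Subtype.ext (Q.at_most_one _ _ _ hij hij')
        exact hl
      · exact ⟨l₀, fun h => (hj h).elim, fun i hij => (h ⟨i, hij⟩).elim⟩
  choose l hlM hlp using hl
  refine ⟨⟨p, l⟩, fun v i j hij => hlp v j i hij, ?_⟩
  ext1
  · exact funext fun v => funext fun i => hpK v ⟨i.1.1, i.2⟩ i.1.2
  · exact funext fun v => funext fun j => hlM v ⟨j.1.1, j.2⟩ j.1.2

end PL1P

/-! ### Solutions over generic images avoid the epipoles -/

/-- A family of `k ≤ n` vectors, extended by zero vectors. -/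
def padded {V : Type*} [Zero V] {k n : ℕ} (b : Fin k → V) (t : Fin n) : V :=
  if h : (t : ℕ) < k then b ⟨t, h⟩ else 0

theorem span_padded {V : Type*} [AddCommGroup V] [Module ℂ V] {k n : ℕ} (hkn : k ≤ n)
    (b : Fin k → V) : Submodule.span ℂ (Set.range (padded (n := n) b)) =
      Submodule.span ℂ (Set.range b) := by
  apply le_antisymm
  · rw [Submodule.span_le]
    rintro _ ⟨t, rfl⟩
    rw [padded]
    split_ifs with h
    · exact Submodule.subset_span ⟨_, rfl⟩
    · exact Submodule.zero_mem _
  · rw [Submodule.span_le]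
    rintro _ ⟨t, rfl⟩
    refine Submodule.subset_span ⟨⟨t, t.2.trans_le hkn⟩, ?_⟩
    rw [padded, dif_pos t.2]

namespace PL1P

variable {P L : Type*} (Q : PL1P P L) (K : Set P) (M : Set L)

/-- The basis of a point that is given by the chart of the space variety. -/
def ptFrame (x : SpaceVar P L → ℂ) (i : P) (s : Fin 1) (a : Fin 4) : ℂ :=
  Q.spaceChart x (.pt i s a)

/-- The basis of a line that is given by the chart of the space variety. -/
def lnFrame (x : SpaceVar P L → ℂ) (j : L) (s : Fin 2) (a : Fin 4) : ℂ :=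
  Q.spaceChart x (.ln j s a)

open Classical in
/-- Generators of a subspace in which the image of the point `i` in view `v` has to lie, if the kept
points and lines and the cameras have the coordinates `x`: for a kept point this is its image, for a
forgotten point with an observed kept pin it is the image of this pin. -/
def ptGens (x : SpaceVar K M → ℂ) (v : Fin 3) (i : P) : Fin 3 → Fin 3 → ℂ :=
  if hi : i ∈ K then
    padded fun s => (cameraOfVars x).proj v ((Q.forget K M).ptFrame x ⟨i, hi⟩ s)
  else if h : ∃ j : M, (j : L) ∈ Q.seesLn v ∧ Q.inc i j then
    padded fun s => (cameraOfVars x).proj v ((Q.forget K M).lnFrame x h.choose s)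
  else fun t => Pi.basisFun ℂ (Fin 3) t

open Classical in
/-- Generators of a subspace in which the vector with number `s` of the basis of the image of the
line `j` in view `v` has to lie, if the kept points and lines and the cameras have the coordinates
`x`. -/
def lnGens (x : SpaceVar K M → ℂ) (v : Fin 3) (j : L) (s : Fin 2) : Fin 3 → Fin 3 → ℂ :=
  if h : j ∈ M ∧ ¬ (s = 0 ∧ ∃ i : Q.seesPt v, Q.inc i j) then
    padded fun s => (cameraOfVars x).proj v ((Q.forget K M).lnFrame x ⟨j, h.1⟩ s)
  else fun t => Pi.basisFun ℂ (Fin 3) t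

/-- The images of kept points and lines with given coordinates, depending on the coefficients with
respect to the generators `ptGens` and `lnGens`. -/
def imageOfVars (x : SpaceVar K M ⊕ ImageVar Q.toPointLineProblem → ℂ) :
    ImageVar Q.toPointLineProblem → ℂ
  | .pt v i s a => ∑ t, x (.inr (.pt v i s t)) * Q.ptGens K M (x ∘ Sum.inl) v i t a
  | .ln v j s a => ∑ t, x (.inr (.ln v j s t)) * Q.lnGens K M (x ∘ Sum.inl) v j s t a

variable {Q K M}

theorem span_proj {k : ℕ} (hk : k ≤ 3) (C : CameraConfig) (v : Fin 3) (b : Fin k → Fin 4 → ℂ) :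
    Submodule.span ℂ (Set.range (padded (n := 3) fun s => C.proj v (b s))) =
      (Submodule.span ℂ (Set.range b)).map (C.proj v) := by
  rw [span_padded hk, Submodule.map_span, ← Set.range_comp]
  rfl

variable {x : SpaceVar K M → ℂ} {v : Fin 3}

theorem span_ptGens_of_mem {i : P} (hi : i ∈ K) :
    Submodule.span ℂ (Set.range (Q.ptGens K M x v i)) =
      (Submodule.span ℂ (Set.range ((Q.forget K M).ptFrame x ⟨i, hi⟩))).map
        ((cameraOfVars x).proj v) := by
  rw [ptGens, dif_pos hi, span_proj (by norm_num)]

theorem span_ptGens_of_inc (hKM : ∀ i ∉ K, ∀ j ∈ M, ∀ j' ∈ M, Q.inc i j → Q.inc i j' → j = j')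
    {i : P} (hi : i ∉ K) {j : L} (hj : j ∈ M) (hjv : j ∈ Q.seesLn v) (hij : Q.inc i j) :
    Submodule.span ℂ (Set.range (Q.ptGens K M x v i)) =
      (Submodule.span ℂ (Set.range ((Q.forget K M).lnFrame x ⟨j, hj⟩))).map
        ((cameraOfVars x).proj v) := by
  have h : ∃ j : M, (j : L) ∈ Q.seesLn v ∧ Q.inc i j := ⟨⟨j, hj⟩, hjv, hij⟩
  rw [ptGens, dif_neg hi, dif_pos h, span_proj (by norm_num)]
  have : h.choose = ⟨j, hj⟩ :=
    Subtype.ext (hKM i hi _ h.choose.2 _ hj h.choose_spec.2 hij)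
  rw [this]

theorem span_ptGens_eq_top {i : P} (hi : i ∉ K)
    (h : ∀ j ∈ M, j ∈ Q.seesLn v → ¬ Q.inc i j) :
    Submodule.span ℂ (Set.range (Q.ptGens K M x v i)) = ⊤ := by
  have h' : ¬ ∃ j : M, (j : L) ∈ Q.seesLn v ∧ Q.inc i j := fun ⟨j, hjv, hij⟩ => h j j.2 hjv hij
  rw [ptGens, dif_neg hi, dif_neg h', Module.Basis.span_eq]

theorem span_lnGens_of_mem {j : L} (hj : j ∈ M) {s : Fin 2}
    (h : ¬ (s = 0 ∧ ∃ i : Q.seesPt v, Q.inc i j)) :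
    Submodule.span ℂ (Set.range (Q.lnGens K M x v j s)) =
      (Submodule.span ℂ (Set.range ((Q.forget K M).lnFrame x ⟨j, hj⟩))).map
        ((cameraOfVars x).proj v) := by
  rw [lnGens, dif_pos ⟨hj, h⟩, span_proj (by norm_num)]

theorem span_lnGens_eq_top {j : L} {s : Fin 2}
    (h : ¬ (j ∈ M ∧ ¬ (s = 0 ∧ ∃ i : Q.seesPt v, Q.inc i j))) :
    Submodule.span ℂ (Set.range (Q.lnGens K M x v j s)) = ⊤ := by
  rw [lnGens, dif_neg h, Module.Basis.span_eq]

/-- `c` lists vectors that lie in the subspaces spanned by `ptGens` and `lnGens`. -/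
def IsCompatible (Q : PL1P P L) (x : SpaceVar K M → ℂ)
    (c : ImageVar Q.toPointLineProblem → ℂ) : Prop :=
  (∀ v (i : Q.seesPt v), (fun a => c (.pt v i 0 a)) ∈
    Submodule.span ℂ (Set.range (Q.ptGens K M x v i))) ∧
  ∀ v (j : Q.seesLn v) s, (fun a => c (.ln v j s a)) ∈
    Submodule.span ℂ (Set.range (Q.lnGens K M x v j s))

theorem isCompatible_imageOfVars (x : SpaceVar K M ⊕ ImageVar Q.toPointLineProblem → ℂ) :
    Q.IsCompatible (x ∘ Sum.inl) (Q.imageOfVars K M x) := by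
  constructor
  · intro v i
    convert (Submodule.sum_mem _ fun t (_ : t ∈ Finset.univ) => Submodule.smul_mem _
      (x (.inr (.pt v i 0 t))) (Submodule.subset_span
        ⟨t, rfl⟩ : _ ∈ Submodule.span ℂ (Set.range (Q.ptGens K M (x ∘ Sum.inl) v i)))) using 1
    ext a
    simp [imageOfVars]
  · intro v j s
    convert (Submodule.sum_mem _ fun t (_ : t ∈ Finset.univ) => Submodule.smul_mem _
      (x (.inr (.ln v j s t))) (Submodule.subset_span
        ⟨t, rfl⟩ : _ ∈ Submodule.span ℂ (Set.range (Q.lnGens K M (x ∘ Sum.inl) v j s)))) using 1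
    ext a
    simp [imageOfVars]

/-- The images described by `imageOfVars` are all the compatible ones. -/
theorem IsCompatible.exists_imageOfVars_eq {c : ImageVar Q.toPointLineProblem → ℂ}
    (h : Q.IsCompatible x c) : ∃ γ, Q.imageOfVars K M (Sum.elim x γ) = c := by
  choose p hp using fun v i => (Submodule.mem_span_range_iff_exists_fun ℂ).1 (h.1 v i)
  choose l hl using fun v j s => (Submodule.mem_span_range_iff_exists_fun ℂ).1 (h.2 v j s)
  refine ⟨fun | .pt v i s t => p v i t | .ln v j s t => l v j s t, ?_⟩
  ext (⟨v, i, s, a⟩ | ⟨v, j, s, a⟩)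
  · have := congrFun (hp v i) a
    rw [Subsingleton.elim s 0, ← this]
    simp [imageOfVars, Sum.elim_comp_inl]
  · have := congrFun (hl v j s) a
    rw [← this]
    simp [imageOfVars, Sum.elim_comp_inl]


end PL1P

namespace PL1P

variable {P L : Type*} {Q : PL1P P L} {K : Set P} {M : Set L}

theorem cameraOfVars_eq {S : SpaceConfig P L} {x : SpaceVar P L → ℂ}
    (h : S.IsCoord (Q.spaceChart x)) : cameraOfVars x = S.cam := by
  ext1
  · ext v a b
    exact h.2.2.1 v a b
  · ext v a
    exact h.2.2.2 v a

theorem spaceForget_mem_solutions {y : ImageConfig Q.toPointLineProblem} {S : SpaceConfig P L}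
    (h : S ∈ Q.solutions y) :
    spaceForget K M S ∈ (Q.forget K M).solutions (Q.imageForget K M y) :=
  ⟨fun i j hij => h.1 i j hij, fun v i => h.2.1 v ⟨i.1.1, i.2⟩, fun v j => h.2.2 v ⟨j.1.1, j.2⟩⟩

/-- Images are compatible with each solution of the problem after forgetting. -/
theorem isCompatible_of_mem_solutions {y : ImageConfig Q.toPointLineProblem}
    (hKM : ∀ i ∉ K, ∀ j ∈ M, ∀ j' ∈ M, Q.inc i j → Q.inc i j' → j = j')
    {c : ImageVar Q.toPointLineProblem → ℂ} (hc : y.IsCoord (Q.imageChart c))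
    {S : SpaceConfig K M} (hS : S ∈ (Q.forget K M).solutions (Q.imageForget K M y))
    {x : SpaceVar K M → ℂ} (hx : S.IsCoord ((Q.forget K M).spaceChart x)) :
    Q.IsCompatible x c := by
  have hy : y ∈ Q.imageVariety := (Q.mem_imageVariety_iff y).2 ⟨c, hc⟩
  have hcam := cameraOfVars_eq hx
  have hln : ∀ v (j : L) (hj : j ∈ M) (hjv : j ∈ Q.seesLn v),
      (Submodule.span ℂ (Set.range ((Q.forget K M).lnFrame x ⟨j, hj⟩))).map
        ((cameraOfVars x).proj v) = (y.ln v ⟨j, hjv⟩).1 := by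
    intro v j hj hjv
    rw [hcam]
    exact (congrArg _ (hx.2.1 ⟨j, hj⟩)).trans (hS.2.2 v ⟨⟨j, hj⟩, hjv⟩)
  constructor
  · intro v i
    by_cases hi : (i : P) ∈ K
    · rw [span_ptGens_of_mem hi, hcam]
      have h1 := (congrArg _ (hx.1 ⟨i, hi⟩)).trans (hS.2.1 v ⟨⟨i, hi⟩, i.2⟩)
      exact h1.ge ((hc.1 v i).mem 0)
    · by_cases h : ∃ j ∈ M, j ∈ Q.seesLn v ∧ Q.inc i j
      · obtain ⟨j, hj, hjv, hij⟩ := h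
        rw [span_ptGens_of_inc hKM hi hj hjv hij, hln v j hj hjv]
        exact hy v i ⟨j, hjv⟩ hij ((hc.1 v i).mem 0)
      · push Not at h
        rw [span_ptGens_eq_top hi h]
        trivial
  · intro v j s
    by_cases h : (j : L) ∈ M ∧ ¬ (s = 0 ∧ ∃ i : Q.seesPt v, Q.inc i j)
    · rw [span_lnGens_of_mem h.1 h.2, hln v j h.1 j.2]
      convert (hc.2 v j).mem s using 1
      exact funext fun a => (imageChart_ln_of_not h.2 c a).symm
    · rw [span_lnGens_eq_top h]
      trivial

/-- If the images of `k` vectors span a space of dimension `k`, then the vectors are linearly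
independent. -/
theorem linearIndependent_of_le_map {m n k : ℕ} {b : Fin k → Fin n → ℂ}
    {A : (Fin n → ℂ) →ₗ[ℂ] (Fin m → ℂ)} {W : Gr k m}
    (h : W.1 ≤ (Submodule.span ℂ (Set.range b)).map A) :
    LinearIndependent ℂ b ∧ (Submodule.span ℂ (Set.range b)).map A = W.1 := by
  have h1 := Submodule.finrank_mono h
  have h2 := Submodule.finrank_map_le A (Submodule.span ℂ (Set.range b))
  have h3 := finrank_range_le_card (R := ℂ) b
  rw [W.2] at h1
  rw [Fintype.card_fin, Set.finrank] at h3
  refine ⟨?_, (Submodule.eq_of_le_of_finrank_le h (by rw [W.2]; omega)).symm⟩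
  rw [linearIndependent_iff_card_eq_finrank_span, Set.finrank, Fintype.card_fin]
  omega

/-- Coordinates that are compatible with an image give a solution of the problem after forgetting; that
they are bases of points and lines follows since every point and line is observed. -/
theorem IsCompatible.exists_mem_solutions (hQ : (Q.forget K M).IsTame)
    (hKM : ∀ i ∉ K, ∀ j ∈ M, ∀ j' ∈ M, Q.inc i j → Q.inc i j' → j = j')
    {x : SpaceVar K M → ℂ} {c : ImageVar Q.toPointLineProblem → ℂ} (h : Q.IsCompatible x c)
    {y : ImageConfig Q.toPointLineProblem} (hc : y.IsCoord (Q.imageChart c)) :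
    ∃ S ∈ (Q.forget K M).solutions (Q.imageForget K M y), S.cam = cameraOfVars x := by
  have hpt : ∀ v (i : K) (hiv : (i : P) ∈ Q.seesPt v), (y.pt v ⟨i, hiv⟩).1 ≤
      (Submodule.span ℂ (Set.range ((Q.forget K M).ptFrame x i))).map
        ((cameraOfVars x).proj v) := by
    intro v i hiv
    rw [Gr.isFrame_one_iff.1 (hc.1 v ⟨i, hiv⟩), Submodule.span_singleton_le_iff_mem,
      ← span_ptGens_of_mem i.2]
    exact h.1 v ⟨i, hiv⟩
  have hinc : ∀ (i : K) (j : M), Q.inc i j →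
      Submodule.span ℂ (Set.range ((Q.forget K M).ptFrame x i)) ≤
        Submodule.span ℂ (Set.range ((Q.forget K M).lnFrame x j)) := by
    intro i j hij
    rw [Submodule.span_le]
    rintro _ ⟨s, rfl⟩
    refine Submodule.subset_span ⟨0, ?_⟩
    ext a
    rw [Subsingleton.elim s 0]
    exact spaceChart_ln_of_inc (Q := Q.forget K M) hij x a
  have hln : ∀ v (j : M) (hjv : (j : L) ∈ Q.seesLn v), (y.ln v ⟨j, hjv⟩).1 ≤
      (Submodule.span ℂ (Set.range ((Q.forget K M).lnFrame x j))).map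
        ((cameraOfVars x).proj v) := by
    intro v j hjv
    rw [← (hc.2 v ⟨j, hjv⟩), Submodule.span_le]
    rintro _ ⟨s, rfl⟩
    by_cases hs : s = 0 ∧ ∃ i : Q.seesPt v, Q.inc i j
    · obtain ⟨rfl, i, hij⟩ := hs
      have : (fun a => Q.imageChart c (.ln v ⟨j, hjv⟩ 0 a)) = fun a => c (.pt v i 0 a) :=
        funext fun a => imageChart_ln_of_inc hij c a
      simp only [SetLike.mem_coe]
      rw [this]
      have hi := h.1 v i
      by_cases hiK : (i : P) ∈ K
      · rw [span_ptGens_of_mem hiK] at hi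
        exact Submodule.map_mono (hinc ⟨i, hiK⟩ j hij) hi
      · rwa [span_ptGens_of_inc hKM hiK j.2 hjv hij] at hi
    · have := h.2 v ⟨j, hjv⟩ s
      rw [span_lnGens_of_mem j.2 hs] at this
      rwa [← show (fun a => Q.imageChart c (.ln v ⟨j, hjv⟩ s a)) =
        fun a => c (.ln v ⟨j, hjv⟩ s a) from funext fun a => imageChart_ln_of_not hs c a] at this
  have hptli : ∀ i, LinearIndependent ℂ ((Q.forget K M).ptFrame x i) := fun i => by
    obtain ⟨v, hv⟩ := hQ.exists_seesPt i
    exact (linearIndependent_of_le_map (hpt v i hv)).1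
  have hlnli : ∀ j, LinearIndependent ℂ ((Q.forget K M).lnFrame x j) := fun j => by
    obtain ⟨v, -, -, hv, -⟩ := hQ.exists_seesLn j
    exact (linearIndependent_of_le_map (hln v j hv)).1
  exact ⟨⟨fun i => Gr.ofLinearIndependent _ (hptli i), fun j => Gr.ofLinearIndependent _ (hlnli j),
    cameraOfVars x⟩, ⟨hinc, fun v i => (linearIndependent_of_le_map (hpt v i.1 i.2)).2,
      fun v j => (linearIndependent_of_le_map (hln v j.1 j.2)).2⟩, rfl⟩

section Polynomial

variable {σ : Type*}

theorem isPolyFun_proj {x : (σ → ℂ) → SpaceVar P L → ℂ} (hx : ∀ k, IsPolyFun fun z => x z k)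
    {p : (σ → ℂ) → Fin 4 → ℂ} (hp : ∀ a, IsPolyFun fun z => p z a) (v a : Fin 3) :
    IsPolyFun fun z => (cameraOfVars (x z)).proj v (p z) a := by
  simp only [CameraConfig.proj_apply]
  exact .add (.sum _ fun b => .mul ((isPolyFun_cameraOfVars_R v a b).comp hx) (hp _))
    (.mul ((isPolyFun_cameraOfVars_t v a).comp hx) (hp _))

theorem isPolyFun_center {x : (σ → ℂ) → SpaceVar P L → ℂ} (hx : ∀ k, IsPolyFun fun z => x z k)
    (v : Fin 3) (a : Fin 4) : IsPolyFun fun z => (cameraOfVars (x z)).center v a := by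
  refine Fin.lastCases ?_ (fun b => ?_) a
  · simp only [CameraConfig.center, Fin.snoc_last]
    exact .const 1
  · simp only [CameraConfig.center_castSucc]
    exact .neg (.sum _ fun a => .mul ((isPolyFun_cameraOfVars_R v a b).comp hx)
      ((isPolyFun_cameraOfVars_t v a).comp hx))

theorem isPolyFun_padded {k n m : ℕ} {b : (σ → ℂ) → Fin k → Fin m → ℂ}
    (hb : ∀ s a, IsPolyFun fun z => b z s a) (t : Fin n) (a : Fin m) :
    IsPolyFun fun z => padded (b z) t a := by
  by_cases h : (t : ℕ) < k
  · simpa only [padded, dif_pos h] using hb _ a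
  · simpa only [padded, dif_neg h, Pi.zero_apply] using .const 0

theorem isPolyFun_ptGens {x : (σ → ℂ) → SpaceVar K M → ℂ} (hx : ∀ k, IsPolyFun fun z => x z k)
    (v : Fin 3) (i : P) (t a : Fin 3) : IsPolyFun fun z => Q.ptGens K M (x z) v i t a := by
  unfold ptGens
  split_ifs
  · exact isPolyFun_padded (fun s a => isPolyFun_proj hx
      (fun b => ((Q.forget K M).isPolyFun_spaceChart _).comp hx) v a) t a
  · exact isPolyFun_padded (fun s a => isPolyFun_proj hx
      (fun b => ((Q.forget K M).isPolyFun_spaceChart _).comp hx) v a) t a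
  · exact .const _

theorem isPolyFun_lnGens {x : (σ → ℂ) → SpaceVar K M → ℂ} (hx : ∀ k, IsPolyFun fun z => x z k)
    (v : Fin 3) (j : L) (s : Fin 2) (t a : Fin 3) :
    IsPolyFun fun z => Q.lnGens K M (x z) v j s t a := by
  unfold lnGens
  split_ifs
  · exact isPolyFun_padded (fun s a => isPolyFun_proj hx
      (fun b => ((Q.forget K M).isPolyFun_spaceChart _).comp hx) v a) t a
  · exact .const _

theorem isPolyFun_imageOfVars (k : ImageVar Q.toPointLineProblem) :
    IsPolyFun fun x => Q.imageOfVars K M x k := by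
  have hx : ∀ k, IsPolyFun fun z : (SpaceVar K M ⊕ ImageVar Q.toPointLineProblem → ℂ) =>
      (z ∘ Sum.inl) k := fun k => .coord _
  rcases k with ⟨v, i, s, a⟩ | ⟨v, j, s, a⟩
  · exact .sum _ fun t => .mul (.coord _) (isPolyFun_ptGens hx v i t a)
  · exact .sum _ fun t => .mul (.coord _) (isPolyFun_lnGens hx v j s t a)

end Polynomial

/-- The determinant that vanishes if the image of the `w`-th camera center in view `v` lies on the
image of the line `j`. -/
def epipoleDet (Q : PL1P P L) (C : CameraConfig) (v w : Fin 3) (j : Q.seesLn v)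
    (c : ImageVar Q.toPointLineProblem → ℂ) : ℂ :=
  Matrix.det (Matrix.of ![C.proj v (C.center w), fun a => Q.imageChart c (.ln v j 0 a),
    fun a => Q.imageChart c (.ln v j 1 a)])

theorem epipoleDet_eq_zero {C : CameraConfig} {v w : Fin 3} {j : Q.seesLn v}
    {c : ImageVar Q.toPointLineProblem → ℂ} {y : ImageConfig Q.toPointLineProblem}
    (hc : y.IsCoord (Q.imageChart c)) (h : C.proj v (C.center w) ∈ (y.ln v j).1) :
    Q.epipoleDet C v w j c = 0 := by
  by_contra hdet
  have hli : LinearIndependent ℂ ![C.proj v (C.center w),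
      fun a => Q.imageChart c (.ln v j 0 a), fun a => Q.imageChart c (.ln v j 1 a)] :=
    Matrix.linearIndependent_rows_iff_isUnit.2
      ((Matrix.isUnit_iff_isUnit_det _).2 (isUnit_iff_ne_zero.2 hdet))
  have hle : Submodule.span ℂ (Set.range ![C.proj v (C.center w),
      fun a => Q.imageChart c (.ln v j 0 a), fun a => Q.imageChart c (.ln v j 1 a)]) ≤
        (y.ln v j).1 := by
    rw [Submodule.span_le]
    rintro _ ⟨s, rfl⟩
    fin_cases s
    exacts [h, (hc.2 v j).mem 0, (hc.2 v j).mem 1]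
  have := Submodule.finrank_mono hle
  rw [finrank_span_eq_card hli, (y.ln v j).2, Fintype.card_fin] at this
  omega

theorem exists_linearIndependent_triple {e a : Fin 3 → ℂ} (h : LinearIndependent ℂ ![e, a]) :
    ∃ b, (Matrix.of ![e, a, b]).det ≠ 0 := by
  obtain ⟨b, hb⟩ : ∃ b, b ∉ Submodule.span ℂ (Set.range ![e, a]) := by
    by_contra! hb
    have := finrank_span_eq_card h
    rw [Submodule.eq_top_iff'.2 hb, finrank_top, Module.finrank_fin_fun, Fintype.card_fin] at this
    omega
  refine ⟨b, isUnit_iff_ne_zero.1 ((Matrix.isUnit_iff_isUnit_det _).1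
    (Matrix.linearIndependent_rows_iff_isUnit.1 ?_))⟩
  have := linearIndependent_finSnoc.2 ⟨h, hb⟩
  rwa [show (Fin.snoc ![e, a] b : Fin 3 → Fin 3 → ℂ) = ![e, a, b] by
    ext s a; fin_cases s <;> rfl] at this

/-- There are kept points and lines with cameras and compatible images for which the image of a
given forgotten line does not contain the image of a camera center. -/
theorem IsRemovable.exists_epipoleDet_ne_zero [Finite P] [Finite L] (h : Q.IsRemovable K M)
    {v w : Fin 3} (hvw : v ≠ w) {j : Q.seesLn v} (hj : (j : L) ∉ M) :
    ∃ (x : SpaceVar K M → ℂ) (c : ImageVar Q.toPointLineProblem → ℂ), Q.IsCompatible x c ∧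
      Q.epipoleDet (cameraOfVars x) v w j c ≠ 0 := by
  classical
  obtain ⟨S, hS, hg⟩ := (Q.forget K M).exists_isGeneral
  obtain ⟨x, hx⟩ := ((Q.forget K M).mem_spaceVariety_iff S).1 hS
  have hcam := cameraOfVars_eq hx
  obtain ⟨a, hea, ha⟩ : ∃ a, LinearIndependent ℂ ![S.cam.proj v (S.cam.center w), a] ∧
      ∀ (i : P) (hi : i ∈ K), Q.inc i j → a ∈ (S.pt ⟨i, hi⟩).1.map (S.cam.proj v) := by
    have key : ∀ W : Submodule ℂ (Fin 3 → ℂ), ¬ W ≤ Submodule.span ℂ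
        {S.cam.proj v (S.cam.center w)} →
        ∃ a ∈ W, LinearIndependent ℂ ![S.cam.proj v (S.cam.center w), a] := by
      intro W hW
      obtain ⟨a, ha, hae⟩ := SetLike.not_le_iff_exists.1 hW
      refine ⟨a, ha, (LinearIndependent.pair_iff' (hg.proj_center_ne_zero hvw)).2 fun t ht => ?_⟩
      exact hae (ht ▸ Submodule.smul_mem _ _ (Submodule.mem_span_singleton_self _))
    by_cases hanchor : ∃ (i : P) (_ : i ∈ K), Q.inc i j
    · obtain ⟨i, hi, hij⟩ := hanchor
      obtain ⟨a, ha, hli⟩ := key ((S.pt ⟨i, hi⟩).1.map (S.cam.proj v)) fun hle => by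
        have heq := Submodule.eq_of_le_of_finrank_eq hle (by
          rw [finrank_span_singleton (hg.proj_center_ne_zero hvw),
            S.cam.finrank_map_proj (hg.center_notMem_pt v _), (S.pt _).2])
        apply hg.proj_center_notMem hvw ⟨i, hi⟩
        rw [heq]
        exact Submodule.mem_span_singleton_self _
      refine ⟨a, hli, fun i' hi' hij' => ?_⟩
      obtain rfl := Q.at_most_one _ _ _ hij hij'
      exact ha
    · obtain ⟨a, -, hli⟩ := key ⊤ fun hle => by
        have h1 := Submodule.finrank_mono hle
        rw [finrank_span_singleton (hg.proj_center_ne_zero hvw), finrank_top,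
          Module.finrank_fin_fun] at h1
        omega
      exact ⟨a, hli, fun i hi hij => (hanchor ⟨i, hi, hij⟩).elim⟩
  obtain ⟨b, hb⟩ := exists_linearIndependent_triple hea
  let c : ImageVar Q.toPointLineProblem → ℂ
    | .pt v' i _ k => if v' = v ∧ Q.inc i j then a k else 0
    | .ln v' j' s k => if v' = v ∧ (j' : L) = j then (if s = 0 then a k else b k) else 0
  refine ⟨x, c, ⟨fun v' i => ?_, fun v' j' s => ?_⟩, ?_⟩
  · by_cases hi : v' = v ∧ Q.inc i j
    · obtain ⟨rfl, hij⟩ := hi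
      have hca : (fun k => c (.pt v' i 0 k)) = a := funext fun k => if_pos ⟨rfl, hij⟩
      rw [hca]
      by_cases hiK : (i : P) ∈ K
      · rw [span_ptGens_of_mem hiK, hcam]
        convert ha i hiK hij using 1
        exact congrArg _ (hx.1 ⟨i, hiK⟩)
      · rw [span_ptGens_eq_top hiK fun j' hj' _ hij' => ?_]
        · trivial
        · obtain ⟨j₀, hj₀, -⟩ := h.exists_isSinglePin hiK
          rw [(hj₀ j').1 hij', ← (hj₀ j).1 hij] at hj'
          exact hj hj'
    · have hc0 : (fun k => c (.pt v' i 0 k)) = 0 := funext fun k => if_neg hi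
      rw [hc0]
      exact Submodule.zero_mem _
  · by_cases hjj : v' = v ∧ (j' : L) = j
    · rw [span_lnGens_eq_top fun h' => hj (hjj.2 ▸ h'.1)]
      trivial
    · have hc0 : (fun k => c (.ln v' j' s k)) = 0 := funext fun k => if_neg hjj
      rw [hc0]
      exact Submodule.zero_mem _
  · have h0 : (fun k => Q.imageChart c (.ln v j 0 k)) = a := by
      ext k
      by_cases hi : ∃ i : Q.seesPt v, Q.inc i j
      · obtain ⟨i, hij⟩ := hi
        rw [imageChart_ln_of_inc hij]
        exact if_pos ⟨rfl, hij⟩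
      · rw [imageChart_ln_of_not fun h => hi h.2]
        simp [c]
    have h1 : (fun k => Q.imageChart c (.ln v j 1 k)) = b := by
      ext k
      rw [imageChart_ln_of_not fun h => one_ne_zero h.1]
      simp [c]
    rwa [epipoleDet, hcam, h0, h1]

/-- The images of the camera centers in the finitely many solutions of the problem after forgetting
depend algebraically on the image, so that a generic forgotten image line does not contain them. -/
theorem IsRemovable.exists_isPolyFun_of_notMem [Finite P] [Finite L] (h : Q.IsRemovable K M)
    (hQ : (Q.forget K M).IsTame)
    (hKM : ∀ i ∉ K, ∀ j ∈ M, ∀ j' ∈ M, Q.inc i j → Q.inc i j' → j = j')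
    {u : (ImageVar Q.toPointLineProblem → ℂ) → ℂ} (hu : IsPolyFun u) (hu0 : ∃ c, u c ≠ 0)
    (hfin : ∀ c, u c ≠ 0 → ∃ y : ImageConfig Q.toPointLineProblem, y.IsCoord (Q.imageChart c) ∧
      ((Q.forget K M).solutions (Q.imageForget K M y)).Finite)
    {v w : Fin 3} (hvw : v ≠ w) {j : Q.seesLn v} (hj : (j : L) ∉ M) :
    ∃ f, IsPolyFun f ∧ (∃ c, f c ≠ 0) ∧ ∀ c, f c ≠ 0 → ∀ y : ImageConfig Q.toPointLineProblem,
      y.IsCoord (Q.imageChart c) → ∀ S ∈ (Q.forget K M).solutions (Q.imageForget K M y),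
        S.cam.proj v (S.cam.center w) ∉ (y.ln v j).1 := by
  let g : (SpaceVar K M ⊕ ImageVar Q.toPointLineProblem → ℂ) → ℂ := fun x =>
    Q.epipoleDet (cameraOfVars (x ∘ Sum.inl)) v w j (Q.imageOfVars K M x)
  have hx : ∀ k, IsPolyFun fun z : (SpaceVar K M ⊕ ImageVar Q.toPointLineProblem → ℂ) =>
      (z ∘ Sum.inl) k := fun k => .coord _
  have hg : IsPolyFun g := by
    refine .det fun s a => ?_
    fin_cases s
    · exact isPolyFun_proj hx (fun b => isPolyFun_center hx w b) v a
    · exact (Q.isPolyFun_imageChart (.ln v j 0 a)).comp isPolyFun_imageOfVars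
    · exact (Q.isPolyFun_imageChart (.ln v j 1 a)).comp isPolyFun_imageOfVars
  obtain ⟨x, c, hxc, hne⟩ := h.exists_epipoleDet_ne_zero hvw hj
  obtain ⟨γ, hγ⟩ := hxc.exists_imageOfVars_eq
  obtain ⟨f, hf, hf0, hfg⟩ := IsPolyFun.exists_of_finite_values
    (F := Q.imageOfVars K M) isPolyFun_imageOfVars hg
    ⟨Sum.elim x γ, by
      change Q.epipoleDet (cameraOfVars (Sum.elim x γ ∘ Sum.inl)) v w j _ ≠ 0
      rwa [hγ, Sum.elim_comp_inl]⟩ hu hu0 (fun c hc => by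
      obtain ⟨y, hy, hsol⟩ := hfin c hc
      refine (hsol.image fun S => Q.epipoleDet S.cam v w j c).subset ?_
      rintro z ⟨x, rfl, rfl⟩
      obtain ⟨S, hS, hSx⟩ := (isCompatible_imageOfVars x).exists_mem_solutions hQ hKM hy
      exact ⟨S, hS, congrArg (fun C => Q.epipoleDet C v w j _) hSx⟩)
  refine ⟨f, hf, hf0, fun c hc y hy S hS hmem => hc ?_⟩
  obtain ⟨x, hx⟩ := ((Q.forget K M).mem_spaceVariety_iff S).1 hS.1
  obtain ⟨γ, rfl⟩ := (isCompatible_of_mem_solutions hKM hy hS hx).exists_imageOfVars_eq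
  apply hfg
  change Q.epipoleDet (cameraOfVars (Sum.elim x γ ∘ Sum.inl)) v w j _ = 0
  rw [Sum.elim_comp_inl, cameraOfVars_eq hx]
  exact epipoleDet_eq_zero hy hmem

/-- Over a generic image, the solutions of the problem after forgetting avoid the epipoles, so that
each of them extends uniquely to a solution of the given problem. -/
theorem IsRemovable.isMinimal [Finite P] [Finite L] (h : Q.IsRemovable K M)
    (hmin : (Q.forget K M).IsMinimal) : Q.IsMinimal := by
  have hQ := isTame_of_isMinimal hmin
  have hKM : ∀ i ∉ K, ∀ j ∈ M, ∀ j' ∈ M, Q.inc i j → Q.inc i j' → j = j' :=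
    h.isReducibleTo.1
  obtain ⟨U, hU, hUd, hUsol⟩ := hmin
  obtain ⟨y₀, hy₀, hy₀U⟩ := closure_nonempty_iff.1
    ((Q.forget K M).exists_mem_imageVariety.mono hUd)
  obtain ⟨y₁, hy₁, rfl⟩ := exists_imageForget_eq hKM hy₀
  obtain ⟨c₁, hc₁⟩ := (Q.mem_imageVariety_iff y₁).1 hy₁
  obtain ⟨u, hu, huc, huU⟩ := Q.isPolyChart_imageChart.exists_isPolyFun_of_isOpen
    (fun _ _ _ h h' => h.eq h') (hU.preimage (Q.continuous_imageForget K M)) hc₁ hy₀U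
  have hsol : ∀ c, u c ≠ 0 → ∀ y : ImageConfig Q.toPointLineProblem, y.IsCoord (Q.imageChart c) →
      ((Q.forget K M).solutions (Q.imageForget K M y)).Nonempty ∧
        ((Q.forget K M).solutions (Q.imageForget K M y)).Finite := by
    intro c hc y hy
    obtain ⟨y', hy'U, hy'⟩ := huU c hc
    obtain rfl := hy.eq hy'
    have hyv : y ∈ Q.imageVariety := (Q.mem_imageVariety_iff y).2 ⟨c, hy⟩
    exact hUsol _ ⟨fun v i j hij => hyv v ⟨i.1.1, i.2⟩ ⟨j.1.1, j.2⟩ hij, hy'U⟩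
  have hf : ∀ (k : (v : Fin 3) × Fin 3 × Q.seesLn v), ∃ f, IsPolyFun f ∧ (∃ c, f c ≠ 0) ∧
      ∀ c, f c ≠ 0 → ∀ y : ImageConfig Q.toPointLineProblem, y.IsCoord (Q.imageChart c) →
        ∀ S ∈ (Q.forget K M).solutions (Q.imageForget K M y), k.1 ≠ k.2.1 → (k.2.2 : L) ∉ M →
          S.cam.proj k.1 (S.cam.center k.2.1) ∉ (y.ln k.1 k.2.2).1 := by
    rintro ⟨v, w, j⟩
    by_cases hk : v ≠ w ∧ (j : L) ∉ M
    · obtain ⟨f, hf, hf0, hfy⟩ := h.exists_isPolyFun_of_notMem hQ hKM hu ⟨_, huc⟩ (fun c hc => by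
        obtain ⟨y, -, hy⟩ := huU c hc
        exact ⟨y, hy, (hsol c hc y hy).2⟩) hk.1 hk.2
      exact ⟨f, hf, hf0, fun c hc y hy S hS _ _ => hfy c hc y hy S hS⟩
    · exact ⟨fun _ => 1, .const 1, ⟨0, one_ne_zero⟩,
        fun c _ y _ S _ h1 h2 => (hk ⟨h1, h2⟩).elim⟩
  choose f hf hf0 hfy using hf
  have := Fintype.ofFinite ((v : Fin 3) × Fin 3 × Q.seesLn v)
  obtain ⟨c, hc⟩ := IsPolyFun.exists_forall_ne_zero Finset.univ hf fun k _ => hf0 k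
  have hprod : IsPolyFun fun c => ∏ k, f k c := .prod _ hf
  obtain ⟨V, hV, hVd, hVy⟩ := Q.forGeneric_exists_ne_zero (hu.mul hprod)
    (hu.exists_ne_zero_and_ne_zero hprod ⟨_, huc⟩ ⟨c, Finset.prod_ne_zero_iff.2 hc⟩ |>.imp
      fun c hc => mul_ne_zero hc.1 hc.2)
  refine ⟨V, hV, hVd, fun y hy => ?_⟩
  obtain ⟨c, hyc, hne⟩ := hVy y hy
  have hfc := Finset.prod_ne_zero_iff.1 (right_ne_zero_of_mul hne)
  obtain ⟨⟨S, hS⟩, hfin⟩ := hsol c (left_ne_zero_of_mul hne) y hyc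
  have havoid : ∀ S ∈ (Q.forget K M).solutions (Q.imageForget K M y),
      Q.AvoidsEpipoles S.cam M y := fun S hS j hj v w hvw hjv _ =>
    hfy ⟨v, w, ⟨j, hjv⟩⟩ c (hfc _ (Finset.mem_univ _)) y hyc S hS hvw hj
  constructor
  · obtain ⟨T, hT, hTy, -⟩ := h.exists_lift hS.1 hy.1 hS.2 (havoid S hS)
    exact ⟨T, hT, hTy⟩
  · refine Set.Finite.of_injOn (f := spaceForget K M) (fun T hT => spaceForget_mem_solutions hT)
      (fun T₁ h₁ T₂ h₂ h₁₂ => ?_) hfin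
    have hgen : Q.AvoidsEpipoles T₁.cam M y :=
      havoid (spaceForget K M T₁) (spaceForget_mem_solutions h₁)
    exact h.lift_unique h₁ h₂ h₁₂ hgen

end PL1P

end

theorem theorem2 {P L : Type*} [Finite P] [Finite L] (Q : PL1P P L) :
    -- a minimal PL1P is reducible to a unique reduced PL1P, and this is what is forgotten
    (Q.IsMinimal →
      ∃ (K : Set P) (M : Set L),
        (Q.IsReducibleTo K M ∧ (Q.forget K M).IsReduced) ∧
        (∀ (K' : Set P) (M' : Set L),
          Q.IsReducibleTo K' M' → (Q.forget K' M').IsReduced → K' = K ∧ M' = M) ∧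
        (∀ i, i ∉ K ↔
          Q.IsOneViewPointOnFullPin i ∨ ∃ j, Q.IsOneViewPointWithTwoViewPin i j) ∧
        (∀ j, j ∉ M ↔
          Q.IsTwoViewPin j ∨ Q.IsTwoViewFreeLine j ∨
            ∃ i, Q.IsOneViewPointWithTwoViewPin i j)) ∧
    -- if a minimal PL1P arises from `Q` by forgetting any collection of features of these four
    -- kinds, then `Q` is minimal
    (∀ (K : Set P) (M : Set L),
      (∀ i ∉ K, Q.IsOneViewPointOnFullPin i ∨ ∃ j ∉ M, Q.IsOneViewPointWithTwoViewPin i j) →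
      (∀ j ∉ M, Q.IsTwoViewPin j ∨ Q.IsTwoViewFreeLine j ∨
        ∃ i ∉ K, Q.IsOneViewPointWithTwoViewPin i j) →
      (Q.forget K M).IsMinimal → Q.IsMinimal) := by
  refine ⟨fun h => ?_, fun K M hK hM hmin => ?_⟩
  · have ht := PL1P.isTame_of_isMinimal h
    refine ⟨Q.coreKeptPoints, Q.coreKeptLines, ⟨Q.isRemovable_core.isReducibleTo, ht.isReduced_core⟩,
      fun K' M' hred hK' => (ht.isRemovable_of_isReducibleTo hred).eq_core hK',
      fun i => not_not, fun j => not_not⟩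
  · exact PL1P.IsRemovable.isMinimal ⟨fun i hi => (hK i hi).imp id fun ⟨j, _, hj⟩ => ⟨j, hj⟩, hM⟩ hmin
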